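/- Let $\tfrac{10}{3}<p<6$ and $c>0$. All functions are real-valued. Let $H^1_r$ be the Hilbert space of radially symmetric functions in $H^1(\mathbb R^3)$, with $\|u\|^2=\int|\nabla u|^2+\int|u|^2$, and let $H^{-1}_r$ be its dual; a function $u\in H^1_r$ is identified with the functional $\varphi\mapsto\int u\varphi$. For $u\in H^1_r$ put $$A(u)=\int_{\mathbb R^3}|\nabla u|^2,\quad B(u)=\int_{\mathbb R^3}\!\int_{\mathbb R^3}\frac{|u(x)|^2|u(y)|^2}{|x-y|}\,dx\,dy,\quad C(u)=\int_{\mathbb R^3}|u|^p,$$ $$F(u)=\tfrac12A(u)+\tfrac14B(u)-\tfrac1pC(u),\qquad Q(u)=A(u)+\tfrac14B(u)-\tfrac{3(p-2)}{2p}C(u),$$ and $S_r(c)=\{u\in H^1_r:\|u\|_2^2=c\}$. For $\theta\in\mathbb R$ let $\kappa(u,\theta)(x)=e^{\frac32\theta}u(e^\theta x)$. Let $V_0\subsetneq V_1\subsetneq V_2\subsetneq\cdots$ be finite-dimensional linear subspaces of $H^1_r$ whose union is dense in $H^1_r$. For $n\ge1$ put $$\mu_n=\inf_{0\ne u\in V_{n-1}^\perp}\frac{\|u\|^2}{\|u\|_p^2},\qquad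 L=\max_{x>0}\frac{(x^2+c)^{p/2}}{x^p+c^{p/2}},\qquad \rho_n=L^{-\frac2{p-2}}\mu_n^{\frac2{p-2}},$$ $$B_n=\{u\in V_{n-1}^\perp\cap S_r(c):\|\nabla u\|_2^2=\rho_n\},\qquad b_n=\inf_{B_n}F .$$ Fix $n\ge1$ with $b_n\ge1$, and fix $\theta_n>0$ such that $\bar g_n(t,u):=\kappa(u,(2t-1)\theta_n)$ satisfies, for all $u\in S_r(c)\cap V_n$, $$A(\bar g_n(0,u))<\rho_n<A(\bar g_n(1,u)),\qquad F(\bar g_n(0,u))<b_n,\qquad F(\bar g_n(1,u))<b_n .$$ Let $\Gamma_n$ be the set of continuous maps $g:[0,1]\times(S_r(c)\cap V_n)\to S_r(c)$ that are odd in $u$ and satisfy $g(0,u)=\bar g_n(0,u)$ and $g(1,u)=\bar g_n(1,u)$ for all $u$, and let $$\gamma_n(c)=\inf_{g\in\Gamma_n}\ \max_{0\le t\le1,\ u\in S_r(c)\cap V_n}F(g(t,u)).$$ Let $(u_k)\subset S_r(c)$ be any sequence such that, as $k\to\infty$, $$F(u_k)\to\gamma_n(c),\qquad F'|_{S_r(c)}(u_k)\to0,\qquad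 Q(u_k)\to0,$$ where the second condition means that the dual norm of $F'(u_k)$ restricted to the tangent space $\{w\in H^1_r:\int u_kw=0\}$ tends to $0$. (Such a sequence is automatically bounded in $H^1_r$.) Then there exist $\lambda_n\in\mathbb R$ and $u_n\in H^1_r$ such that, up to a subsequence of $(u_k)$, 1. $u_k\rightharpoonup u_n\ne0$ weakly in $H^1_r$; 2. $-\Delta u_k-\lambda_nu_k+(|x|^{-1}*|u_k|^2)u_k-|u_k|^{p-2}u_k\to0$ in $H^{-1}_r$; 3. $-\Delta u_n-\lambda_nu_n+(|x|^{-1}*|u_n|^2)u_n-|u_n|^{p-2}u_n=0$ in $H^{-1}_r$. Moreover, if $\lambda_n<0$, then (along this subsequence) $u_k\to u_n$ strongly in $H^1_r$; in particular $\|u_n\|_2^2=c$, $F(u_n)=\gamma_n(c)$, and $F'(u_n)-\lambda_nu_n=0$ in $H^{-1}_r$. -/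

import Mathlib

open MeasureTheory Filter Topology Set
open scoped ContDiff

noncomputable section

namespace SchrodingerPoisson

/-- Three-dimensional Euclidean space. -/
abbrev R3 : Type := EuclideanSpace ℝ (Fin 3)

/-- `G` is the weak gradient of `f`: integration by parts holds against every smooth compactly
supported test function, in every direction `v`. -/
def IsWeakGradient (f : R3 → ℝ) (G : R3 → R3) : Prop :=
  ∀ ψ : R3 → ℝ, ContDiff ℝ ∞ ψ → HasCompactSupport ψ → ∀ v : R3,
    ∫ x, f x * fderiv ℝ ψ x v = - ∫ x, inner ℝ (G x) v * ψ x

/-- `f` is radially symmetric: it agrees a.e. with its composition with each linear isometry. -/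
def IsRadial (f : R3 → ℝ) : Prop :=
  ∀ O : R3 ≃ₗᵢ[ℝ] R3, (fun x => f (O x)) =ᵐ[volume] f

/-- The Hilbert space `L²(ℝ³) × L²(ℝ³; ℝ³)`, with squared norm `‖f‖₂² + ‖G‖₂²`. -/
abbrev L2Pair : Type :=
  WithLp 2 (Lp ℝ 2 (volume : Measure R3) × Lp R3 2 (volume : Measure R3))

lemma integrable_mul_test {f g : R3 → ℝ} (hf : MemLp f 2 volume) (hg : Continuous g)
    (hc : HasCompactSupport g) : Integrable (fun x => f x * g x) volume :=
  MemLp.integrable_mul (p := 2) (q := 2) hf (hg.memLp_of_hasCompactSupport hc)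

lemma integrable_mul_fderiv {f ψ : R3 → ℝ} (hf : MemLp f 2 volume) (hψ : ContDiff ℝ ∞ ψ)
    (hc : HasCompactSupport ψ) (v : R3) :
    Integrable (fun x => f x * fderiv ℝ ψ x v) volume :=
  integrable_mul_test hf ((hψ.continuous_fderiv (by simp)).clm_apply continuous_const)
    (hc.fderiv_apply ℝ v)

lemma integrable_inner_mul {G : R3 → R3} {ψ : R3 → ℝ} (hG : MemLp G 2 volume)
    (hψ : ContDiff ℝ ∞ ψ) (hc : HasCompactSupport ψ) (v : R3) :
    Integrable (fun x => inner ℝ (G x) v * ψ x) volume :=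
  integrable_mul_test (hG.inner_const v) hψ.continuous hc

/-- The space `H¹_r(ℝ³)` of radially symmetric real functions of class `H¹`, realised as the
subspace of `L² × L²` of the pairs (radial function, weak gradient of it).  It inherits the inner
product `∫ ∇u·∇v + ∫ u v`. -/
def H1r : Submodule ℝ L2Pair where
  carrier := {w | IsWeakGradient w.fst w.snd ∧ IsRadial w.fst}
  zero_mem' := by
    refine ⟨fun ψ _ _ v => ?_, fun O => ?_⟩
    · have h1 : (fun x => (WithLp.fst (0 : L2Pair)) x * fderiv ℝ ψ x v) =ᵐ[volume] 0 := by
        filter_upwards [Lp.coeFn_zero ℝ 2 (volume : Measure R3)] with x hx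
        simp only [WithLp.zero_fst, hx, Pi.zero_apply, zero_mul]
      have h2 : (fun x => inner ℝ ((WithLp.snd (0 : L2Pair)) x) v * ψ x) =ᵐ[volume] 0 := by
        filter_upwards [Lp.coeFn_zero R3 2 (volume : Measure R3)] with x hx
        simp only [WithLp.zero_snd, hx, Pi.zero_apply, inner_zero_left, zero_mul]
      rw [integral_congr_ae h1, integral_congr_ae h2]
      simp
    · have h := Lp.coeFn_zero ℝ 2 (volume : Measure R3)
      have h' := O.measurePreserving.quasiMeasurePreserving.ae h
      filter_upwards [h, h'] with x hx hx'
      simp only [WithLp.zero_fst, hx, hx', Pi.zero_apply]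
  add_mem' := by
    rintro a b ⟨ha, ha'⟩ ⟨hb, hb'⟩
    refine ⟨fun ψ hψ hc v => ?_, fun O => ?_⟩
    · have h1 : (fun x => (a + b).fst x * fderiv ℝ ψ x v) =ᵐ[volume]
          fun x => a.fst x * fderiv ℝ ψ x v + b.fst x * fderiv ℝ ψ x v := by
        filter_upwards [Lp.coeFn_add a.fst b.fst] with x hx
        simp only [WithLp.add_fst, hx, Pi.add_apply, add_mul]
      have h2 : (fun x => inner ℝ ((a + b).snd x) v * ψ x) =ᵐ[volume]
          fun x => inner ℝ (a.snd x) v * ψ x + inner ℝ (b.snd x) v * ψ x := by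
        filter_upwards [Lp.coeFn_add a.snd b.snd] with x hx
        simp only [WithLp.add_snd, hx, Pi.add_apply, inner_add_left, add_mul]
      rw [integral_congr_ae h1, integral_congr_ae h2,
        integral_add (integrable_mul_fderiv (Lp.memLp _) hψ hc v)
          (integrable_mul_fderiv (Lp.memLp _) hψ hc v),
        integral_add (integrable_inner_mul (Lp.memLp _) hψ hc v)
          (integrable_inner_mul (Lp.memLp _) hψ hc v), ha ψ hψ hc v, hb ψ hψ hc v]
      ring
    · have h := Lp.coeFn_add a.fst b.fst
      have h' := O.measurePreserving.quasiMeasurePreserving.ae h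
      filter_upwards [h, h', ha' O, hb' O] with x hx hx' h1 h2
      simp only [WithLp.add_fst, hx, hx', Pi.add_apply, h1, h2]
  smul_mem' := by
    rintro r a ⟨ha, ha'⟩
    refine ⟨fun ψ hψ hc v => ?_, fun O => ?_⟩
    · have h1 : (fun x => (r • a).fst x * fderiv ℝ ψ x v) =ᵐ[volume]
          fun x => r * (a.fst x * fderiv ℝ ψ x v) := by
        filter_upwards [Lp.coeFn_smul r a.fst] with x hx
        simp only [WithLp.smul_fst, hx, Pi.smul_apply, smul_eq_mul, mul_assoc]
      have h2 : (fun x => inner ℝ ((r • a).snd x) v * ψ x) =ᵐ[volume]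
          fun x => r * (inner ℝ (a.snd x) v * ψ x) := by
        filter_upwards [Lp.coeFn_smul r a.snd] with x hx
        simp only [WithLp.smul_snd, hx, Pi.smul_apply, real_inner_smul_left, mul_assoc]
      rw [integral_congr_ae h1, integral_congr_ae h2, integral_const_mul, integral_const_mul,
        ha ψ hψ hc v]
      ring
    · have h := Lp.coeFn_smul r a.fst
      have h' := O.measurePreserving.quasiMeasurePreserving.ae h
      filter_upwards [h, h', ha' O] with x hx hx' h1
      simp only [WithLp.smul_fst, hx, hx', Pi.smul_apply, h1]

/-- The function underlying an element of `H¹_r(ℝ³)`. -/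
def fn (u : H1r) : R3 → ℝ := (u : L2Pair).fst

/-- The weak gradient of an element of `H¹_r(ℝ³)`. -/
def grad (u : H1r) : R3 → R3 := (u : L2Pair).snd

/-- `A(u) = ∫ |∇u|²`. -/
def A (u : H1r) : ℝ := ∫ x, ‖grad u x‖ ^ 2

/-- The Newton-type potential `(|x|⁻¹ * |u|²)(x)`. -/
def potential (u : H1r) (x : R3) : ℝ := ∫ y, |fn u y| ^ 2 / ‖x - y‖

/-- `B(u) = ∫∫ |u(x)|² |u(y)|² / |x - y|`. -/
def B (u : H1r) : ℝ := ∫ x, ∫ y, |fn u x| ^ 2 * |fn u y| ^ 2 / ‖x - y‖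

/-- `C(u) = ∫ |u|ᵖ`. -/
def C (p : ℝ) (u : H1r) : ℝ := ∫ x, |fn u x| ^ p

/-- `D(u) = ∫ |u|²`. -/
def D (u : H1r) : ℝ := ∫ x, |fn u x| ^ 2

/-- The energy functional `F`. -/
def F (p : ℝ) (u : H1r) : ℝ := 1 / 2 * A u + 1 / 4 * B u - 1 / p * C p u

/-- The functional `Q` of the Pohozaev-type identity. -/
def Q (p : ℝ) (u : H1r) : ℝ := A u + 1 / 4 * B u - 3 * (p - 2) / (2 * p) * C p u

/-- The constraint `S_r(c) = {u ∈ H¹_r : ‖u‖₂² = c}`. -/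
def S (c : ℝ) : Set H1r := {u | D u = c}

/-- The `L²` pairing `φ ↦ ∫ u φ` with `u`, as a continuous linear functional on `H¹_r`; this is the
element of the dual space with which `u` is identified. -/
def l2Dual (u : H1r) : StrongDual ℝ H1r :=
  (innerSL ℝ (u : L2Pair).fst).comp
    ((WithLp.fstL 2 ℝ (Lp ℝ 2 (volume : Measure R3)) (Lp R3 2 (volume : Measure R3))).comp
      H1r.subtypeL)

lemma l2Dual_apply (u φ : H1r) : l2Dual u φ = ∫ x, fn u x * fn φ x := by
  change inner ℝ (u : L2Pair).fst (φ : L2Pair).fst = _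
  rw [L2.inner_def]
  refine integral_congr_ae (Eventually.of_forall fun x => ?_)
  exact mul_comm _ _

/-- The tangent space `{w ∈ H¹_r : ∫ u w = 0}` of the constraint at `u`. -/
def tangent (u : H1r) : Submodule ℝ H1r := (l2Dual u).ker

/-- The norm of `F'|_{S_r(c)}(u)`: the dual norm of the Fréchet derivative `F'(u)` restricted to the
tangent space of the constraint at `u`. -/
def constrainedDerivNorm (p : ℝ) (u : H1r) : ℝ :=
  ‖(fderiv ℝ (F p) u).comp (tangent u).subtypeL‖

/-- The left-hand side of the equation
`-Δu - λ u + (|x|⁻¹ * |u|²) u - |u|^(p-2) u`, tested against `φ ∈ H¹_r`. -/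
def eqResidual (p lam : ℝ) (u φ : H1r) : ℝ :=
  (∫ x, inner ℝ (grad u x) (grad φ x)) - lam * (∫ x, fn u x * fn φ x)
    + (∫ x, potential u x * fn u x * fn φ x) - ∫ x, |fn u x| ^ (p - 2) * fn u x * fn φ x

/-- Weak convergence in `H¹_r`. -/
def WeaklyConverges (u : ℕ → H1r) (w : H1r) : Prop :=
  ∀ ℓ : StrongDual ℝ H1r, Tendsto (fun k => ℓ (u k)) atTop (𝓝 (ℓ w))

/-! ### The dilations -/

lemma memLp_dilation {X : Type*} [NormedAddCommGroup X] {f : R3 → X} (hf : MemLp f 2 volume)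
    {r : ℝ} (hr : r ≠ 0) : MemLp (fun x => f (r • x)) 2 volume := by
  have hm : Measurable (fun x : R3 => r • x) := measurable_const_smul r
  have h : MemLp f 2 (Measure.map (fun x : R3 => r • x) volume) := by
    rw [Measure.map_addHaar_smul volume hr]
    exact hf.smul_measure ENNReal.ofReal_ne_top
  exact h.comp_of_map hm.aemeasurable

lemma ae_dilation {P : R3 → Prop} (h : ∀ᵐ x, P x) {r : ℝ} (hr : r ≠ 0) :
    ∀ᵐ x : R3, P (r • x) := by
  have hm : Measurable (fun x : R3 => r • x) := measurable_const_smul r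
  refine ae_of_ae_map hm.aemeasurable ?_
  rw [Measure.map_addHaar_smul volume hr]
  exact Measure.ae_smul_measure h _

lemma memLp_kappa_fn (u : H1r) (θ : ℝ) :
    MemLp (fun x => Real.exp (3 / 2 * θ) * fn u (Real.exp θ • x)) 2 volume :=
  (memLp_dilation (Lp.memLp (u : L2Pair).fst) (Real.exp_ne_zero θ)).const_mul _

lemma memLp_kappa_grad (u : H1r) (θ : ℝ) :
    MemLp (fun x => Real.exp (5 / 2 * θ) • grad u (Real.exp θ • x)) 2 volume :=
  (memLp_dilation (Lp.memLp (u : L2Pair).snd) (Real.exp_ne_zero θ)).const_smul (Real.exp (5 / 2 * θ))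

/-- The dilation `κ(u,θ)(x) = e^{3θ/2} u(e^θ x)`, an element of `H¹_r` with weak gradient
`e^{5θ/2} (∇u)(e^θ x)`. -/
def kappa (u : H1r) (θ : ℝ) : H1r :=
  ⟨WithLp.toLp 2 ((memLp_kappa_fn u θ).toLp _, (memLp_kappa_grad u θ).toLp _), by
    have hf := (memLp_kappa_fn u θ).coeFn_toLp
    have hG := (memLp_kappa_grad u θ).coeFn_toLp
    refine ⟨fun ψ hψ hc v => ?_, fun O => ?_⟩
    · set r := Real.exp θ with hr
      have hr0 : r ≠ 0 := Real.exp_ne_zero θ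
      have e1 : (∫ x, (memLp_kappa_fn u θ).toLp _ x * fderiv ℝ ψ x v)
          = ∫ x, (fun y => Real.exp (3 / 2 * θ) * (fn u y * fderiv ℝ ψ (r⁻¹ • y) v)) (r • x) := by
        refine integral_congr_ae ?_
        filter_upwards [hf] with x hx
        rw [hx, smul_smul, inv_mul_cancel₀ hr0, one_smul]
        ring
      have e2 : (∫ x, inner ℝ ((memLp_kappa_grad u θ).toLp _ x) v * ψ x)
          = ∫ x, (fun y => Real.exp (5 / 2 * θ) * (inner ℝ (grad u y) v * ψ (r⁻¹ • y))) (r • x) := by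
        refine integral_congr_ae ?_
        filter_upwards [hG] with x hx
        rw [hx, smul_smul, inv_mul_cancel₀ hr0, one_smul, real_inner_smul_left]
        ring
      change (∫ x, (memLp_kappa_fn u θ).toLp _ x * fderiv ℝ ψ x v)
          = - ∫ x, inner ℝ ((memLp_kappa_grad u θ).toLp _ x) v * ψ x
      rw [e1, e2, Measure.integral_comp_smul volume
          (fun y => Real.exp (3 / 2 * θ) * (fn u y * fderiv ℝ ψ (r⁻¹ • y) v)),
        Measure.integral_comp_smul volume
          (fun y => Real.exp (5 / 2 * θ) * (inner ℝ (grad u y) v * ψ (r⁻¹ • y))), integral_const_mul,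
        integral_const_mul]
      have key := u.2.1 (fun y => ψ (r⁻¹ • y)) (hψ.comp (contDiff_const_smul _))
        (hc.comp_homeomorph (Homeomorph.smulOfNeZero r⁻¹ (inv_ne_zero hr0))) v
      have e3 : (∫ x, (u : L2Pair).fst x * fderiv ℝ (fun y => ψ (r⁻¹ • y)) x v)
          = r⁻¹ * ∫ x, fn u x * fderiv ℝ ψ (r⁻¹ • x) v := by
        rw [← integral_const_mul]
        refine integral_congr_ae (Eventually.of_forall fun x => ?_)
        have : fderiv ℝ (fun y => ψ (r⁻¹ • y)) x = r⁻¹ • fderiv ℝ ψ (r⁻¹ • x) :=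
          fderiv_comp_smul (f := ψ) r⁻¹
        simp only [this, fn, smul_apply, smul_eq_mul]
        ring
      rw [e3] at key
      have e4 : (∫ x, fn u x * fderiv ℝ ψ (r⁻¹ • x) v)
          = - (r * ∫ x, inner ℝ (grad u x) v * ψ (r⁻¹ • x)) := by
        have := congrArg (fun t => r * t) key
        simp only [mul_inv_cancel_left₀ hr0] at this
        rw [this, mul_neg]
        rfl
      have e5 : Real.exp (5 / 2 * θ) = Real.exp (3 / 2 * θ) * r := by
        rw [hr, ← Real.exp_add]
        ring_nf
      rw [e4, e5]
      simp only [smul_eq_mul]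
      ring
    · have h1 := O.measurePreserving.quasiMeasurePreserving.ae hf
      have h2 := ae_dilation (u.2.2 O) (Real.exp_ne_zero θ)
      filter_upwards [hf, h1, h2] with x a1 a2 a3
      change (memLp_kappa_fn u θ).toLp _ (O x) = (memLp_kappa_fn u θ).toLp _ x
      rw [a1, a2, ← O.map_smul]
      exact congrArg _ a3⟩

/-! ### The min-max scheme -/

/-- `μ_n = inf {‖u‖² / ‖u‖_p² : u ∈ V_{n-1}^⊥, u ≠ 0}`. -/
def mu (p : ℝ) (V : ℕ → Submodule ℝ H1r) (n : ℕ) : ℝ :=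
  sInf ((fun u : H1r => ‖u‖ ^ 2 / C p u ^ (2 / p)) '' {u | u ∈ (V (n - 1))ᗮ ∧ u ≠ 0})

/-- `L = max_{x > 0} (x² + c)^{p/2} / (x^p + c^{p/2})`. -/
def Lconst (p c : ℝ) : ℝ :=
  sSup ((fun x : ℝ => (x ^ 2 + c) ^ (p / 2) / (x ^ p + c ^ (p / 2))) '' Ioi 0)

/-- `ρ_n = L^{-2/(p-2)} μ_n^{2/(p-2)}`. -/
def rho (p c : ℝ) (V : ℕ → Submodule ℝ H1r) (n : ℕ) : ℝ :=
  Lconst p c ^ (-(2 / (p - 2))) * mu p V n ^ (2 / (p - 2))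

/-- `B_n = {u ∈ V_{n-1}^⊥ ∩ S_r(c) : ‖∇u‖₂² = ρ_n}`. -/
def Bset (p c : ℝ) (V : ℕ → Submodule ℝ H1r) (n : ℕ) : Set H1r :=
  {u | u ∈ (V (n - 1))ᗮ ∧ u ∈ S c ∧ A u = rho p c V n}

/-- `b_n = inf_{B_n} F`. -/
def bn (p c : ℝ) (V : ℕ → Submodule ℝ H1r) (n : ℕ) : ℝ := sInf (F p '' Bset p c V n)

/-- The reference map `ḡ_n(t,u) = κ(u, (2t-1)θ)`. -/
def gbar (θ t : ℝ) (u : H1r) : H1r := kappa u ((2 * t - 1) * θ)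

/-- The conditions on the dilation parameter `θ_n > 0` fixed in the min-max scheme. -/
def IsScale (p c : ℝ) (V : ℕ → Submodule ℝ H1r) (n : ℕ) (θ : ℝ) : Prop :=
  0 < θ ∧ ∀ u ∈ S c ∩ (V n : Set H1r),
    A (gbar θ 0 u) < rho p c V n ∧ rho p c V n < A (gbar θ 1 u) ∧
    F p (gbar θ 0 u) < bn p c V n ∧ F p (gbar θ 1 u) < bn p c V n

/-- The class `Γ_n` of continuous maps `[0,1] × (S_r(c) ∩ V_n) → S_r(c)`, odd in `u`, that agree
with `ḡ_n` for `t = 0` and `t = 1`.  (Only the values on this domain matter.) -/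
def Gam (c : ℝ) (V : ℕ → Submodule ℝ H1r) (n : ℕ) (θ : ℝ) : Set (ℝ × H1r → H1r) :=
  {g | ContinuousOn g (Icc 0 1 ×ˢ (S c ∩ (V n : Set H1r))) ∧
    MapsTo g (Icc 0 1 ×ˢ (S c ∩ (V n : Set H1r))) (S c) ∧
    (∀ t ∈ Icc (0 : ℝ) 1, ∀ u ∈ S c ∩ (V n : Set H1r), g (t, -u) = -g (t, u)) ∧
    ∀ u ∈ S c ∩ (V n : Set H1r), g (0, u) = gbar θ 0 u ∧ g (1, u) = gbar θ 1 u}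

/-- The min-max level `γ_n(c) = inf_{g ∈ Γ_n} max F(g(t,u))`. -/
def gam (p c : ℝ) (V : ℕ → Submodule ℝ H1r) (n : ℕ) (θ : ℝ) : ℝ :=
  sInf ((fun g : ℝ × H1r → H1r =>
    sSup ((fun q => F p (g q)) '' (Icc (0 : ℝ) 1 ×ˢ (S c ∩ (V n : Set H1r))))) '' Gam c V n θ)

end SchrodingerPoisson

end

open SchrodingerPoisson

noncomputable section

namespace BorsukUlam

/-- Chains with coefficients in `ℤ/2`, generated by the finite sequences of points of `X`. -/
abbrev Chain (X : Type*) := List X →₀ ZMod 2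

variable {X : Type*}

lemma chain_add_self (c : Chain X) : c + c = 0 := by
  ext t
  simpa using CharTwo.add_self_eq_zero (c t)

/-- The cone with apex `x`: prepend `x` to every sequence. -/
def cone (x : X) : Chain X →ₗ[ZMod 2] Chain X := Finsupp.lmapDomain (ZMod 2) (ZMod 2) (List.cons x)

lemma cone_single (x : X) (l : List X) :
    cone x (Finsupp.single l 1) = Finsupp.single (x :: l) 1 := by
  simp [cone]

/-- The (augmented) boundary of one sequence. -/
def bdryList : List X → Chain X
  | [] => 0
  | x :: l => Finsupp.single l 1 + cone x (bdryList l)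

/-- The boundary of a chain. -/
def bdry : Chain X →ₗ[ZMod 2] Chain X := Finsupp.linearCombination (ZMod 2) bdryList

lemma bdry_single (l : List X) : bdry (Finsupp.single l 1) = bdryList l := by
  simp [bdry]

/-- Two linear maps on chains that agree on generators are equal. -/
lemma linearMap_ext {M : Type*} [AddCommGroup M] [Module (ZMod 2) M]
    {f g : Chain X →ₗ[ZMod 2] M}
    (h : ∀ l, f (Finsupp.single l 1) = g (Finsupp.single l 1)) : f = g :=
  Finsupp.lhom_ext' fun l => LinearMap.ext_ring (h l)

lemma bdry_cone (x : X) (c : Chain X) : bdry (cone x c) = c + cone x (bdry c) := by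
  have : bdry ∘ₗ cone x = LinearMap.id + cone x ∘ₗ bdry := by
    refine linearMap_ext fun l => ?_
    simp [cone_single, bdry_single, bdryList]
  exact LinearMap.congr_fun this c

lemma bdry_bdryList (l : List X) : bdry (bdryList l) = 0 := by
  induction l with
  | nil => simp [bdryList]
  | cons x l ih =>
    rw [bdryList, map_add, bdry_single, bdry_cone, ih, map_zero, add_zero, chain_add_self]

/-- A linear map sends chains supported in `s` into `p` as soon as it does so for generators. -/
lemma map_supported_mem {M : Type*} [AddCommGroup M] [Module (ZMod 2) M] {s : Set (List X)}
    {p : Submodule (ZMod 2) M} {f : Chain X →ₗ[ZMod 2] M}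
    (h : ∀ l ∈ s, f (Finsupp.single l 1) ∈ p) {c : Chain X}
    (hc : c ∈ Finsupp.supported (ZMod 2) (ZMod 2) s) : f c ∈ p := by
  rw [Finsupp.supported_eq_span_single] at hc
  refine (Submodule.span_le.2 ?_ : _ ≤ p.comap f) hc
  rintro _ ⟨l, hl, rfl⟩
  exact h l hl

lemma eqOn_supported {M : Type*} [AddCommGroup M] [Module (ZMod 2) M] {s : Set (List X)}
    {f g : Chain X →ₗ[ZMod 2] M}
    (h : ∀ l ∈ s, f (Finsupp.single l 1) = g (Finsupp.single l 1)) {c : Chain X}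
    (hc : c ∈ Finsupp.supported (ZMod 2) (ZMod 2) s) : f c = g c := by
  have : (f - g) c ∈ (⊥ : Submodule (ZMod 2) M) :=
    map_supported_mem (fun l hl => by simp [h l hl]) hc
  simpa [sub_eq_zero] using this

lemma single_mem_supported {s : Set (List X)} {l : List X} (hl : l ∈ s) :
    (Finsupp.single l 1 : Chain X) ∈ Finsupp.supported (ZMod 2) (ZMod 2) s :=
  Finsupp.single_mem_supported _ _ hl

lemma cone_mem_supported {s t : Set (List X)} {x : X} (h : ∀ l ∈ s, x :: l ∈ t) {c : Chain X}
    (hc : c ∈ Finsupp.supported (ZMod 2) (ZMod 2) s) :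
    cone x c ∈ Finsupp.supported (ZMod 2) (ZMod 2) t :=
  map_supported_mem (fun l hl => by rw [cone_single]; exact single_mem_supported (h l hl)) hc

lemma supported_mono {s t : Set (List X)} (h : s ⊆ t) {c : Chain X}
    (hc : c ∈ Finsupp.supported (ZMod 2) (ZMod 2) s) :
    c ∈ Finsupp.supported (ZMod 2) (ZMod 2) t :=
  Finsupp.supported_mono h hc

lemma bdryList_mem_supported (l : List X) :
    bdryList l ∈ Finsupp.supported (ZMod 2) (ZMod 2) {t | t.length + 1 = l.length ∧ t ⊆ l} := by
  induction l with
  | nil => simp [bdryList]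
  | cons x l ih =>
    refine Submodule.add_mem _ (single_mem_supported ?_) (cone_mem_supported ?_ ih)
    · exact ⟨rfl, List.subset_cons_self x l⟩
    · rintro t ⟨ht1, ht2⟩
      exact ⟨by simpa using ht1, List.cons_subset_cons x ht2⟩

section Subdivision

variable (b : List X → X)

/-- Barycentric subdivision of one sequence of length `n`, with `b` as barycenter. -/
def sdAux : ℕ → List X → Chain X
  | 0, l => Finsupp.single l 1
  | n + 1, l => cone (b l) (Finsupp.linearCombination (ZMod 2) (sdAux n) (bdryList l))

/-- Barycentric subdivision of a chain, with `b` as barycenter. -/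
def sd : Chain X →ₗ[ZMod 2] Chain X :=
  Finsupp.linearCombination (ZMod 2) fun l => sdAux b l.length l

lemma sd_single_nil : sd b (Finsupp.single [] 1) = Finsupp.single [] 1 := by
  simp [sd, sdAux]

lemma sd_single_of_ne_nil {l : List X} (hl : l ≠ []) :
    sd b (Finsupp.single l 1) = cone (b l) (sd b (bdryList l)) := by
  obtain ⟨n, hn⟩ : ∃ n, l.length = n + 1 :=
    Nat.exists_eq_succ_of_ne_zero (by simpa using hl)
  have : sd b (Finsupp.single l 1) = sdAux b l.length l := by simp [sd]
  rw [this, hn, sdAux]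
  congr 1
  refine eqOn_supported (fun t ht => ?_) (bdryList_mem_supported l)
  have : t.length = n := by have := ht.1; omega
  simp [sd, this]

lemma bdry_sd (c : Chain X) : bdry (sd b c) = sd b (bdry c) := by
  have key : ∀ n, ∀ l : List X, l.length = n →
      bdry (sd b (Finsupp.single l 1)) = sd b (bdryList l) := by
    intro n
    induction n with
    | zero =>
      intro l hl
      obtain rfl := List.length_eq_zero_iff.1 hl
      simp [sd_single_nil, bdry_single, bdryList]
    | succ n ih =>
      intro l hl
      have hne : l ≠ [] := by rintro rfl; simp at hl
      rw [sd_single_of_ne_nil b hne, bdry_cone]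
      have : bdry (sd b (bdryList l)) = sd b (bdry (bdryList l)) := by
        refine eqOn_supported (f := bdry ∘ₗ sd b) (g := sd b ∘ₗ bdry) (fun t ht => ?_)
          (bdryList_mem_supported l)
        simp only [LinearMap.comp_apply, bdry_single]
        exact ih t (by have := ht.1; omega)
      rw [this, bdry_bdryList, map_zero, map_zero, add_zero]
  have : bdry ∘ₗ sd b = sd b ∘ₗ bdry :=
    linearMap_ext fun l => by simpa [bdry_single] using key _ l rfl
  exact LinearMap.congr_fun this c

end Subdivision

section Antipode

variable [InvolutiveNeg X]

/-- The antipodal involution on chains. -/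
def antip : Chain X →ₗ[ZMod 2] Chain X :=
  Finsupp.lmapDomain (ZMod 2) (ZMod 2) (List.map fun x => -x)

lemma antip_single (l : List X) :
    antip (Finsupp.single l 1) = Finsupp.single (l.map fun x => -x) 1 := by
  simp [antip]

lemma antip_cone (x : X) (c : Chain X) : antip (cone x c) = cone (-x) (antip c) := by
  have : antip ∘ₗ cone x = cone (-x) ∘ₗ antip :=
    linearMap_ext fun l => by simp [cone_single, antip_single]
  exact LinearMap.congr_fun this c

lemma antip_bdryList (l : List X) : antip (bdryList l) = bdryList (l.map fun x => -x) := by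
  induction l with
  | nil => simp [bdryList]
  | cons x l ih => simp [bdryList, antip_single, antip_cone, ih]

lemma sd_antip {b : List X → X} (hb : ∀ l, b (l.map fun x => -x) = - b l) (c : Chain X) :
    sd b (antip c) = antip (sd b c) := by
  have key : ∀ n, ∀ l : List X, l.length = n →
      sd b (Finsupp.single (l.map fun x => -x) 1) = antip (sd b (Finsupp.single l 1)) := by
    intro n
    induction n with
    | zero =>
      intro l hl
      obtain rfl := List.length_eq_zero_iff.1 hl
      simp [sd_single_nil, antip_single]
    | succ n ih =>
      intro l hl
      have hne : l ≠ [] := by rintro rfl; simp at hl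
      have hne' : (l.map fun x => -x) ≠ [] := by simpa using hne
      rw [sd_single_of_ne_nil b hne, sd_single_of_ne_nil b hne', antip_cone, hb,
        ← antip_bdryList]
      congr 1
      refine eqOn_supported (f := sd b ∘ₗ antip) (g := antip ∘ₗ sd b) (fun t ht => ?_)
          (bdryList_mem_supported l)
      simp only [LinearMap.comp_apply, antip_single]
      exact ih t (by have := ht.1; omega)
  have : sd b ∘ₗ antip = antip ∘ₗ sd b :=
    linearMap_ext fun l => by simpa [antip_single] using key _ l rfl
  exact LinearMap.congr_fun this c

/-- The sum of all sequences `(± e (k-1), …, ± e 0)`: the fundamental cycle of a cross-polytope. -/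
def crossPolytope (e : ℕ → X) : ℕ → Chain X
  | 0 => Finsupp.single [] 1
  | k + 1 => cone (e k) (crossPolytope e k) + cone (-e k) (crossPolytope e k)

/-- The upper hemisphere of the cross-polytope. -/
def hemi (e : ℕ → X) (k : ℕ) : Chain X := cone (e k) (crossPolytope e k)

lemma antip_crossPolytope (e : ℕ → X) (k : ℕ) : antip (crossPolytope e k) = crossPolytope e k := by
  induction k with
  | zero => simp [crossPolytope, antip_single]
  | succ k ih => simp [crossPolytope, antip_cone, ih, add_comm]

lemma bdry_crossPolytope (e : ℕ → X) (k : ℕ) : bdry (crossPolytope e k) = 0 := by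
  induction k with
  | zero => simp [crossPolytope, bdry_single, bdryList]
  | succ k ih => simp [crossPolytope, bdry_cone, ih, chain_add_self]

lemma bdry_hemi_succ (e : ℕ → X) (k : ℕ) :
    bdry (hemi e (k + 1)) = hemi e k + antip (hemi e k) := by
  rw [hemi, bdry_cone, bdry_crossPolytope, map_zero, add_zero, hemi, antip_cone,
    antip_crossPolytope, crossPolytope]

end Antipode

section Cochains

/-- The cup product of the coboundaries of the functions in the list. -/
def cupList : List (X → ZMod 2) → List X → ZMod 2
  | a :: as, x :: y :: l => (a x + a y) * cupList as (y :: l)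
  | _, _ => 1

/-- The cup product of `a` with the cup product of the coboundaries of the functions in `as`. -/
def cupHead (a : X → ZMod 2) (as : List (X → ZMod 2)) : List X → ZMod 2
  | x :: l => a x * cupList as (x :: l)
  | [] => 0

/-- Evaluation of a cochain on a chain. -/
def pairing (φ : List X → ZMod 2) : Chain X →ₗ[ZMod 2] ZMod 2 :=
  Finsupp.linearCombination (ZMod 2) φ

lemma pairing_single (φ : List X → ZMod 2) (l : List X) :
    pairing φ (Finsupp.single l 1) = φ l := by simp [pairing]

lemma pairing_cupList_cone_cone (a : X → ZMod 2) (as : List (X → ZMod 2)) (x y : X)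
    (c : Chain X) :
    pairing (cupList (a :: as)) (cone x (cone y c)) =
      (a x + a y) * pairing (cupList as) (cone y c) := by
  have : pairing (cupList (a :: as)) ∘ₗ cone x ∘ₗ cone y =
      (a x + a y) • (pairing (cupList as) ∘ₗ cone y) :=
    linearMap_ext fun l => by simp [cone_single, pairing_single, cupList]
  simpa using LinearMap.congr_fun this c

lemma pairing_cupHead_cone (a : X → ZMod 2) (as : List (X → ZMod 2)) (x : X) (c : Chain X) :
    pairing (cupHead a as) (cone x c) = a x * pairing (cupList as) (cone x c) := by
  have : pairing (cupHead a as) ∘ₗ cone x = a x • (pairing (cupList as) ∘ₗ cone x) :=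
    linearMap_ext fun l => by simp [cone_single, pairing_single, cupHead]
  simpa using LinearMap.congr_fun this c

lemma zmod_two_add_self (z : ZMod 2) : z + z = 0 := CharTwo.add_self_eq_zero z

lemma eq_of_add_eq_zero_zmod {y z : ZMod 2} (h : y + z = 0) : y = z := by
  have := CharTwo.add_eq_zero.1 h
  exact this

lemma pairing_cupList_bdryList : ∀ (as : List (X → ZMod 2)) (l : List X),
    l.length = as.length + 2 → pairing (cupList as) (bdryList l) = 0
  | [], [x, y], _ => by
    simp [bdryList, cone_single, pairing_single, cupList, zmod_two_add_self]
  | [a], [x, y, z], _ => by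
    simp only [bdryList, cone_single, pairing_single, cupList, map_add, map_zero, add_zero]
    linear_combination zmod_two_add_self (a x) + zmod_two_add_self (a y) + zmod_two_add_self (a z)
  | a :: a' :: as, x :: y :: z :: l, h => by
    have ih := pairing_cupList_bdryList (a' :: as) (y :: z :: l) (by simpa using h)
    simp only [bdryList, map_add, cone_single, pairing_single, pairing_cupList_cone_cone] at ih ⊢
    rw [show cupList (a :: a' :: as) (y :: z :: l) = (a y + a z) * cupList (a' :: as) (z :: l) from rfl,
      show cupList (a :: a' :: as) (x :: z :: l) = (a x + a z) * cupList (a' :: as) (z :: l) from rfl,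
      show cupList (a :: a' :: as) (x :: y :: l) = (a x + a y) * cupList (a' :: as) (y :: l) from rfl]
    linear_combination (a x + a y) * ih + zmod_two_add_self (a z * cupList (a' :: as) (z :: l)) 

lemma pairing_cupHead_bdryList (a : X → ZMod 2) (as : List (X → ZMod 2)) (l : List X)
    (h : l.length = as.length + 2) :
    pairing (cupHead a as) (bdryList l) = cupList (a :: as) l := by
  match l, h with
  | x :: y :: l, h =>
    have h0 := pairing_cupList_bdryList as (x :: y :: l) h
    rw [bdryList, map_add, pairing_single] at h0
    rw [bdryList, map_add, pairing_single, pairing_cupHead_cone, ← eq_of_add_eq_zero_zmod h0]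
    simp only [cupHead, cupList]
    ring

end Cochains

section Hemispheres


/-- The list `[a (k-1), …, a 0]`. -/
def cups (a : ℕ → X → ZMod 2) : ℕ → List (X → ZMod 2)
  | 0 => []
  | k + 1 => a k :: cups a k

lemma length_cups (a : ℕ → X → ZMod 2) (k : ℕ) : (cups a k).length = k := by
  induction k with
  | zero => rfl
  | succ k ih => simp [cups, ih]

lemma mem_cups {a : ℕ → X → ZMod 2} {k j : ℕ} (h : j < k) : a j ∈ cups a k := by
  induction k with
  | zero => omega
  | succ k ih =>
    rcases Nat.lt_succ_iff_lt_or_eq.1 h with h | rfl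
    · exact List.mem_cons_of_mem _ (ih h)
    · exact List.mem_cons_self

lemma cupList_neg [InvolutiveNeg X] (a : ℕ → X → ZMod 2) (k : ℕ) (t : List X)
    (h : ∀ j, ∀ x ∈ t, a j (-x) = a j x + 1) :
    cupList (cups a k) (t.map fun x => -x) = cupList (cups a k) t := by
  induction k generalizing t with
  | zero => rfl
  | succ k ih =>
    match t with
    | [] => rfl
    | [x] => rfl
    | x :: y :: t =>
      have ih' := ih (y :: t) fun j z hz => h j z (List.mem_cons_of_mem _ hz)
      simp only [cups, List.map_cons, cupList] at ih' ⊢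
      rw [ih', h k x (by simp), h k y (by simp)]
      linear_combination cupList (cups a k) (y :: t) * zmod_two_add_self 1

lemma cupHead_add_antip [InvolutiveNeg X] (a : ℕ → X → ZMod 2) (k : ℕ) {c : Chain X} {s : Set (List X)}
    (hs : ∀ t ∈ s, t ≠ [] ∧ ∀ j, ∀ x ∈ t, a j (-x) = a j x + 1)
    (hc : c ∈ Finsupp.supported (ZMod 2) (ZMod 2) s) :
    pairing (cupHead (a k) (cups a k)) (c + antip c) = pairing (cupList (cups a k)) c := by
  refine eqOn_supported (f := pairing (cupHead (a k) (cups a k)) ∘ₗ (LinearMap.id + antip))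
    (fun t ht => ?_) hc
  obtain ⟨hne, h⟩ := hs t ht
  have h2 := cupList_neg a k t h
  match t, hne with
  | x :: t, _ =>
    simp only [LinearMap.comp_apply, LinearMap.add_apply, LinearMap.id_apply, map_add, antip_single,
      pairing_single, List.map_cons, cupHead] at h2 ⊢
    rw [h2, h k x (by simp)]
    linear_combination cupList (cups a k) (x :: t) * zmod_two_add_self (a k x)

lemma cupHead_bdry (a : ℕ → X → ZMod 2) (k : ℕ) {c : Chain X}
    (hc : c ∈ Finsupp.supported (ZMod 2) (ZMod 2) {t : List X | t.length = k + 2}) :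
    pairing (cupHead (a k) (cups a k)) (bdry c) = pairing (cupList (cups a (k + 1))) c := by
  refine eqOn_supported (f := pairing (cupHead (a k) (cups a k)) ∘ₗ bdry) (fun t ht => ?_) hc
  simp only [LinearMap.comp_apply, bdry_single, pairing_single]
  rw [pairing_cupHead_bdryList]
  · rfl
  · rw [length_cups]; exact ht

lemma cupList_eq_zero {as : List (X → ZMod 2)} {t : List X} (hl : t.length = as.length + 1)
    {a : X → ZMod 2} (ha : a ∈ as) (hc : ∀ x ∈ t, ∀ y ∈ t, a x = a y) : cupList as t = 0 := by
  induction as generalizing t with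
  | nil => simp at ha
  | cons a' as ih =>
    match t, hl with
    | x :: y :: t, hl =>
      rw [cupList]
      rcases List.mem_cons.1 ha with rfl | ha
      · rw [hc x (by simp) y (by simp), zmod_two_add_self, zero_mul]
      · rw [ih (t := y :: t) (by simpa using hl) ha fun u hu v hv =>
          hc u (List.mem_cons_of_mem _ hu) v (List.mem_cons_of_mem _ hv), mul_zero]

end Hemispheres

section Geometry

variable {E : Type*} [NormedAddCommGroup E] [NormedSpace ℝ E]

/-- The barycenter of a finite sequence. -/
def bary (l : List E) : E := (l.length : ℝ)⁻¹ • l.sum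

lemma bary_neg (l : List E) : bary (l.map fun x => -x) = - bary l := by
  have : (l.map fun x => -x).sum = - l.sum := by
    induction l with
    | nil => simp
    | cons x l ih => simp [ih]; abel
  simp [bary, this]

lemma bary_mem_convexHull {l : List E} (hl : l ≠ []) : bary l ∈ convexHull ℝ {y | y ∈ l} := by
  have hpos : (0 : ℝ) < l.length := by
    exact_mod_cast List.length_pos_iff.2 hl
  have : bary l = ∑ i : Fin l.length, (l.length : ℝ)⁻¹ • l.get i := by
    rw [bary, ← Finset.smul_sum, ← List.sum_ofFn, List.ofFn_get]
  rw [this]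
  refine (convex_convexHull ℝ _).sum_mem (fun _ _ => by positivity) ?_ fun i _ =>
    subset_convexHull ℝ _ (List.get_mem l i)
  simp [hpos.ne']

lemma dist_bary_le {l : List E} {r : ℝ} (hr : 0 ≤ r) {n : ℕ} (hl : l.length ≤ n + 1)
    {x : E} (hx : x ∈ l) (h : ∀ y ∈ l, dist x y ≤ r) : dist x (bary l) ≤ n / (n + 1) * r := by
  have hne : l ≠ [] := by rintro rfl; simp at hx
  have hpos : (0 : ℝ) < l.length := by
    exact_mod_cast List.length_pos_iff.2 hne
  have hsum : (l.length : ℝ) • (x - bary l) = (l.map fun y => x - y).sum := by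
    have h1 : (l.map fun y => x - y).sum = (l.length : ℝ) • x - l.sum := by
      clear hx h hl hne hpos
      induction l with
      | nil => simp
      | cons y l ih => simp [ih, add_smul]; abel
    rw [h1, smul_sub, bary, smul_inv_smul₀ hpos.ne']
  have hbound : ‖(l.map fun y => x - y).sum‖ ≤ (l.length - 1) * r := by
    obtain ⟨s, t, rfl⟩ := List.append_of_mem hx
    have aux : ∀ s : List E, (∀ y ∈ s, dist x y ≤ r) →
        ‖(s.map fun y => x - y).sum‖ ≤ s.length * r := by
      intro s hs
      induction s with
      | nil => simp
      | cons y s ih =>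
        have h1 := ih fun z hz => hs z (List.mem_cons_of_mem _ hz)
        have h2 := hs y (by simp)
        rw [dist_eq_norm] at h2
        simp only [List.map_cons, List.sum_cons, List.length_cons, Nat.cast_add, Nat.cast_one]
        exact (norm_add_le _ _).trans (by linarith)
    have h1 := aux s fun y hy => h y (by simp [hy])
    have h2 := aux t fun y hy => h y (by simp [hy])
    simp only [List.map_append, List.map_cons, sub_self, List.sum_append, List.sum_cons, zero_add,
      List.length_append, List.length_cons, Nat.cast_add, Nat.cast_one]
    exact (norm_add_le _ _).trans (by linarith)
  rw [← hsum, norm_smul, Real.norm_of_nonneg hpos.le] at hbound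
  rw [dist_eq_norm]
  have hl' : (l.length : ℝ) ≤ n + 1 := by exact_mod_cast hl
  have hn : (0 : ℝ) < n + 1 := by positivity
  have h3 : ‖x - bary l‖ ≤ (1 - 1 / l.length) * r := by
    have : (1 - 1 / (l.length : ℝ)) * r = (l.length - 1) * r / l.length := by
      field_simp
    rw [this, le_div_iff₀ hpos]; linarith
  have h4 : (1 : ℝ) / (n + 1) ≤ 1 / l.length := one_div_le_one_div_of_le hpos hl'
  have h5 : (n : ℝ) / (n + 1) = 1 - 1 / (n + 1) := by field_simp; ring
  rw [h5]
  exact h3.trans (mul_le_mul_of_nonneg_right (by linarith) hr)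

lemma sd_single_mem_supported {r : ℝ} (hr : 0 ≤ r) (n : ℕ) (l : List E) (hl : l.length ≤ n + 1)
    (h : ∀ x ∈ l, ∀ y ∈ l, dist x y ≤ r) :
    sd bary (Finsupp.single l 1) ∈ Finsupp.supported (ZMod 2) (ZMod 2)
      {t | t.length = l.length ∧ (∀ x ∈ t, ∀ y ∈ t, dist x y ≤ n / (n + 1) * r) ∧
        ∀ x ∈ t, x ∈ convexHull ℝ {y | y ∈ l}} := by
  obtain ⟨k, hk⟩ : ∃ k, k = l.length := ⟨_, rfl⟩
  have hr' : 0 ≤ n / (n + 1) * r := by positivity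
  induction k generalizing l with
  | zero =>
    obtain rfl := List.length_eq_zero_iff.1 hk.symm
    rw [sd_single_nil]
    exact single_mem_supported (by simp)
  | succ k ih =>
    have hne : l ≠ [] := by rintro rfl; simp at hk
    rw [sd_single_of_ne_nil _ hne]
    have hsub : sd bary (bdryList l) ∈ Finsupp.supported (ZMod 2) (ZMod 2)
        {t | t.length + 1 = l.length ∧ (∀ x ∈ t, ∀ y ∈ t, dist x y ≤ n / (n + 1) * r) ∧
        ∀ x ∈ t, x ∈ convexHull ℝ {y | y ∈ l}} := by
      refine map_supported_mem ?_ (bdryList_mem_supported l)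
      rintro s ⟨hs1, hs2⟩
      refine supported_mono ?_ (ih s (by omega) (fun x hx y hy => h x (hs2 hx) y (hs2 hy))
        (by omega))
      rintro t ⟨ht1, ht2, ht3⟩
      exact ⟨by omega, ht2, fun x hx => convexHull_mono (fun y hy => hs2 hy) (ht3 x hx)⟩
    refine cone_mem_supported ?_ hsub
    rintro t ⟨ht1, ht2, ht3⟩
    have hball : convexHull ℝ {y | y ∈ l} ⊆ Metric.closedBall (bary l) (n / (n + 1) * r) :=
      convexHull_min (fun x hx => dist_bary_le hr hl hx (h x hx)) (convex_closedBall _ _)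
    refine ⟨by simpa using ht1, ?_, ?_⟩
    · intro x hx y hy
      rcases List.mem_cons.1 hx with rfl | hx' <;> rcases List.mem_cons.1 hy with rfl | hy'
      · simpa using hr'
      · rw [dist_comm]; exact hball (ht3 y hy')
      · exact hball (ht3 x hx')
      · exact ht2 x hx' y hy'
    · intro x hx
      rcases List.mem_cons.1 hx with rfl | hx'
      · exact bary_mem_convexHull hne
      · exact ht3 x hx'

/-- The sequences of length `k` in which all distances are at most `r` and whose convex hull is
contained in `K`. -/
def smallIn (K : Set E) (k : ℕ) (r : ℝ) : Set (List E) :=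
  {t | t.length = k ∧ (∀ x ∈ t, ∀ y ∈ t, dist x y ≤ r) ∧ convexHull ℝ {y | y ∈ t} ⊆ K}

lemma sd_mem_supported {K : Set E} {r : ℝ} (hr : 0 ≤ r) {n k : ℕ} (hk : k ≤ n + 1) {c : Chain E}
    (hc : c ∈ Finsupp.supported (ZMod 2) (ZMod 2) (smallIn K k r)) :
    sd bary c ∈ Finsupp.supported (ZMod 2) (ZMod 2) (smallIn K k (n / (n + 1) * r)) := by
  refine map_supported_mem ?_ hc
  rintro l ⟨hl1, hl2, hl3⟩
  refine supported_mono ?_ (sd_single_mem_supported hr n l (by omega) hl2)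
  rintro t ⟨ht1, ht2, ht3⟩
  exact ⟨by omega, ht2, (convexHull_min ht3 (convex_convexHull ℝ _)).trans hl3⟩

lemma sd_pow_mem_supported {K : Set E} {r : ℝ} (hr : 0 ≤ r) {n k : ℕ} (hk : k ≤ n + 1) {c : Chain E}
    (hc : c ∈ Finsupp.supported (ZMod 2) (ZMod 2) (smallIn K k r)) (N : ℕ) :
    (sd bary)^[N] c ∈ Finsupp.supported (ZMod 2) (ZMod 2)
      (smallIn K k ((n / (n + 1)) ^ N * r)) := by
  induction N with
  | zero => simpa using hc
  | succ N ih =>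
    rw [Function.iterate_succ_apply']
    have := sd_mem_supported (by positivity) hk ih
    rwa [← mul_assoc, ← pow_succ'] at this

end Geometry

section Main

variable {m : ℕ}

/-- The `k`-th vector of the standard basis, or zero. -/
def stdVec (m k : ℕ) : Fin (m + 1) → ℝ := fun i => if (i : ℕ) = k then 1 else 0

/-- The boundary of the standard cross-polytope. -/
def octahedron (m : ℕ) : Set (Fin (m + 1) → ℝ) := {x | ∑ i, |x i| = 1}

lemma isCompact_octahedron (m : ℕ) : IsCompact (octahedron m) := by
  refine Metric.isCompact_of_isClosed_isBounded
    (isClosed_eq (by fun_prop) continuous_const) ?_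
  refine (Metric.isBounded_closedBall (x := 0) (r := 1)).subset fun x hx => ?_
  rw [mem_closedBall_zero_iff, pi_norm_le_iff_of_nonneg zero_le_one]
  intro i
  rw [← (hx : ∑ i, |x i| = 1)]
  exact Finset.single_le_sum (f := fun i => |x i|) (fun _ _ => abs_nonneg _) (Finset.mem_univ i)

lemma ne_zero_of_mem_octahedron {x : Fin (m + 1) → ℝ} (hx : x ∈ octahedron m) : x ≠ 0 := by
  rintro rfl
  simp [octahedron] at hx

lemma crossPolytope_mem_supported (m k : ℕ) :
    crossPolytope (stdVec m) k ∈ Finsupp.supported (ZMod 2) (ZMod 2)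
      {t | t.length = k ∧ ∃ ε : ℕ → ℝ, (∀ i, |ε i| = 1) ∧ ∀ x ∈ t, ∃ i < k, x = ε i • stdVec m i} := by
  induction k with
  | zero => exact single_mem_supported ⟨rfl, fun _ => 1, by simp, by simp⟩
  | succ k ih =>
    have key : ∀ s : ℝ, |s| = 1 → cone (s • stdVec m k) (crossPolytope (stdVec m) k) ∈
        Finsupp.supported (ZMod 2) (ZMod 2) {t | t.length = k + 1 ∧ ∃ ε : ℕ → ℝ, (∀ i, |ε i| = 1) ∧
          ∀ x ∈ t, ∃ i < k + 1, x = ε i • stdVec m i} := by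
      intro s hs
      refine cone_mem_supported ?_ ih
      rintro t ⟨ht, ε, hε, h⟩
      refine ⟨by simpa using ht, Function.update ε k s, fun i => ?_, fun x hx => ?_⟩
      · by_cases hi : i = k
        · subst hi; simpa using hs
        · simpa [hi] using hε i
      · rcases List.mem_cons.1 hx with rfl | hx
        · exact ⟨k, by omega, by simp⟩
        · obtain ⟨i, hi, rfl⟩ := h x hx
          exact ⟨i, by omega, by simp [hi.ne]⟩
    refine Submodule.add_mem _ ?_ ?_
    · simpa using key 1 (by simp)
    · simpa using key (-1) (by simp)

lemma hemi_mem_supported {k : ℕ} (hk : k ≤ m) :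
    hemi (stdVec m) k ∈ Finsupp.supported (ZMod 2) (ZMod 2) (smallIn (octahedron m) (k + 1) 2) := by
  have h1 : hemi (stdVec m) k ∈ Finsupp.supported (ZMod 2) (ZMod 2)
      {t | t.length = k + 1 ∧ ∃ ε : ℕ → ℝ, (∀ i, |ε i| = 1) ∧
        ∀ x ∈ t, ∃ i < k + 1, x = ε i • stdVec m i} := by
    refine cone_mem_supported ?_ (crossPolytope_mem_supported m k)
    rintro t ⟨ht, ε, hε, h⟩
    refine ⟨by simpa using ht, Function.update ε k 1, fun i => ?_, fun x hx => ?_⟩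
    · by_cases hi : i = k
      · subst hi; simp
      · simpa [hi] using hε i
    · rcases List.mem_cons.1 hx with rfl | hx
      · exact ⟨k, by omega, by simp⟩
      · obtain ⟨i, hi, rfl⟩ := h x hx
        exact ⟨i, by omega, by simp [hi.ne]⟩
  refine supported_mono ?_ h1
  rintro t ⟨ht, ε, hε, h⟩
  have hεε : ∀ i, ε i * ε i = 1 := fun i => by
    rw [← abs_mul_abs_self, hε]; simp
  have hnorm : ∀ x ∈ t, ‖x‖ ≤ 1 := by
    intro x hx
    obtain ⟨i, -, rfl⟩ := h x hx
    rw [norm_smul, Real.norm_eq_abs, hε, one_mul, pi_norm_le_iff_of_nonneg zero_le_one]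
    intro j
    simp only [stdVec]
    split_ifs <;> simp
  refine ⟨ht, fun x hx y hy => ?_, ?_⟩
  · rw [dist_eq_norm]
    exact (norm_sub_le _ _).trans (by linarith [hnorm x hx, hnorm y hy])
  · have hsub : convexHull ℝ {y | y ∈ t} ⊆
        {x : Fin (m + 1) → ℝ | (∀ i : Fin (m + 1), 0 ≤ ε i * x i) ∧
          ∑ i : Fin (m + 1), ε i * x i = 1} := by
      refine convexHull_min ?_ ?_
      · intro x hx
        obtain ⟨i, hi, rfl⟩ := h x hx
        refine ⟨fun j => ?_, ?_⟩
        · by_cases hj : (j : ℕ) = i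
          · simp [stdVec, hj, hεε]
          · simp [stdVec, hj]
        · rw [Finset.sum_eq_single (⟨i, by omega⟩ : Fin (m + 1))]
          · simp [stdVec, hεε]
          · intro j _ hj
            have : (j : ℕ) ≠ i := fun h => hj (Fin.ext h)
            simp [stdVec, this]
          · simp
      · intro x hx y hy s t hs ht hst
        refine ⟨fun i => ?_, ?_⟩
        · have := add_nonneg (mul_nonneg hs (hx.1 i)) (mul_nonneg ht (hy.1 i))
          simp only [Pi.add_apply, Pi.smul_apply, smul_eq_mul]
          linarith
        · have : ∑ i : Fin (m + 1), ε i * (s • x + t • y) i =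
              s * ∑ i : Fin (m + 1), ε i * x i + t * ∑ i : Fin (m + 1), ε i * y i := by
            rw [Finset.mul_sum, Finset.mul_sum, ← Finset.sum_add_distrib]
            refine Finset.sum_congr rfl fun i _ => ?_
            simp only [Pi.add_apply, Pi.smul_apply, smul_eq_mul]
            ring
          rw [this, hx.2, hy.2, mul_one, mul_one, hst]
    intro x hx
    obtain ⟨h1, h2⟩ := hsub hx
    rw [octahedron, mem_ofPred_eq, ← h2]
    refine Finset.sum_congr rfl fun i _ => ?_
    rw [← abs_of_nonneg (h1 i), abs_mul, hε, one_mul]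

lemma bdry_sd_pow (c : Chain (Fin (m + 1) → ℝ)) (N : ℕ) :
    bdry ((sd bary)^[N] c) = (sd bary)^[N] (bdry c) := by
  induction N with
  | zero => rfl
  | succ N ih => rw [Function.iterate_succ_apply', Function.iterate_succ_apply', bdry_sd, ih]

lemma sd_pow_antip (c : Chain (Fin (m + 1) → ℝ)) (N : ℕ) :
    (sd bary)^[N] (antip c) = antip ((sd bary)^[N] c) := by
  induction N with
  | zero => rfl
  | succ N ih =>
    rw [Function.iterate_succ_apply', Function.iterate_succ_apply', ih, sd_antip bary_neg]

lemma sd_pow_add (c c' : Chain (Fin (m + 1) → ℝ)) (N : ℕ) :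
    (sd bary)^[N] (c + c') = (sd bary)^[N] c + (sd bary)^[N] c' := by
  induction N with
  | zero => rfl
  | succ N ih => simp only [Function.iterate_succ_apply', ih, map_add]

lemma sd_pow_single (N : ℕ) (x : Fin (m + 1) → ℝ) :
    ∃ y, (sd bary)^[N] (Finsupp.single [x] 1) = Finsupp.single [y] 1 := by
  induction N with
  | zero => exact ⟨x, rfl⟩
  | succ N ih =>
    obtain ⟨y, hy⟩ := ih
    refine ⟨bary [y], ?_⟩
    rw [Function.iterate_succ_apply', hy, sd_single_of_ne_nil _ (by simp), bdryList, bdryList,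
      map_zero, add_zero, sd_single_nil, cone_single]

lemma pairing_sd_pow_hemi (a : ℕ → (Fin (m + 1) → ℝ) → ZMod 2)
    (ha : ∀ j, ∀ x, x ≠ 0 → a j (-x) = a j x + 1) (N : ℕ) {k : ℕ} (hk : k ≤ m) :
    pairing (cupList (cups a k)) ((sd bary)^[N] (hemi (stdVec m) k)) = 1 := by
  induction k with
  | zero =>
    rw [hemi, crossPolytope, cone_single]
    obtain ⟨y, hy⟩ := sd_pow_single N (stdVec m 0)
    rw [hy, pairing_single]
    rfl
  | succ k ih =>
    have hsupp : ∀ k ≤ m, (sd bary)^[N] (hemi (stdVec m) k) ∈ Finsupp.supported (ZMod 2) (ZMod 2)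
        (smallIn (octahedron m) (k + 1) ((m / (m + 1)) ^ N * 2)) := fun k hk =>
      sd_pow_mem_supported (by norm_num) (by omega) (hemi_mem_supported hk) N
    rw [← cupHead_bdry a k (supported_mono (fun t ht => ht.1) (hsupp (k + 1) hk)), bdry_sd_pow,
      bdry_hemi_succ, sd_pow_add, sd_pow_antip, cupHead_add_antip a k ?_ (hsupp k (by omega))]
    · exact ih (by omega)
    · rintro t ⟨ht1, -, ht2⟩
      refine ⟨by rintro rfl; simp at ht1, fun j x hx => ha j x ?_⟩
      exact ne_zero_of_mem_octahedron (ht2 (subset_convexHull ℝ _ hx))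

/-- A function that changes its value under `x ↦ -x`, except at zero. -/
def lexSign (x : Fin (m + 1) → ℝ) : ZMod 2 := by
  classical exact if 0 < toLex x then 1 else 0

lemma lexSign_neg {x : Fin (m + 1) → ℝ} (hx : x ≠ 0) : lexSign (-x) = lexSign x + 1 := by
  have h0 : toLex x ≠ 0 := by simpa using hx
  rcases lt_or_gt_of_ne h0 with h | h
  · have h1 : 0 < toLex (-x) := by rw [toLex_neg]; exact neg_pos.2 h
    have h2 : ¬ 0 < toLex x := h.not_gt
    rw [lexSign, lexSign, if_pos h1, if_neg h2, zero_add]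
  · have h1 : ¬ 0 < toLex (-x) := by rw [toLex_neg, neg_pos]; exact h.not_gt
    have h2 : 0 < toLex x := h
    rw [lexSign, lexSign, if_neg h1, if_pos h2, zmod_two_add_self]

/-- The **Borsuk–Ulam theorem**: a continuous odd map from `ℝ^(m+1)` without the origin to `ℝ^m` has
a zero. -/
theorem exists_ne_zero_eq_zero {f : (Fin (m + 1) → ℝ) → Fin m → ℝ} (hf : ContinuousOn f {0}ᶜ)
    (hodd : ∀ x, x ≠ 0 → f (-x) = - f x) : ∃ x, x ≠ 0 ∧ f x = 0 := by
  classical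
  by_contra! hne
  have hcont : ContinuousOn f (octahedron m) :=
    hf.mono fun x hx => ne_zero_of_mem_octahedron hx
  have hK := isCompact_octahedron m
  have hKne : (octahedron m).Nonempty := ⟨stdVec m 0, by
    rw [octahedron, mem_ofPred_eq, Finset.sum_eq_single (0 : Fin (m + 1))]
    · simp [stdVec]
    · intro j _ hj
      have : (j : ℕ) ≠ 0 := fun h => hj (Fin.ext h)
      simp [stdVec, this]
    · simp⟩
  obtain ⟨x₀, hx₀, hmin⟩ := hK.exists_isMinOn hKne hcont.norm
  have hδ : 0 < ‖f x₀‖ := norm_pos_iff.2 (hne x₀ (ne_zero_of_mem_octahedron hx₀))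
  set δ := ‖f x₀‖ with hδdef
  have hunif := hK.uniformContinuousOn_of_continuous hcont
  obtain ⟨η, hη, hfη⟩ := Metric.uniformContinuousOn_iff.1 hunif δ hδ
  obtain ⟨N, hN⟩ : ∃ N : ℕ, ((m : ℝ) / (m + 1)) ^ N * 2 < η := by
    have hlt : (m : ℝ) / (m + 1) < 1 := by rw [div_lt_one (by positivity)]; linarith
    have := ((tendsto_pow_atTop_nhds_zero_of_lt_one (by positivity) hlt).mul_const 2)
    rw [zero_mul] at this
    exact (this.eventually_lt_const hη).exists
  let a : ℕ → (Fin (m + 1) → ℝ) → ZMod 2 := fun j x =>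
    if h : j < m then
      if 0 < f x ⟨j, h⟩ then 1 else if f x ⟨j, h⟩ < 0 then 0 else lexSign x
    else lexSign x
  have ha : ∀ j, ∀ x, x ≠ 0 → a j (-x) = a j x + 1 := by
    intro j x hx
    by_cases h : j < m
    · simp only [a, h, dif_pos, hodd x hx, Pi.neg_apply, neg_pos, Left.neg_neg_iff]
      rcases lt_trichotomy (f x ⟨j, h⟩) 0 with h1 | h1 | h1
      · simp [h1, h1.not_gt]
      · simp [h1, lexSign_neg hx]
      · simp [h1, h1.not_gt, zmod_two_add_self]
    · simp only [a, h, dif_neg, not_false_eq_true, lexSign_neg hx]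
  have h1 := pairing_sd_pow_hemi a ha N le_rfl
  have hsupp := sd_pow_mem_supported (n := m) (by norm_num) le_rfl
    (hemi_mem_supported (m := m) le_rfl) N
  have h0 : pairing (cupList (cups a m)) ((sd bary)^[N] (hemi (stdVec m) m)) = 0 := by
    refine eqOn_supported (g := 0) (fun t ht => ?_) hsupp
    rw [pairing_single, LinearMap.zero_apply]
    obtain ⟨ht1, ht2, ht3⟩ := ht
    have hmem : ∀ x ∈ t, x ∈ octahedron m := fun x hx => ht3 (subset_convexHull ℝ _ hx)
    obtain ⟨x, hx⟩ : ∃ x, x ∈ t := List.exists_mem_of_ne_nil _ (by rintro rfl; simp at ht1)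
    obtain ⟨j, hj⟩ : ∃ j, δ ≤ |f x j| := by
      by_contra! hlt
      have : ‖f x‖ < δ := (pi_norm_lt_iff hδ).2 hlt
      exact absurd (hmin (hmem x hx)) (not_le.2 this)
    have hfar : ∀ y ∈ t, |f y j - f x j| < δ := fun y hy => by
      have := hfη y (hmem y hy) x (hmem x hx) ((ht2 y hy x hx).trans_lt hN)
      exact (dist_pi_lt_iff hδ).1 this j
    refine cupList_eq_zero (by rw [length_cups]; exact ht1) (mem_cups j.2) (a := a j) ?_
    have : ∀ y ∈ t, a j y = a j x := by
      intro y hy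
      have h3 := abs_lt.1 (hfar y hy)
      simp only [a, j.2, dif_pos, Fin.eta]
      rcases le_abs.1 hj with h4 | h4
      · rw [if_pos (by linarith), if_pos (by linarith)]
      · rw [if_neg (by linarith), if_pos (by linarith), if_neg (by linarith), if_pos (by linarith)]
    intro y hy z hz
    rw [this y hy, this z hz]
  rw [h0] at h1
  exact zero_ne_one h1

end Main

end BorsukUlam

namespace SchrodingerPoisson

lemma memLp_fn (u : H1r) : MemLp (fn u) 2 volume := Lp.memLp _

lemma memLp_grad (u : H1r) : MemLp (grad u) 2 volume := Lp.memLp _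

lemma fn_add (u v : H1r) : fn (u + v) =ᵐ[volume] fun x => fn u x + fn v x := Lp.coeFn_add _ _

lemma fn_sub (u v : H1r) : fn (u - v) =ᵐ[volume] fun x => fn u x - fn v x := Lp.coeFn_sub _ _

lemma fn_smul (r : ℝ) (u : H1r) : fn (r • u) =ᵐ[volume] fun x => r * fn u x := Lp.coeFn_smul r _

lemma fn_zero : fn 0 =ᵐ[volume] fun _ => 0 := Lp.coeFn_zero ℝ 2 (volume : Measure R3)

lemma D_eq_norm_sq (u : H1r) : D u = ‖(u : L2Pair).fst‖ ^ 2 := by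
  rw [← real_inner_self_eq_norm_sq, L2.inner_def, D]
  refine integral_congr_ae (Eventually.of_forall fun x => ?_)
  simp [fn]

lemma A_eq_norm_sq (u : H1r) : A u = ‖(u : L2Pair).snd‖ ^ 2 := by
  rw [← real_inner_self_eq_norm_sq, L2.inner_def, A]
  refine integral_congr_ae (Eventually.of_forall fun x => ?_)
  simp [grad]

lemma norm_sq_eq (u : H1r) : ‖u‖ ^ 2 = D u + A u := by
  rw [D_eq_norm_sq, A_eq_norm_sq, ← WithLp.prod_norm_sq_eq_of_L2]
  rfl

lemma D_nonneg (u : H1r) : 0 ≤ D u := by rw [D_eq_norm_sq]; positivity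

lemma A_nonneg (u : H1r) : 0 ≤ A u := by rw [A_eq_norm_sq]; positivity

lemma D_le_norm_sq (u : H1r) : D u ≤ ‖u‖ ^ 2 := by linarith [norm_sq_eq u, A_nonneg u]

lemma A_le_norm_sq (u : H1r) : A u ≤ ‖u‖ ^ 2 := by linarith [norm_sq_eq u, D_nonneg u]

/-- The gradient pairing `φ ↦ ∫ ∇u·∇φ` as a continuous linear functional. -/
def gradDual (u : H1r) : StrongDual ℝ H1r :=
  (innerSL ℝ (u : L2Pair).snd).comp
    ((WithLp.sndL 2 ℝ (Lp ℝ 2 (volume : Measure R3)) (Lp R3 2 (volume : Measure R3))).comp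
      H1r.subtypeL)

lemma gradDual_apply (u φ : H1r) : gradDual u φ = ∫ x, inner ℝ (grad u x) (grad φ x) := by
  change inner ℝ (u : L2Pair).snd (φ : L2Pair).snd = _
  rw [L2.inner_def]
  rfl

lemma gradDual_self (u : H1r) : gradDual u u = A u := by
  rw [A_eq_norm_sq, ← real_inner_self_eq_norm_sq]; rfl

lemma l2Dual_self (u : H1r) : l2Dual u u = D u := by
  rw [D_eq_norm_sq, ← real_inner_self_eq_norm_sq]; rfl

lemma l2Dual_comm (u v : H1r) : l2Dual u v = l2Dual v u :=
  real_inner_comm (v : L2Pair).fst (u : L2Pair).fst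

lemma gradDual_comm (u v : H1r) : gradDual u v = gradDual v u :=
  real_inner_comm (v : L2Pair).snd (u : L2Pair).snd

lemma norm_l2Dual_le (u : H1r) : ‖l2Dual u‖ ≤ ‖u‖ := by
  refine ContinuousLinearMap.opNorm_le_bound _ (norm_nonneg _) fun v => ?_
  have h1 : ∀ w : H1r, ‖(w : L2Pair).fst‖ ≤ ‖w‖ := fun w =>
    abs_le_of_sq_le_sq' (by rw [← D_eq_norm_sq]; exact D_le_norm_sq w) (norm_nonneg _) |>.2
  exact (norm_inner_le_norm _ _).trans (mul_le_mul (h1 u) (h1 v) (norm_nonneg _) (norm_nonneg _))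

lemma continuous_integral_mul {g : R3 → ℝ} (hg : MemLp g 2 volume) :
    Continuous fun f : Lp ℝ 2 (volume : Measure R3) => ∫ x, f x * g x := by
  have : (fun f : Lp ℝ 2 (volume : Measure R3) => ∫ x, f x * g x) =
      fun f => inner ℝ (hg.toLp g) f := by
    ext f
    rw [L2.inner_def]
    refine integral_congr_ae ?_
    filter_upwards [hg.coeFn_toLp] with x hx
    simp [hx]
  rw [this]
  fun_prop

lemma continuous_integral_inner {g : R3 → R3} (hg : MemLp g 2 volume) :
    Continuous fun f : Lp R3 2 (volume : Measure R3) => ∫ x, inner ℝ (f x) (g x) := by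
  have : (fun f : Lp R3 2 (volume : Measure R3) => ∫ x, inner ℝ (f x) (g x)) =
      fun f => inner ℝ f (hg.toLp g) := by
    ext f
    rw [L2.inner_def]
    refine integral_congr_ae ?_
    filter_upwards [hg.coeFn_toLp] with x hx
    simp [hx]
  rw [this]
  fun_prop

lemma isClosed_H1r : IsClosed (H1r : Set L2Pair) := by
  have hfst : Continuous fun w : L2Pair => w.fst :=
    (WithLp.fstL 2 ℝ (Lp ℝ 2 (volume : Measure R3)) (Lp R3 2 (volume : Measure R3))).continuous
  have hsnd : Continuous fun w : L2Pair => w.snd :=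
    (WithLp.sndL 2 ℝ (Lp ℝ 2 (volume : Measure R3)) (Lp R3 2 (volume : Measure R3))).continuous
  have : (H1r : Set L2Pair) = {w | IsWeakGradient w.fst w.snd} ∩ {w | IsRadial w.fst} := rfl
  rw [this]
  refine IsClosed.inter ?_ ?_
  · simp only [IsWeakGradient, Set.ofPred_forall]
    refine isClosed_iInter fun ψ => isClosed_iInter fun hψ => isClosed_iInter fun hc =>
      isClosed_iInter fun v => isClosed_eq ?_ ?_
    · have hg : MemLp (fun x => fderiv ℝ ψ x v) 2 (volume : Measure R3) :=
        ((hψ.continuous_fderiv (by simp)).clm_apply continuous_const).memLp_of_hasCompactSupport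
          (hc.fderiv_apply ℝ v)
      exact (continuous_integral_mul hg).comp hfst
    · have hg : MemLp (fun x => ψ x • v) 2 (volume : Measure R3) :=
        (hψ.continuous.smul continuous_const).memLp_of_hasCompactSupport hc.smul_right
      have h := (continuous_integral_inner hg).comp hsnd
      simp only [real_inner_smul_right, Function.comp_def] at h
      refine Continuous.neg ?_
      simpa only [mul_comm] using h
  · simp only [IsRadial, Set.ofPred_forall]
    refine isClosed_iInter fun O => ?_
    have hO := O.measurePreserving
    have : {w : L2Pair | (fun x => w.fst (O x)) =ᵐ[volume] w.fst} =
        {w : L2Pair | Lp.compMeasurePreservingₗᵢ ℝ (⇑O) hO w.fst = w.fst} := by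
      ext w
      have h : ⇑(Lp.compMeasurePreservingₗᵢ ℝ (⇑O) hO w.fst) =ᵐ[volume] fun x => w.fst (O x) :=
        Lp.coeFn_compMeasurePreserving w.fst hO
      constructor
      · intro hw
        exact Lp.ext (h.trans hw)
      · intro hw
        have h2 : ⇑(Lp.compMeasurePreservingₗᵢ ℝ (⇑O) hO w.fst) =ᵐ[volume] w.fst := by
          rw [show Lp.compMeasurePreservingₗᵢ ℝ (⇑O) hO w.fst = w.fst from hw]
        exact h.symm.trans h2
    rw [this]
    exact isClosed_eq ((Lp.compMeasurePreservingₗᵢ ℝ (⇑O) hO).continuous.comp hfst) hfst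

instance : CompleteSpace H1r := isClosed_H1r.completeSpace_coe

lemma eq_zero_of_D_eq_zero {u : H1r} (h : D u = 0) : u = 0 := by
  have h1 : (u : L2Pair).fst = 0 := by
    rw [D_eq_norm_sq] at h
    simpa using h
  have hfn : fn u =ᵐ[volume] fun _ => 0 := by
    rw [fn, h1]; exact Lp.coeFn_zero ℝ 2 (volume : Measure R3)
  have hG : grad u =ᵐ[volume] 0 := by
    have hv : ∀ v : R3, ∀ᵐ x, inner ℝ (grad u x) v = (0 : ℝ) := by
      intro v
      refine ae_eq_zero_of_integral_contDiff_smul_eq_zero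
        (((memLp_grad u).inner_const v).locallyIntegrable (by norm_num)) fun g hg hgc => ?_
      have := u.2.1 g hg hgc v
      rw [integral_congr_ae (g := fun _ => (0 : ℝ))] at this
      · simp only [integral_zero, zero_eq_neg] at this
        rw [← this]
        refine integral_congr_ae (Eventually.of_forall fun x => ?_)
        simp only [smul_eq_mul, grad]
        ring
      · filter_upwards [hfn] with x hx
        rw [show (u : L2Pair).fst x = fn u x from rfl, hx, zero_mul]
    have hall : ∀ᵐ x, ∀ i, inner ℝ (grad u x) (EuclideanSpace.single i (1 : ℝ)) = (0 : ℝ) :=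
      ae_all_iff.2 fun i => hv _
    filter_upwards [hall] with x hx
    ext i
    have := hx i
    simpa [EuclideanSpace.inner_single_right] using this
  have h2 : (u : L2Pair).snd = 0 := by
    refine Lp.ext (hG.trans ?_)
    exact (Lp.coeFn_zero R3 2 (volume : Measure R3)).symm
  ext1
  refine (WithLp.equiv 2 _).injective ?_
  exact Prod.ext h1 h2

/-- Bounded sequences in a separable Hilbert space have weakly convergent subsequences. -/
lemma exists_weakly_convergent_subseq {E : Type*} [NormedAddCommGroup E] [InnerProductSpace ℝ E]
    [CompleteSpace E] [TopologicalSpace.SeparableSpace E] {u : ℕ → E} {M : ℝ}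
    (hu : ∀ k, ‖u k‖ ≤ M) :
    ∃ (w : E) (τ : ℕ → ℕ), StrictMono τ ∧
      ∀ ℓ : StrongDual ℝ E, Tendsto (fun k => ℓ (u (τ k))) atTop (𝓝 (ℓ w)) := by
  let J := InnerProductSpace.toDual ℝ E
  let φ : ℕ → WeakDual ℝ E := fun k => StrongDual.toWeakDual (J (u k))
  have hmem : ∀ k, φ k ∈ WeakDual.toStrongDual ⁻¹' Metric.closedBall (0 : StrongDual ℝ E) M := by
    intro k
    have h : ‖J (u k)‖ ≤ M := (J.norm_map (u k)).trans_le (hu k)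
    exact mem_closedBall_zero_iff.2 h
  obtain ⟨ℓ, -, τ, hτ, hlim⟩ := WeakDual.isSeqCompact_closedBall ℝ E 0 M hmem
  refine ⟨J.symm (WeakDual.toStrongDual ℓ), τ, hτ, fun f => ?_⟩
  have h := ((WeakDual.eval_continuous (J.symm f)).tendsto ℓ).comp hlim
  have e : ∀ v : E, f v = J v (J.symm f) := fun v => by
    rw [InnerProductSpace.toDual_apply_apply, real_inner_comm, InnerProductSpace.toDual_symm_apply]
  have e2 : f (J.symm (WeakDual.toStrongDual ℓ)) = ℓ (J.symm f) := by
    rw [e, LinearIsometryEquiv.apply_symm_apply]; rfl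
  rw [e2]
  refine h.congr fun k => ?_
  rw [e]
  rfl

lemma separableSpace_of_dense_iUnion {E : Type*} [NormedAddCommGroup E] [NormedSpace ℝ E]
    {V : ℕ → Submodule ℝ E} (hVfin : ∀ m, FiniteDimensional ℝ (V m))
    (hVdense : Dense (⋃ m, (V m : Set E))) : TopologicalSpace.SeparableSpace E := by
  have h : TopologicalSpace.IsSeparable (⋃ m, (V m : Set E)) := by
    refine TopologicalSpace.IsSeparable.iUnion fun m => ?_
    have := hVfin m
    have : ProperSpace (V m) := FiniteDimensional.proper ℝ (V m)
    exact TopologicalSpace.isSeparable_range (f := ((↑) : V m → E)) continuous_subtype_val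
      |>.mono (by simp)
  have h2 := h.closure
  rw [hVdense.closure_eq] at h2
  exact TopologicalSpace.isSeparable_univ_iff.1 h2

/-! ### A representation formula -/

lemma hasFDerivAt_radial_mul {k : ℝ → ℝ} (hk : Differentiable ℝ k) (x y v : R3) :
    fderiv ℝ (fun y : R3 => k (‖x - y‖ ^ 2) * inner ℝ (x - y) v) y v =
      -(k (‖x - y‖ ^ 2) * ‖v‖ ^ 2 + 2 * deriv k (‖x - y‖ ^ 2) * inner ℝ (x - y) v ^ 2) := by
  have h1 : HasFDerivAt (fun y : R3 => x - y) (-ContinuousLinearMap.id ℝ R3) y := by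
    simpa using (hasFDerivAt_id y).const_sub x
  have h2 := h1.norm_sq
  have h3 := (hk (‖x - y‖ ^ 2)).hasDerivAt.comp_hasFDerivAt y h2
  have h4 : HasFDerivAt (fun y : R3 => inner ℝ (x - y) v) (-(innerSL ℝ v)) y := by
    have := ((innerSL ℝ v).hasFDerivAt (x := x - y)).comp y h1
    refine (this.congr_of_eventuallyEq (Eventually.of_forall fun z => ?_)).congr_fderiv ?_
    · simp [real_inner_comm]
    · ext w; simp
  have h5 := (h3.mul h4).fderiv
  have e : (fun y : R3 => k (‖x - y‖ ^ 2) * inner ℝ (x - y) v) =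
    (k ∘ fun y => ‖x - y‖ ^ 2) * fun y => inner ℝ (x - y) v := rfl
  rw [e, h5]
  simp [real_inner_comm v]
  rw [inner_sub_right]
  ring

/-- Integration by parts of a weak gradient against a radial field `k(|z|²) z`. -/
lemma integral_fn_mul_div_radial {k : ℝ → ℝ} (hk : ContDiff ℝ ∞ k) {R : ℝ}
    (hR : ∀ s, R ≤ s → k s = 0) (u : H1r) (x : R3) :
    ∫ y, fn u y * (3 * k (‖x - y‖ ^ 2) + 2 * ‖x - y‖ ^ 2 * deriv k (‖x - y‖ ^ 2)) =
      ∫ y, inner ℝ (grad u y) (x - y) * k (‖x - y‖ ^ 2) := by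
  have hkd : Differentiable ℝ k := hk.differentiable (by simp)
  let ψ : R3 → R3 → ℝ := fun v y => k (‖x - y‖ ^ 2) * inner ℝ (x - y) v
  have hψ : ∀ v, ContDiff ℝ ∞ (ψ v) := fun v => by
    refine ContDiff.mul (hk.comp ((contDiff_const.sub contDiff_id).norm_sq ℝ)) ?_
    exact (contDiff_const.sub contDiff_id).inner ℝ contDiff_const
  have hψc : ∀ v, HasCompactSupport (ψ v) := fun v => by
    refine HasCompactSupport.of_support_subset_isCompact
      (isCompact_closedBall x (|R| + 1)) fun y hy => ?_
    by_contra hfar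
    rw [Metric.mem_closedBall, dist_comm, dist_eq_norm, not_le] at hfar
    refine hy ?_
    simp only [ψ]
    rw [hR, zero_mul]
    nlinarith [abs_nonneg R, le_abs_self R]
  have hmain : ∀ i, ∫ y, fn u y * fderiv ℝ (ψ (EuclideanSpace.basisFun (Fin 3) ℝ i)) y
      (EuclideanSpace.basisFun (Fin 3) ℝ i) =
      - ∫ y, inner ℝ (grad u y) (EuclideanSpace.basisFun (Fin 3) ℝ i) *
        ψ (EuclideanSpace.basisFun (Fin 3) ℝ i) y :=
    fun i => u.2.1 _ (hψ _) (hψc _) _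
  have hsum := Finset.sum_congr (rfl : (Finset.univ : Finset (Fin 3)) = Finset.univ)
    fun i _ => hmain i
  rw [← integral_finsetSum _ fun i _ => integrable_mul_fderiv (memLp_fn u) (hψ _) (hψc _) _,
    Finset.sum_neg_distrib,
    ← integral_finsetSum _ fun i _ => integrable_inner_mul (memLp_grad u) (hψ _) (hψc _) _] at hsum
  rw [← neg_inj, ← integral_neg]
  refine Eq.trans ?_ (hsum.trans ?_)
  · refine integral_congr_ae (Eventually.of_forall fun y => ?_)
    change _ = ∑ i, fn u y * fderiv ℝ (ψ _) y _
    rw [← Finset.mul_sum]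
    refine (mul_neg _ _).symm.trans ?_
    congr 1
    simp only [ψ, hasFDerivAt_radial_mul hkd]
    rw [Finset.sum_neg_distrib, Finset.sum_add_distrib, ← Finset.mul_sum, ← Finset.mul_sum]
    have h1 : ∑ i, inner ℝ (x - y) (EuclideanSpace.basisFun (Fin 3) ℝ i) ^ 2 = ‖x - y‖ ^ 2 := by
      have := (EuclideanSpace.basisFun (Fin 3) ℝ).sum_sq_norm_inner_left (x - y)
      simpa using this
    rw [h1]
    simp
    ring
  · congr 1
    refine integral_congr_ae (Eventually.of_forall fun y => ?_)
    change ∑ i, inner ℝ (grad u y) _ * ψ _ y = _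
    simp only [ψ]
    have h1 := (EuclideanSpace.basisFun (Fin 3) ℝ).sum_inner_mul_inner (grad u y) (x - y)
    rw [← h1, Finset.sum_mul]
    refine Finset.sum_congr rfl fun i _ => ?_
    rw [real_inner_comm (x - y) (EuclideanSpace.basisFun (Fin 3) ℝ i)]
    ring

/-- The radial profile `s ↦ s^{-3/2} T(s - 1)`, smooth on `ℝ`, equal to `s^{-3/2}` for `s ≥ 2`. -/
def profile (s : ℝ) : ℝ := s ^ (-(3 / 2) : ℝ) * Real.smoothTransition (s - 1)

lemma contDiff_profile : ContDiff ℝ ∞ profile := by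
  rw [contDiff_iff_contDiffAt]
  intro s
  rcases lt_or_ge s 1 with h | h
  · refine (contDiffAt_const (c := (0 : ℝ))).congr_of_eventuallyEq ?_
    filter_upwards [Iio_mem_nhds h] with t ht
    rw [profile, Real.smoothTransition.zero_of_nonpos (by linarith [mem_Iio.1 ht]), mul_zero]
  · have hs : s ≠ 0 := by positivity
    exact (contDiffAt_id.rpow_const_of_ne hs).mul
      (Real.smoothTransition.contDiff.contDiffAt.comp s (contDiffAt_id.sub contDiffAt_const))

/-- The profile of the mollifier: `div (z · profile(|z|²)) = bump(|z|²)`. -/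
def bump (s : ℝ) : ℝ := 3 * profile s + 2 * s * deriv profile s

lemma continuous_bump : Continuous bump :=
  (continuous_const.mul contDiff_profile.continuous).add
    ((continuous_const.mul continuous_id).mul (contDiff_profile.continuous_deriv (by simp)))

lemma bump_of_pos {s : ℝ} (hs : 0 < s) :
    bump s = 2 * s ^ (-(1 / 2) : ℝ) * deriv Real.smoothTransition (s - 1) := by
  have h1 : HasDerivAt (fun s : ℝ => s ^ (-(3 / 2) : ℝ)) (-(3 / 2) * s ^ (-(3 / 2) - 1 : ℝ)) s :=
    Real.hasDerivAt_rpow_const (Or.inl hs.ne')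
  have h2 : HasDerivAt (fun s : ℝ => Real.smoothTransition (s - 1))
      (deriv Real.smoothTransition (s - 1)) s := by
    have hd : HasDerivAt Real.smoothTransition (deriv Real.smoothTransition (s - 1)) (s - 1) :=
      ((Real.smoothTransition.contDiff (n := 1)).differentiable (by simp) _).hasDerivAt
    exact hd.comp_sub_const s 1
  have h3 : deriv profile s = _ := (h1.mul h2).deriv
  rw [bump, h3, profile]
  have e1 : s ^ (-(3 / 2) - 1 : ℝ) * s = s ^ (-(3 / 2) : ℝ) := by
    rw [← Real.rpow_add_one hs.ne']; norm_num
  have e2 : s ^ (-(3 / 2) : ℝ) * s = s ^ (-(1 / 2) : ℝ) := by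
    rw [← Real.rpow_add_one hs.ne']; norm_num
  rw [← e2, ← e1]
  ring

lemma bump_nonneg (s : ℝ) : 0 ≤ bump s := by
  rcases le_or_gt s 0 with h | h
  · have : deriv profile s = 0 := by
      have : profile =ᶠ[𝓝 s] fun _ => 0 := by
        filter_upwards [Iio_mem_nhds (show s < 1 by linarith)] with t ht
        rw [profile, Real.smoothTransition.zero_of_nonpos (by linarith [mem_Iio.1 ht]), mul_zero]
      rw [this.deriv_eq]; simp
    rw [bump, this, profile, Real.smoothTransition.zero_of_nonpos (by linarith)]
    simp
  · rw [bump_of_pos h]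
    have := Real.smoothTransition.monotone.deriv_nonneg (x := s - 1)
    positivity

lemma bump_of_two_le {s : ℝ} (hs : 2 ≤ s) : bump s = 0 := by
  have : ∀ t ∈ Ioi (2 : ℝ), bump t = 0 := by
    intro t ht
    rw [bump_of_pos (by linarith [mem_Ioi.1 ht])]
    have : Real.smoothTransition =ᶠ[𝓝 (t - 1)] fun _ => 1 := by
      filter_upwards [Ioi_mem_nhds (show 1 < t - 1 by linarith [mem_Ioi.1 ht])] with r hr
      exact Real.smoothTransition.one_of_one_le (le_of_lt hr)
    rw [this.deriv_eq]; simp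
  have hcl : s ∈ closure (Ioi (2 : ℝ)) := by rw [closure_Ioi]; exact hs
  exact (closure_minimal this (isClosed_eq continuous_bump continuous_const)) hcl

/-- The scaled, non-normalised mollifier `z ↦ ε⁻³ bump(|z|²/ε²)`. -/
def moll (ε : ℝ) (z : R3) : ℝ := ε⁻¹ ^ 3 * bump (‖ε⁻¹ • z‖ ^ 2)

lemma continuous_moll (ε : ℝ) : Continuous (moll ε) :=
  continuous_const.mul (continuous_bump.comp (by fun_prop))

lemma moll_nonneg {ε : ℝ} (hε : 0 < ε) (z : R3) : 0 ≤ moll ε z :=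
  mul_nonneg (by positivity) (bump_nonneg _)

lemma moll_eq_zero {ε : ℝ} (hε : 0 < ε) {z : R3} (hz : 2 * ε ≤ ‖z‖) : moll ε z = 0 := by
  rw [moll, bump_of_two_le, mul_zero]
  rw [norm_smul, norm_inv, Real.norm_of_nonneg hε.le]
  have : 2 ≤ ε⁻¹ * ‖z‖ := by
    rw [inv_mul_eq_div, le_div_iff₀ hε]; exact hz
  nlinarith

lemma hasCompactSupport_moll {ε : ℝ} (hε : 0 < ε) : HasCompactSupport (moll ε) := by
  refine HasCompactSupport.of_support_subset_isCompact
      (isCompact_closedBall 0 (2 * ε)) fun y hy => ?_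
  by_contra hfar
  rw [mem_closedBall_zero_iff, not_le] at hfar
  exact hy (moll_eq_zero hε hfar.le)

lemma memLp_moll_sub {ε : ℝ} (hε : 0 < ε) (x : R3) (p : ENNReal) :
    MemLp (fun y => moll ε (x - y)) p volume := by
  refine Continuous.memLp_of_hasCompactSupport
    ((continuous_moll ε).comp (continuous_const.sub continuous_id)) ?_
  exact (hasCompactSupport_moll hε).comp_homeomorph (Homeomorph.subLeft x)

/-- The integral of the mollifier. -/
def mollMass : ℝ := ∫ z : R3, moll 1 z

lemma integral_moll {ε : ℝ} (hε : 0 < ε) : ∫ z : R3, moll ε z = mollMass := by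
  have h := Measure.integral_comp_smul (volume : Measure R3) (fun z => bump (‖z‖ ^ 2)) ε⁻¹
  simp only [moll, mollMass, integral_const_mul, h]
  have : Module.finrank ℝ R3 = 3 := by simp
  rw [this, abs_of_pos (by positivity)]
  simp only [smul_eq_mul, inv_one, one_pow, one_mul, one_smul]
  field_simp

lemma mollMass_pos : 0 < mollMass := by
  obtain ⟨ξ, hξ, hd⟩ := exists_deriv_eq_slope Real.smoothTransition (zero_lt_one (α := ℝ))
    Real.smoothTransition.continuous.continuousOn
    (((Real.smoothTransition.contDiff (n := 1)).differentiable (by simp)).differentiableOn)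
  rw [Real.smoothTransition.one, Real.smoothTransition.zero] at hd
  have hpos : 0 < bump (1 + ξ) := by
    rw [bump_of_pos (by linarith [hξ.1]), add_sub_cancel_left, hd]
    have : 0 < 1 + ξ := by linarith [hξ.1]
    norm_num
    positivity
  refine (continuous_moll 1).integral_pos_of_hasCompactSupport_nonneg_nonzero
    (hasCompactSupport_moll one_pos) (fun z => moll_nonneg one_pos z)
    (x := EuclideanSpace.single 0 (Real.sqrt (1 + ξ))) ?_
  rw [moll]
  simp only [inv_one, one_pow, one_smul, one_mul, PiLp.norm_single, Real.norm_eq_abs,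
    sq_abs]
  rw [Real.sq_sqrt (by linarith [hξ.1])]
  exact hpos.ne'

/-- The mollification of a function, normalised. -/
def mollify (ε : ℝ) (f : R3 → ℝ) (x : R3) : ℝ := mollMass⁻¹ * ∫ y, f y * moll ε (x - y)

/-- The singular kernel `|z|⁻²` truncated to a ball. -/
def sing (ε : ℝ) : R3 → ENNReal :=
  (Metric.ball (0 : R3) (2 * ε)).indicator fun z => ENNReal.ofReal (‖z‖ ^ (-2 : ℝ))

lemma measurable_sing (ε : ℝ) : Measurable (sing ε) :=
  Measurable.indicator (by fun_prop) Metric.isOpen_ball.measurableSet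

lemma scaled_profile_of_pos {ε s : ℝ} (hε : 0 < ε) (hs : 0 < s) :
    ε⁻¹ ^ 3 * profile (ε⁻¹ ^ 2 * s) =
      s ^ (-(3 / 2) : ℝ) * Real.smoothTransition (ε⁻¹ ^ 2 * s - 1) := by
  rw [profile, Real.mul_rpow (by positivity) hs.le, ← Real.rpow_natCast ε⁻¹ 2,
    ← Real.rpow_mul (by positivity)]
  have : ε⁻¹ ^ 3 * ε⁻¹ ^ (((2 : ℕ) : ℝ) * (-(3 / 2))) = 1 := by
    rw [← Real.rpow_natCast ε⁻¹ 3, ← Real.rpow_add (by positivity)]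
    norm_num
  calc _ = (ε⁻¹ ^ 3 * ε⁻¹ ^ (((2 : ℕ) : ℝ) * (-(3 / 2)))) * (s ^ (-(3 / 2) : ℝ) *
        Real.smoothTransition (ε⁻¹ ^ ((2 : ℕ) : ℝ) * s - 1)) := by ring
    _ = _ := by rw [this, one_mul, Real.rpow_natCast]

lemma enorm_sub_moll_le {δ ε : ℝ} (hδ : 0 < δ) (hδε : δ ≤ ε) (u : H1r) (x : R3) :
    ‖(∫ y, fn u y * moll δ (x - y)) - ∫ y, fn u y * moll ε (x - y)‖ₑ ≤
      ∫⁻ y, ‖grad u y‖ₑ * sing ε (x - y) := by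
  have hε : 0 < ε := hδ.trans_le hδε
  let k : ℝ → ℝ := fun s => δ⁻¹ ^ 3 * profile (δ⁻¹ ^ 2 * s) - ε⁻¹ ^ 3 * profile (ε⁻¹ ^ 2 * s)
  have hk : ContDiff ℝ ∞ k := by
    refine ContDiff.sub ?_ ?_ <;>
    exact contDiff_const.mul (contDiff_profile.comp (contDiff_const.mul contDiff_id))
  have hkpos : ∀ s, 0 < s → k s = s ^ (-(3 / 2) : ℝ) *
      (Real.smoothTransition (δ⁻¹ ^ 2 * s - 1) - Real.smoothTransition (ε⁻¹ ^ 2 * s - 1)) := by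
    intro s hs
    simp only [k]
    rw [scaled_profile_of_pos hδ hs, scaled_profile_of_pos hε hs]
    ring
  have hinv : ε⁻¹ ≤ δ⁻¹ := inv_anti₀ hδ hδε
  have hkR : ∀ s, 2 * ε ^ 2 ≤ s → k s = 0 := by
    intro s hs
    have hs0 : 0 < s := by have := sq_pos_of_pos hε; linarith
    have h1 : 2 ≤ ε⁻¹ ^ 2 * s := by
      have : ε⁻¹ ^ 2 * (2 * ε ^ 2) = 2 := by field_simp
      rw [← this]
      gcongr
    have h2 : ε⁻¹ ^ 2 * s ≤ δ⁻¹ ^ 2 * s := by gcongr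
    rw [hkpos s hs0, Real.smoothTransition.one_of_one_le (by linarith),
      Real.smoothTransition.one_of_one_le (by linarith), sub_self, mul_zero]
  have hkb : ∀ s, 0 < s → |k s| ≤ s ^ (-(3 / 2) : ℝ) := by
    intro s hs
    rw [hkpos s hs, abs_mul, abs_of_nonneg (by positivity)]
    refine mul_le_of_le_one_right (by positivity) ?_
    rw [abs_le]
    constructor <;>
    linarith [Real.smoothTransition.nonneg (δ⁻¹ ^ 2 * s - 1),
      Real.smoothTransition.nonneg (ε⁻¹ ^ 2 * s - 1), Real.smoothTransition.le_one (δ⁻¹ ^ 2 * s - 1),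
      Real.smoothTransition.le_one (ε⁻¹ ^ 2 * s - 1)]
  have hderiv : ∀ s, 3 * k s + 2 * s * deriv k s =
      δ⁻¹ ^ 3 * bump (δ⁻¹ ^ 2 * s) - ε⁻¹ ^ 3 * bump (ε⁻¹ ^ 2 * s) := by
    intro s
    have hp : ∀ r : ℝ, HasDerivAt profile (deriv profile r) r := fun r =>
      ((contDiff_profile.differentiable (by simp)) r).hasDerivAt
    have h1 : ∀ c : ℝ, HasDerivAt (fun s => c ^ 3 * profile (c ^ 2 * s))
        (c ^ 3 * (deriv profile (c ^ 2 * s) * c ^ 2)) s := fun c => by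
      refine HasDerivAt.const_mul _ ?_
      have := (hp (c ^ 2 * s)).comp s ((hasDerivAt_id s).const_mul (c ^ 2))
      simpa [Function.comp_def] using this
    have h2 : deriv k s = _ := ((h1 δ⁻¹).sub (h1 ε⁻¹)).deriv
    rw [h2]
    simp only [k, bump]
    ring
  have hint := integral_fn_mul_div_radial hk hkR u x
  simp only [hderiv] at hint
  have hmoll : ∀ (c : ℝ) (z : R3), c⁻¹ ^ 3 * bump (c⁻¹ ^ 2 * ‖z‖ ^ 2) = moll c z := fun c z => by
    rw [moll, norm_smul, mul_pow, Real.norm_eq_abs, sq_abs]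
  simp only [hmoll, mul_sub] at hint
  have hi : ∀ {c : ℝ}, 0 < c → Integrable (fun y => fn u y * moll c (x - y)) volume := fun hc =>
    (memLp_fn u).integrable_mul (memLp_moll_sub hc x 2)
  rw [← integral_sub (hi hδ) (hi hε), hint]
  refine (enorm_integral_le_lintegral_enorm _).trans (lintegral_mono fun y => ?_)
  rw [enorm_mul, sing]
  by_cases hz : x - y ∈ Metric.ball (0 : R3) (2 * ε)
  · rw [indicator_of_mem hz]
    have h1 : ‖(inner ℝ (grad u y) (x - y) : ℝ)‖ₑ ≤ ‖grad u y‖ₑ * ‖x - y‖ₑ := by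
      rw [← ofReal_norm, ← ofReal_norm, ← ofReal_norm, ← ENNReal.ofReal_mul (norm_nonneg _)]
      exact ENNReal.ofReal_le_ofReal (norm_inner_le_norm _ _)
    refine (mul_le_mul_left h1 _).trans ?_
    rw [mul_assoc]
    refine mul_le_mul_right ?_ _
    rw [← ofReal_norm, ← ofReal_norm, ← ENNReal.ofReal_mul (norm_nonneg _)]
    refine ENNReal.ofReal_le_ofReal ?_
    rcases (norm_nonneg (x - y)).eq_or_lt with h0 | h0
    · rw [← h0, zero_mul]; positivity
    · refine (mul_le_mul_of_nonneg_left (hkb _ (by positivity)) h0.le).trans_eq ?_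
      rw [← Real.rpow_natCast, ← Real.rpow_mul h0.le, mul_comm, ← Real.rpow_add_one h0.ne']
      norm_num
  · rw [hkR, enorm_zero, mul_zero]
    · exact zero_le
    · rw [mem_ball_zero_iff, not_lt] at hz
      nlinarith

lemma tendsto_integral_moll (u : H1r) :
    ∀ᵐ x, Tendsto (fun n : ℕ => mollify (1 / ((n : ℝ) + 1)) (fn u) x) atTop (𝓝 (fn u x)) := by
  have hloc : LocallyIntegrable (fn u) volume := (memLp_fn u).locallyIntegrable (by norm_num)
  obtain ⟨M, hM⟩ : ∃ M, ∀ s, |bump s| ≤ M := by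
    have hc : ContinuousOn bump (Icc 0 2) := continuous_bump.continuousOn
    obtain ⟨M, hM⟩ := isCompact_Icc.exists_bound_of_continuousOn hc
    have hM0 : 0 ≤ M := (norm_nonneg _).trans (hM 0 (by simp))
    refine ⟨max M |bump 0|, fun s => ?_⟩
    rcases lt_or_ge s 0 with h | h
    · have hz : ∀ t < 0, bump t = 0 := by
        intro t ht
        have : profile =ᶠ[𝓝 t] fun _ => 0 := by
          filter_upwards [Iio_mem_nhds (show t < 1 by linarith)] with r hr
          rw [profile, Real.smoothTransition.zero_of_nonpos (by linarith [mem_Iio.1 hr]), mul_zero]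
        rw [bump, this.deriv_eq, this.eq_of_nhds]; simp
      rw [hz s h, abs_zero]
      exact le_max_of_le_left hM0
    · rcases le_or_gt s 2 with h2 | h2
      · exact le_max_of_le_left (hM s ⟨h, h2⟩)
      · rw [bump_of_two_le h2.le, abs_zero]
        exact le_max_of_le_left hM0
  have hM0 : 0 ≤ M := (abs_nonneg _).trans (hM 0)
  have hδ : Tendsto (fun n : ℕ => 2 * (1 / ((n : ℝ) + 1))) atTop (𝓝[>] 0) := by
    refine tendsto_nhdsWithin_iff.2 ⟨?_, Eventually.of_forall fun n => by
      simp only [mem_Ioi]; positivity⟩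
    simpa using (tendsto_one_div_add_atTop_nhds_zero_nat (𝕜 := ℝ)).const_mul 2
  filter_upwards [IsUnifLocDoublingMeasure.ae_tendsto_average_norm_sub volume hloc 1] with x hx
  have hav := hx (fun _ : ℕ => x) _ hδ (Eventually.of_forall fun n => by
    simp only [one_mul, Metric.mem_closedBall, dist_self]; positivity)
  set c1 : ℝ := volume.real (Metric.closedBall (0 : R3) 1) with hc1
  have key := tendsto_integral_smul_of_tendsto_average_norm_sub
    (g := fun (n : ℕ) y => mollMass⁻¹ * moll (1 / ((n : ℝ) + 1)) (x - y))
    (mollMass⁻¹ * M * (8 * c1)) hav ?_ ?_ ?_ ?_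
  · refine key.congr fun n => ?_
    rw [mollify, ← integral_const_mul]
    refine integral_congr_ae (Eventually.of_forall fun y => ?_)
    simp only [smul_eq_mul]
    ring
  · exact Eventually.of_forall fun n => hloc.integrableOn_isCompact (isCompact_closedBall _ _)
  · refine tendsto_const_nhds.congr fun n => ?_
    rw [integral_const_mul, integral_sub_left_eq_self (fun z => moll _ z),
      integral_moll (by positivity), inv_mul_cancel₀ mollMass_pos.ne']
  · refine Eventually.of_forall fun n y hy => ?_
    by_contra hfar
    rw [Metric.mem_closedBall, dist_comm, dist_eq_norm, not_le] at hfar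
    exact hy (by simp only [moll_eq_zero (show (0 : ℝ) < 1 / ((n : ℝ) + 1) by positivity) hfar.le,
      mul_zero])
  · refine Eventually.of_forall fun n y => ?_
    set ε : ℝ := 1 / ((n : ℝ) + 1) with hε
    have hε0 : 0 < ε := by positivity
    have hc1pos : 0 < c1 := by
      rw [hc1, Measure.real, ENNReal.toReal_pos_iff]
      exact ⟨Metric.measure_closedBall_pos _ _ one_pos, measure_closedBall_lt_top⟩
    have hvol : volume.real (Metric.closedBall x (2 * ε)) = 8 * ε ^ 3 * c1 := by
      have := Measure.addHaar_real_closedBall (volume : Measure R3) x (show 0 ≤ 2 * ε by positivity)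
      rw [this, hc1, Measure.addHaar_real_closedBall_eq_addHaar_real_ball]
      have h3 : Module.finrank ℝ R3 = 3 := by simp
      rw [h3]
      ring
    rw [hvol, moll, abs_mul, abs_mul, abs_of_pos (inv_pos.2 mollMass_pos),
      abs_of_pos (show 0 < ε⁻¹ ^ 3 by positivity), mul_assoc mollMass⁻¹ M, mul_div_assoc]
    refine mul_le_mul_of_nonneg_left ?_ (inv_pos.2 mollMass_pos).le
    have : M * (8 * c1) / (8 * ε ^ 3 * c1) = ε⁻¹ ^ 3 * M := by
      field_simp
    rw [this]
    exact mul_le_mul_of_nonneg_left (hM _) (by positivity)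

/-- A function in `H¹_r` differs from its mollification by at most a singular integral of its
gradient. -/
lemma enorm_sub_mollify_le {ε : ℝ} (hε : 0 < ε) (u : H1r) :
    ∀ᵐ x, ‖fn u x - mollify ε (fn u) x‖ₑ ≤
      ENNReal.ofReal mollMass⁻¹ * ∫⁻ y, ‖grad u y‖ₑ * sing ε (x - y) := by
  filter_upwards [tendsto_integral_moll u] with x hx
  have h1 : Tendsto (fun n : ℕ => ‖mollify (1 / ((n : ℝ) + 1)) (fn u) x - mollify ε (fn u) x‖ₑ)
      atTop (𝓝 ‖fn u x - mollify ε (fn u) x‖ₑ) :=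
    (continuous_enorm.tendsto _).comp (hx.sub tendsto_const_nhds)
  refine le_of_tendsto h1 ?_
  have h2 := (tendsto_one_div_add_atTop_nhds_zero_nat (𝕜 := ℝ)).eventually_lt_const hε
  filter_upwards [h2] with n hn
  rw [mollify, mollify, ← mul_sub, enorm_mul, Real.enorm_of_nonneg (inv_pos.2 mollMass_pos).le]
  exact mul_le_mul_right (enorm_sub_moll_le (by positivity) hn.le u x) _

open ENNReal in
lemma sq_lintegral_conv_le {κ g : R3 → ℝ≥0∞} (hκ : Measurable κ) (hg : AEMeasurable g volume)
    {α : ℝ} (h0 : 0 ≤ α) (h1 : α ≤ 1) (x : R3) :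
    (∫⁻ y, g y * κ (x - y)) ^ (2 : ℝ) ≤
      (∫⁻ y, κ y ^ (2 * α)) * ∫⁻ y, κ (x - y) ^ (2 * (1 - α)) * g y ^ (2 : ℝ) := by
  have hκx : Measurable fun y => κ (x - y) := hκ.comp (measurable_const.sub measurable_id)
  have h := ENNReal.lintegral_mul_le_Lp_mul_Lq volume Real.HolderConjugate.two_two
    (f := fun y => κ (x - y) ^ α) (g := fun y => κ (x - y) ^ (1 - α) * g y)
    (hκx.pow_const _).aemeasurable ((hκx.pow_const _).aemeasurable.mul hg)
  have e : ∀ y, g y * κ (x - y) = κ (x - y) ^ α * (κ (x - y) ^ (1 - α) * g y) := fun y => by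
    rw [← mul_assoc, ← ENNReal.rpow_add_of_nonneg _ _ h0 (by linarith)]
    simp [mul_comm]
  simp only [Pi.mul_apply] at h
  simp only [e]
  refine (ENNReal.rpow_le_rpow h (by norm_num)).trans_eq ?_
  rw [ENNReal.mul_rpow_of_nonneg _ _ (by norm_num), ← ENNReal.rpow_mul, ← ENNReal.rpow_mul]
  norm_num only [one_div, inv_mul_cancel₀, ENNReal.rpow_one]
  congr 1
  · rw [← lintegral_sub_left_eq_self (fun y => κ y ^ (2 * α)) x]
    refine lintegral_congr fun y => ?_
    rw [← ENNReal.rpow_mul, mul_comm]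
  · refine lintegral_congr fun y => ?_
    rw [ENNReal.mul_rpow_of_nonneg _ _ (by norm_num),
      ← ENNReal.rpow_mul, mul_comm (1 - α)]

open ENNReal in
lemma rpow_lintegral_conv_le {κ g : R3 → ℝ≥0∞} (hκ : Measurable κ) (hg : AEMeasurable g volume)
    {α p : ℝ} (hp : 2 < p) (h0 : 0 ≤ α) (h1 : α ≤ 1) (x : R3) :
    (∫⁻ y, g y * κ (x - y)) ^ p ≤ (∫⁻ y, κ y ^ (2 * α)) ^ (p / 2) *
      ((∫⁻ y, κ (x - y) ^ ((1 - α) * p) * g y ^ (2 : ℝ)) * (∫⁻ y, g y ^ (2 : ℝ)) ^ (p / 2 - 1)) := by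
  have hκx : Measurable fun y => κ (x - y) := hκ.comp (measurable_const.sub measurable_id)
  set q := p / 2 with hq
  have hq1 : 1 < q := by rw [hq]; linarith
  have hq0 : q ≠ 0 := by positivity
  have hconj := Real.HolderConjugate.conjExponent hq1
  set q' := q.conjExponent with hq'
  have hqq : (1 - 1 / q) * q' = 1 := by
    have h2 := hconj.inv_add_inv_eq_one
    have h3 : 1 - 1 / q = q'⁻¹ := by rw [one_div]; linarith
    rw [h3, inv_mul_cancel₀ hconj.symm.ne_zero]
  have h := ENNReal.lintegral_mul_le_Lp_mul_Lq volume hconj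
    (f := fun y => κ (x - y) ^ (2 * (1 - α)) * g y ^ (2 / q)) (g := fun y => g y ^ (2 * (1 - 1 / q)))
    ((hκx.pow_const _).aemeasurable.mul (hg.pow_const _)) (hg.pow_const _)
  have hle : 1 / q ≤ 1 := by rw [div_le_one (by positivity)]; exact hq1.le
  have e : ∀ y, κ (x - y) ^ (2 * (1 - α)) * g y ^ (2 : ℝ) =
      κ (x - y) ^ (2 * (1 - α)) * g y ^ (2 / q) * g y ^ (2 * (1 - 1 / q)) := fun y => by
    rw [mul_assoc, ← ENNReal.rpow_add_of_nonneg _ _ (by positivity) (by linarith)]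
    congr 2
    ring
  have e2 : ∀ y, (κ (x - y) ^ (2 * (1 - α)) * g y ^ (2 / q)) ^ q =
      κ (x - y) ^ ((1 - α) * p) * g y ^ (2 : ℝ) := fun y => by
    rw [ENNReal.mul_rpow_of_nonneg _ _ (by positivity), ← ENNReal.rpow_mul, ← ENNReal.rpow_mul]
    congr 2
    · rw [hq]; ring
    · field_simp
  have e3 : ∀ y, (g y ^ (2 * (1 - 1 / q))) ^ q' = g y ^ (2 : ℝ) := fun y => by
    rw [← ENNReal.rpow_mul, mul_assoc, hqq, mul_one]
  simp only [Pi.mul_apply, e2, e3] at h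
  simp only [← e] at h
  have hA := sq_lintegral_conv_le hκ hg h0 h1 x
  calc (∫⁻ y, g y * κ (x - y)) ^ p = ((∫⁻ y, g y * κ (x - y)) ^ (2 : ℝ)) ^ q := by
        rw [← ENNReal.rpow_mul]; congr 1; rw [hq]; ring
    _ ≤ ((∫⁻ y, κ y ^ (2 * α)) * _) ^ q := ENNReal.rpow_le_rpow (hA.trans (mul_le_mul_right h _))
        (by positivity)
    _ = _ := by
      rw [ENNReal.mul_rpow_of_nonneg _ _ (by positivity),
        ENNReal.mul_rpow_of_nonneg _ _ (by positivity), ← ENNReal.rpow_mul, ← ENNReal.rpow_mul]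
      congr 2
      · rw [one_div, inv_mul_cancel₀ hq0, ENNReal.rpow_one]
      · congr 1
        have h2 := hconj.inv_add_inv_eq_one
        have h3 : 1 / q' = 1 - q⁻¹ := by rw [one_div]; linarith
        rw [h3, sub_mul, one_mul, inv_mul_cancel₀ hq0]

open ENNReal in
/-- A form of **Young's convolution inequality**. -/
lemma lintegral_rpow_conv_le {κ g : R3 → ℝ≥0∞} (hκ : Measurable κ) (hg : AEMeasurable g volume)
    {α p : ℝ} (hp : 2 < p) (h0 : 0 ≤ α) (h1 : α ≤ 1) :
    ∫⁻ x, (∫⁻ y, g y * κ (x - y)) ^ p ≤ (∫⁻ y, κ y ^ (2 * α)) ^ (p / 2) *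
      (∫⁻ y, κ y ^ ((1 - α) * p)) * (∫⁻ y, g y ^ (2 : ℝ)) ^ (p / 2) := by
  have hm : AEMeasurable (fun z : R3 × R3 => κ (z.1 - z.2) ^ ((1 - α) * p) * g z.2 ^ (2 : ℝ))
      (volume.prod volume) :=
    ((hκ.comp (measurable_fst.sub measurable_snd)).pow_const _).aemeasurable.mul
      ((hg.comp_quasiMeasurePreserving Measure.quasiMeasurePreserving_snd).pow_const _)
  have hm1 : AEMeasurable (fun x : R3 => ∫⁻ y, κ (x - y) ^ ((1 - α) * p) * g y ^ (2 : ℝ)) volume :=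
    hm.lintegral_prod_right'
  calc ∫⁻ x, (∫⁻ y, g y * κ (x - y)) ^ p
      ≤ ∫⁻ x, (∫⁻ y, κ y ^ (2 * α)) ^ (p / 2) * ((∫⁻ y, κ (x - y) ^ ((1 - α) * p) * g y ^ (2 : ℝ)) *
        (∫⁻ y, g y ^ (2 : ℝ)) ^ (p / 2 - 1)) :=
        lintegral_mono fun x => rpow_lintegral_conv_le hκ hg hp h0 h1 x
    _ = (∫⁻ y, κ y ^ (2 * α)) ^ (p / 2) * ((∫⁻ x, ∫⁻ y, κ (x - y) ^ ((1 - α) * p) * g y ^ (2 : ℝ)) *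
        (∫⁻ y, g y ^ (2 : ℝ)) ^ (p / 2 - 1)) := by
        rw [lintegral_const_mul'' _ (hm1.mul_const _), lintegral_mul_const'' _ hm1]
    _ = _ := by
      rw [lintegral_lintegral_swap hm]
      have : ∀ y, ∫⁻ x, κ (x - y) ^ ((1 - α) * p) * g y ^ (2 : ℝ) =
          (∫⁻ x, κ x ^ ((1 - α) * p)) * g y ^ (2 : ℝ) := fun y => by
        have hκy : Measurable fun x => κ (x - y) := hκ.comp (measurable_id.sub measurable_const)
        rw [lintegral_mul_const _ (hκy.pow_const _),
          lintegral_sub_right_eq_self (fun x => κ x ^ ((1 - α) * p)) y]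
      simp only [this]
      rw [lintegral_const_mul'' _ (hg.pow_const _), mul_assoc, mul_assoc]
      congr 2
      nth_rewrite 1 [← ENNReal.rpow_one (∫⁻ y, g y ^ (2 : ℝ))]
      rw [← ENNReal.rpow_add_of_nonneg _ _ (by norm_num) (by linarith)]
      congr 1
      ring

lemma lintegral_norm_rpow_ball_lt_top {s r : ℝ} (hs : s < 3) :
    ∫⁻ z in Metric.ball (0 : R3) r, ENNReal.ofReal (‖z‖ ^ (-s)) < ⊤ := by
  have h := integrableOn_ball_of_norm_le_rpow (E := R3) (F := ℝ) (μ := volume) (r := r) (C := 1)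
    (α := s) (f := fun z => ‖z‖ ^ (-s)) (by simp) (by simpa using hs)
    (Eventually.of_forall fun z => by
      rw [Real.norm_of_nonneg (Real.rpow_nonneg (norm_nonneg _) _), one_mul])
    (measurable_norm.pow_const _).aestronglyMeasurable
  have h2 := h.2
  rw [hasFiniteIntegral_iff_ofReal (Eventually.of_forall fun z =>
    Real.rpow_nonneg (norm_nonneg _) _)] at h2
  exact h2

lemma lintegral_sing_rpow {ε t : ℝ} (ht : 0 < t) :
    ∫⁻ z, sing ε z ^ t = ∫⁻ z in Metric.ball (0 : R3) (2 * ε), ENNReal.ofReal (‖z‖ ^ (-(2 * t))) := by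
  rw [← lintegral_indicator Metric.isOpen_ball.measurableSet]
  refine lintegral_congr fun z => ?_
  by_cases hz : z ∈ Metric.ball (0 : R3) (2 * ε)
  · rw [sing, indicator_of_mem hz, indicator_of_mem hz,
      ENNReal.ofReal_rpow_of_nonneg (by positivity) ht.le, ← Real.rpow_mul (norm_nonneg _)]
    congr 2
    ring
  · rw [sing, indicator_of_notMem hz, indicator_of_notMem hz, ENNReal.zero_rpow_of_pos ht]

lemma tendsto_lintegral_sing_rpow {t : ℝ} (ht : 0 < t) (ht2 : 2 * t < 3) :
    Tendsto (fun n : ℕ => ∫⁻ z, sing (1 / ((n : ℝ) + 1)) z ^ t) atTop (𝓝 0) := by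
  simp only [lintegral_sing_rpow ht]
  have hb := (lintegral_norm_rpow_ball_lt_top (r := 2) ht2).ne
  have hsub : ∀ n : ℕ, Metric.ball (0 : R3) (2 * (1 / ((n : ℝ) + 1))) ⊆ Metric.ball 0 2 := fun n => by
    refine Metric.ball_subset_ball ?_
    have : 1 / ((n : ℝ) + 1) ≤ 1 := by
      rw [div_le_one (by positivity)]; linarith [(Nat.cast_nonneg n : (0 : ℝ) ≤ n)]
    linarith
  have hvol : Tendsto (fun n : ℕ => (volume.restrict (Metric.ball (0 : R3) 2))
      (Metric.ball (0 : R3) (2 * (1 / ((n : ℝ) + 1))))) atTop (𝓝 0) := by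
    have h1 : ∀ n : ℕ, (volume.restrict (Metric.ball (0 : R3) 2))
        (Metric.ball (0 : R3) (2 * (1 / ((n : ℝ) + 1)))) =
        ENNReal.ofReal ((2 * (1 / ((n : ℝ) + 1))) ^ 3) * volume (Metric.ball (0 : R3) 1) := fun n => by
      rw [Measure.restrict_eq_self _ (hsub n), Measure.addHaar_ball _ _ (by positivity)]
      simp
    simp only [h1]
    have h2 : Tendsto (fun n : ℕ => (2 * (1 / ((n : ℝ) + 1))) ^ 3) atTop (𝓝 0) := by
      simpa using ((tendsto_one_div_add_atTop_nhds_zero_nat (𝕜 := ℝ)).const_mul 2).pow 3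
    have h3 := ENNReal.Tendsto.mul_const (ENNReal.tendsto_ofReal h2)
      (Or.inr (measure_ball_lt_top (μ := (volume : Measure R3)) (x := 0) (r := 1)).ne)
    simpa using h3
  refine (tendsto_setLIntegral_zero hb hvol).congr fun n => ?_
  rw [Measure.restrict_restrict Metric.isOpen_ball.measurableSet, inter_eq_left.2 (hsub n)]

lemma norm_fst_le (u : H1r) : ‖(u : L2Pair).fst‖ ≤ ‖u‖ :=
  (abs_le_of_sq_le_sq' (by rw [← D_eq_norm_sq]; exact D_le_norm_sq u) (norm_nonneg _)).2

lemma norm_snd_le (u : H1r) : ‖(u : L2Pair).snd‖ ≤ ‖u‖ :=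
  (abs_le_of_sq_le_sq' (by rw [← A_eq_norm_sq]; exact A_le_norm_sq u) (norm_nonneg _)).2

lemma lintegral_enorm_rpow_two {X : Type*} [NormedAddCommGroup X]
    (f : Lp X 2 (volume : Measure R3)) :
    ∫⁻ x, ‖f x‖ₑ ^ (2 : ℝ) = ENNReal.ofReal (‖f‖ ^ 2) := by
  have h1 : eLpNorm f 2 volume ^ (2 : ℝ) = ∫⁻ x, ‖f x‖ₑ ^ (2 : ℝ) := by
    rw [eLpNorm_eq_lintegral_rpow_enorm_toReal two_ne_zero ENNReal.ofNat_ne_top, ← ENNReal.rpow_mul]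
    simp
  rw [← h1, ← Lp.enorm_def, ← ofReal_norm, ENNReal.ofReal_rpow_of_nonneg (norm_nonneg _) (by norm_num)]
  norm_num

lemma lintegral_fn_le (u : H1r) : ∫⁻ x, ‖fn u x‖ₑ ^ (2 : ℝ) ≤ ENNReal.ofReal (‖u‖ ^ 2) := by
  rw [fn, lintegral_enorm_rpow_two]
  exact ENNReal.ofReal_le_ofReal (by gcongr; exact norm_fst_le u)

lemma lintegral_grad_le (u : H1r) : ∫⁻ x, ‖grad u x‖ₑ ^ (2 : ℝ) ≤ ENNReal.ofReal (‖u‖ ^ 2) := by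
  rw [grad, lintegral_enorm_rpow_two]
  exact ENNReal.ofReal_le_ofReal (by gcongr; exact norm_snd_le u)

/-- In the subcritical range, mollification approximates functions in `H¹_r` in `L^p`, uniformly on
bounded sets. -/
lemma exists_lintegral_sub_mollify_le {p : ℝ} (hp : 2 < p) (hp' : p < 6) {η : ℝ} (hη : 0 < η) :
    ∃ ε > 0, ∀ u : H1r, ∫⁻ x, ‖fn u x - mollify ε (fn u) x‖ₑ ^ p ≤ ENNReal.ofReal (η * ‖u‖ ^ p) := by
  have hp0 : 0 < p := by linarith
  set a : ℝ := max 0 (1 - 3 / (2 * p)) with ha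
  set α : ℝ := (a + 3 / 4) / 2 with hα
  have ha1 : a < 3 / 4 := by
    refine max_lt (by norm_num) ?_
    have : 1 / 4 < 3 / (2 * p) := by rw [div_lt_div_iff₀ (by norm_num) (by positivity)]; linarith
    linarith
  have ha0 : 0 ≤ a := le_max_left _ _
  have hα1 : α < 3 / 4 := by rw [hα]; linarith
  have hα0 : 0 < α := by rw [hα]; linarith
  have hα2 : 2 * ((1 - α) * p) < 3 := by
    have h1 : 1 - 3 / (2 * p) < α := by
      have := le_max_right 0 (1 - 3 / (2 * p))
      rw [hα]; linarith
    have h2 : 1 - α < 3 / (2 * p) := by linarith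
    rw [lt_div_iff₀ (by positivity)] at h2
    linarith
  have hc : ENNReal.ofReal mollMass⁻¹ ^ p ≠ ⊤ :=
    ENNReal.rpow_ne_top_of_nonneg hp0.le ENNReal.ofReal_ne_top
  have hlim : Tendsto (fun n : ℕ => ENNReal.ofReal mollMass⁻¹ ^ p *
      ((∫⁻ z, sing (1 / ((n : ℝ) + 1)) z ^ (2 * α)) ^ (p / 2) *
        ∫⁻ z, sing (1 / ((n : ℝ) + 1)) z ^ ((1 - α) * p))) atTop (𝓝 0) := by
    have h1 := (tendsto_lintegral_sing_rpow (t := 2 * α) (by linarith) (by linarith)).ennrpow_const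
      (p / 2)
    have h2 := tendsto_lintegral_sing_rpow (t := (1 - α) * p)
      (mul_pos (by linarith) hp0) hα2
    rw [ENNReal.zero_rpow_of_pos (by linarith)] at h1
    have h3 := ENNReal.Tendsto.mul h1 (Or.inr ENNReal.zero_ne_top) h2 (Or.inr ENNReal.zero_ne_top)
    rw [mul_zero] at h3
    have h4 := ENNReal.Tendsto.const_mul h3 (Or.inr hc)
    rwa [mul_zero] at h4
  obtain ⟨n, hn⟩ := (hlim.eventually_le_const (ENNReal.ofReal_pos.2 hη)).exists
  set ε : ℝ := 1 / ((n : ℝ) + 1) with hε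
  have hε0 : 0 < ε := by positivity
  refine ⟨ε, hε0, fun u => ?_⟩
  have hg : AEMeasurable (fun y => ‖grad u y‖ₑ) volume := (memLp_grad u).1.enorm
  calc ∫⁻ x, ‖fn u x - mollify ε (fn u) x‖ₑ ^ p
      ≤ ∫⁻ x, ENNReal.ofReal mollMass⁻¹ ^ p * (∫⁻ y, ‖grad u y‖ₑ * sing ε (x - y)) ^ p := by
        refine lintegral_mono_ae ?_
        filter_upwards [enorm_sub_mollify_le hε0 u] with x hx
        rw [← ENNReal.mul_rpow_of_nonneg _ _ hp0.le]
        exact ENNReal.rpow_le_rpow hx hp0.le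
    _ = ENNReal.ofReal mollMass⁻¹ ^ p * ∫⁻ x, (∫⁻ y, ‖grad u y‖ₑ * sing ε (x - y)) ^ p :=
        lintegral_const_mul' _ _ hc
    _ ≤ ENNReal.ofReal mollMass⁻¹ ^ p * ((∫⁻ z, sing ε z ^ (2 * α)) ^ (p / 2) *
        (∫⁻ z, sing ε z ^ ((1 - α) * p)) * (∫⁻ y, ‖grad u y‖ₑ ^ (2 : ℝ)) ^ (p / 2)) :=
        mul_le_mul_right (lintegral_rpow_conv_le (measurable_sing ε) hg hp hα0.le (by linarith)) _
    _ ≤ ENNReal.ofReal η * ENNReal.ofReal (‖u‖ ^ p) := by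
        rw [← mul_assoc]
        refine mul_le_mul hn ?_ zero_le zero_le
        refine (ENNReal.rpow_le_rpow (lintegral_grad_le u) (by linarith)).trans_eq ?_
        rw [ENNReal.ofReal_rpow_of_nonneg (by positivity) (by linarith), ← Real.rpow_natCast,
          ← Real.rpow_mul (norm_nonneg _)]
        congr 2
        push_cast; ring
    _ = _ := (ENNReal.ofReal_mul hη.le).symm

/-! ### Mollification of functions in `L²` -/

/-- The translated mollifier as an element of `L²`. -/
def kern {ε : ℝ} (hε : 0 < ε) (x : R3) : Lp ℝ 2 (volume : Measure R3) :=
  (memLp_moll_sub hε x 2).toLp _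

lemma mollify_eq_inner {ε : ℝ} (hε : 0 < ε) (u : H1r) (x : R3) :
    mollify ε (fn u) x = mollMass⁻¹ * inner ℝ (kern hε x) (u : L2Pair).fst := by
  rw [mollify, L2.inner_def]
  congr 1
  refine integral_congr_ae ?_
  filter_upwards [(memLp_moll_sub hε x 2).coeFn_toLp] with y hy
  rw [kern, hy]
  rfl

lemma continuous_kern {ε : ℝ} (hε : 0 < ε) : Continuous (kern hε) := by
  rw [continuous_iff_continuousAt]
  intro x₀
  have hnorm : ∀ x, ‖kern hε x - kern hε x₀‖ ^ 2 =
      ∫ y, (moll ε (x - y) - moll ε (x₀ - y)) ^ 2 := by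
    intro x
    rw [← real_inner_self_eq_norm_sq, L2.inner_def]
    refine integral_congr_ae ?_
    filter_upwards [(memLp_moll_sub hε x 2).coeFn_toLp, (memLp_moll_sub hε x₀ 2).coeFn_toLp,
      Lp.coeFn_sub (kern hε x) (kern hε x₀)] with y h1 h2 h3
    rw [h3, Pi.sub_apply, kern, kern, h1, h2]
    simp [sq]
  obtain ⟨M, hM⟩ := (hasCompactSupport_moll hε).exists_bound_of_continuous (continuous_moll ε)
  have hc : ContinuousAt (fun x => ∫ y, (moll ε (x - y) - moll ε (x₀ - y)) ^ 2) x₀ := by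
    refine continuousAt_of_dominated
      (bound := (Metric.closedBall x₀ (2 * ε + 1)).indicator fun _ => (2 * M) ^ 2) ?_ ?_ ?_ ?_
    · refine Eventually.of_forall fun x => Continuous.aestronglyMeasurable ?_
      have := continuous_moll ε
      fun_prop
    · filter_upwards [Metric.ball_mem_nhds x₀ one_pos] with x hx
      refine Eventually.of_forall fun y => ?_
      by_cases hy : y ∈ Metric.closedBall x₀ (2 * ε + 1)
      · rw [indicator_of_mem hy, norm_pow]
        refine pow_le_pow_left₀ (norm_nonneg _) ?_ 2
        exact (norm_sub_le _ _).trans (by linarith [hM (x - y), hM (x₀ - y)])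
      · rw [indicator_of_notMem hy]
        rw [Metric.mem_closedBall, not_le] at hy
        rw [Metric.mem_ball, dist_comm] at hx
        have h1 : 2 * ε ≤ ‖x - y‖ := by
          rw [← dist_eq_norm]
          have := dist_triangle y x x₀
          rw [dist_comm x x₀, dist_comm y x] at this
          linarith
        have h2 : 2 * ε ≤ ‖x₀ - y‖ := by
          rw [← dist_eq_norm, dist_comm]; linarith
        simp [moll_eq_zero hε h1, moll_eq_zero hε h2]
    · exact (integrable_indicator_iff Metric.isClosed_closedBall.measurableSet).2
        (integrableOn_const measure_closedBall_lt_top.ne)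
    · refine Eventually.of_forall fun y => Continuous.continuousAt ?_
      have := continuous_moll ε
      fun_prop
  have h0 : Tendsto (fun x => ‖kern hε x - kern hε x₀‖ ^ 2) (𝓝 x₀) (𝓝 0) := by
    simp only [hnorm]
    have := hc.tendsto
    simpa using this
  rw [ContinuousAt, tendsto_iff_norm_sub_tendsto_zero]
  have := h0.sqrt
  simpa [Real.sqrt_sq (norm_nonneg _)] using this

lemma continuous_mollify {ε : ℝ} (hε : 0 < ε) (u : H1r) : Continuous (mollify ε (fn u)) := by
  have h : mollify ε (fn u) = fun x => mollMass⁻¹ * inner ℝ (kern hε x) (u : L2Pair).fst :=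
    funext fun x => mollify_eq_inner hε u x
  rw [h]
  exact continuous_const.mul ((continuous_kern hε).inner continuous_const)

lemma enorm_mollify_le (ε : ℝ) (f : R3 → ℝ) (x : R3) :
    ‖mollify ε f x‖ₑ ≤ ENNReal.ofReal mollMass⁻¹ * ∫⁻ y, ‖f y‖ₑ * ‖moll ε (x - y)‖ₑ := by
  rw [mollify, enorm_mul, Real.enorm_of_nonneg (inv_pos.2 mollMass_pos).le]
  refine mul_le_mul_right ((enorm_integral_le_lintegral_enorm _).trans_eq ?_) _
  simp only [enorm_mul]

lemma lintegral_moll_rpow_lt_top {ε : ℝ} (hε : 0 < ε) {t : ℝ} (ht : 0 < t) :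
    ∫⁻ z, ‖moll ε z‖ₑ ^ t < ⊤ := by
  have h : MemLp (moll ε) (ENNReal.ofReal t) volume :=
    (continuous_moll ε).memLp_of_hasCompactSupport (hasCompactSupport_moll hε)
  have := h.eLpNorm_lt_top
  have h2 := (eLpNorm_lt_top_iff_lintegral_rpow_enorm_lt_top (by simpa using ht)
    ENNReal.ofReal_ne_top).1 this
  rwa [ENNReal.toReal_ofReal ht.le] at h2

/-- The mollification at `x` is controlled by the `L²` norm on a ball around `x`. -/
lemma exists_sq_mollify_le {ε : ℝ} (hε : 0 < ε) :
    ∃ C : ℝ, 0 ≤ C ∧ ∀ (u : H1r) (x : R3), ‖mollify ε (fn u) x‖ₑ ^ (2 : ℝ) ≤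
      ENNReal.ofReal C * ∫⁻ y in Metric.ball x (2 * ε), ‖fn u y‖ₑ ^ (2 : ℝ) := by
  have hfin : ENNReal.ofReal mollMass⁻¹ ^ (2 : ℝ) * ∫⁻ z, ‖moll ε z‖ₑ ^ (2 : ℝ) ≠ ⊤ :=
    ENNReal.mul_ne_top (ENNReal.rpow_ne_top_of_nonneg (by norm_num) ENNReal.ofReal_ne_top)
      (lintegral_moll_rpow_lt_top hε (by norm_num)).ne
  refine ⟨_, ENNReal.toReal_nonneg
    (a := ENNReal.ofReal mollMass⁻¹ ^ (2 : ℝ) * ∫⁻ z, ‖moll ε z‖ₑ ^ (2 : ℝ)), fun u x => ?_⟩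
  rw [ENNReal.ofReal_toReal hfin]
  have hmeas : AEMeasurable (fun y => ‖fn u y‖ₑ) volume := (memLp_fn u).1.enorm
  have hcut : ∀ y, ‖fn u y‖ₑ * ‖moll ε (x - y)‖ₑ =
      (Metric.ball x (2 * ε)).indicator (fun y => ‖fn u y‖ₑ) y * ‖moll ε (x - y)‖ₑ := by
    intro y
    by_cases hy : y ∈ Metric.ball x (2 * ε)
    · rw [indicator_of_mem hy]
    · rw [Metric.mem_ball, dist_comm, dist_eq_norm, not_lt] at hy
      simp [moll_eq_zero hε hy]
  have h1 := sq_lintegral_conv_le (κ := fun z => ‖moll ε z‖ₑ) (continuous_moll ε).measurable.enorm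
    (hmeas.indicator Metric.isOpen_ball.measurableSet) zero_le_one le_rfl x
      (g := (Metric.ball x (2 * ε)).indicator (fun y => ‖fn u y‖ₑ))
  have h2 := enorm_mollify_le ε (fn u) x
  simp only [hcut] at h2
  refine (ENNReal.rpow_le_rpow h2 (by norm_num)).trans ?_
  rw [ENNReal.mul_rpow_of_nonneg _ _ (by norm_num), mul_assoc]
  refine mul_le_mul_right (h1.trans_eq ?_) _
  simp only [mul_one, sub_self, mul_zero, ENNReal.rpow_zero, one_mul]
  congr 1
  rw [← lintegral_indicator Metric.isOpen_ball.measurableSet]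
  refine lintegral_congr fun y => ?_
  by_cases hy : y ∈ Metric.ball x (2 * ε)
  · rw [indicator_of_mem hy, indicator_of_mem hy]
  · rw [indicator_of_notMem hy, indicator_of_notMem hy, ENNReal.zero_rpow_of_pos (by norm_num)]

lemma exists_lintegral_sq_mollify_le {ε : ℝ} (hε : 0 < ε) :
    ∃ C : ℝ, 0 ≤ C ∧ ∀ u : H1r, ∫⁻ x, ‖mollify ε (fn u) x‖ₑ ^ (2 : ℝ) ≤
      ENNReal.ofReal (C * ‖u‖ ^ 2) := by
  set m := ∫⁻ z, ‖moll ε z‖ₑ with hm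
  have hmfin : m ≠ ⊤ := by
    have := (lintegral_moll_rpow_lt_top hε one_pos).ne
    simpa using this
  have hmm : ENNReal.ofReal mollMass⁻¹ ^ (2 : ℝ) ≠ ⊤ :=
    ENNReal.rpow_ne_top_of_nonneg (by norm_num) ENNReal.ofReal_ne_top
  have hfin : ENNReal.ofReal mollMass⁻¹ ^ (2 : ℝ) * (m * m) ≠ ⊤ :=
    ENNReal.mul_ne_top hmm (ENNReal.mul_ne_top hmfin hmfin)
  refine ⟨_, ENNReal.toReal_nonneg (a := ENNReal.ofReal mollMass⁻¹ ^ (2 : ℝ) * (m * m)),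
    fun u => ?_⟩
  rw [ENNReal.ofReal_mul ENNReal.toReal_nonneg, ENNReal.ofReal_toReal hfin]
  have hg : AEMeasurable (fun y => ‖fn u y‖ₑ) volume := (memLp_fn u).1.enorm
  have hκ : Measurable fun z => ‖moll ε z‖ₑ := (continuous_moll ε).measurable.enorm
  have hjm : AEMeasurable (fun z : R3 × R3 => ‖moll ε (z.1 - z.2)‖ₑ * ‖fn u z.2‖ₑ ^ (2 : ℝ))
      (volume.prod volume) :=
    (hκ.comp (measurable_fst.sub measurable_snd)).aemeasurable.mul
      ((hg.comp_quasiMeasurePreserving Measure.quasiMeasurePreserving_snd).pow_const _)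
  have hpt : ∀ x, ‖mollify ε (fn u) x‖ₑ ^ (2 : ℝ) ≤ ENNReal.ofReal mollMass⁻¹ ^ (2 : ℝ) *
      (m * ∫⁻ y, ‖moll ε (x - y)‖ₑ * ‖fn u y‖ₑ ^ (2 : ℝ)) := by
    intro x
    have h1 := sq_lintegral_conv_le hκ hg (α := 1 / 2) (by norm_num) (by norm_num) x
    norm_num only [ENNReal.rpow_one] at h1
    refine (ENNReal.rpow_le_rpow (enorm_mollify_le ε (fn u) x) (by norm_num)).trans ?_
    rw [ENNReal.mul_rpow_of_nonneg _ _ (by norm_num)]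
    refine mul_le_mul_right ?_ _
    simpa using h1
  calc _ ≤ ∫⁻ x, ENNReal.ofReal mollMass⁻¹ ^ (2 : ℝ) *
      (m * ∫⁻ y, ‖moll ε (x - y)‖ₑ * ‖fn u y‖ₑ ^ (2 : ℝ)) := lintegral_mono hpt
    _ = ENNReal.ofReal mollMass⁻¹ ^ (2 : ℝ) *
      (m * ∫⁻ x, ∫⁻ y, ‖moll ε (x - y)‖ₑ * ‖fn u y‖ₑ ^ (2 : ℝ)) := by
      rw [lintegral_const_mul' _ _ hmm, lintegral_const_mul' _ _ hmfin]
    _ = ENNReal.ofReal mollMass⁻¹ ^ (2 : ℝ) * (m * (m * ∫⁻ y, ‖fn u y‖ₑ ^ (2 : ℝ))) := by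
      rw [lintegral_lintegral_swap hjm]
      have : ∀ y, ∫⁻ x, ‖moll ε (x - y)‖ₑ * ‖fn u y‖ₑ ^ (2 : ℝ) = m * ‖fn u y‖ₑ ^ (2 : ℝ) := by
        intro y
        have hκy : Measurable fun x => ‖moll ε (x - y)‖ₑ :=
          hκ.comp (measurable_id.sub measurable_const)
        rw [lintegral_mul_const _ hκy, lintegral_sub_right_eq_self (fun x => ‖moll ε x‖ₑ) y]
      simp only [this]
      rw [lintegral_const_mul' _ _ hmfin]
    _ ≤ _ := by
      rw [← mul_assoc m m, ← mul_assoc]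
      exact mul_le_mul_right (lintegral_fn_le u) _

lemma lintegral_rpow_le_of_bound {f : R3 → ℝ} {s : ENNReal} (hs : s ≠ ⊤) {p : ℝ} (hp : 2 < p)
    (hf : ∀ x, ‖f x‖ₑ ≤ s) :
    ∫⁻ x, ‖f x‖ₑ ^ p ≤ s ^ (p - 2) * ∫⁻ x, ‖f x‖ₑ ^ (2 : ℝ) := by
  rw [← lintegral_const_mul' _ _ (ENNReal.rpow_ne_top_of_nonneg (by linarith) hs)]
  refine lintegral_mono fun x => ?_
  calc ‖f x‖ₑ ^ p = ‖f x‖ₑ ^ (p - 2) * ‖f x‖ₑ ^ (2 : ℝ) := by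
        rw [← ENNReal.rpow_add_of_nonneg _ _ (by linarith) (by norm_num)]; congr 1; ring
    _ ≤ _ := mul_le_mul_left (ENNReal.rpow_le_rpow (hf x) (by linarith)) _

/-! ### Decay of radial functions -/

lemma lintegral_ball_isometry (u : H1r) (O : R3 ≃ₗᵢ[ℝ] R3) (x : R3) (r : ℝ) :
    ∫⁻ y in Metric.ball (O x) r, ‖fn u y‖ₑ ^ (2 : ℝ) =
      ∫⁻ y in Metric.ball x r, ‖fn u y‖ₑ ^ (2 : ℝ) := by
  have hpre : O ⁻¹' Metric.ball (O x) r = Metric.ball x r := by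
    ext y; simp
  have h := O.measurePreserving.setLIntegral_comp_preimage_emb O.toHomeomorph.measurableEmbedding
    (fun y => ‖fn u y‖ₑ ^ (2 : ℝ)) (Metric.ball (O x) r)
  rw [← h, hpre]
  refine lintegral_congr_ae (ae_restrict_of_ae ?_)
  filter_upwards [u.2.2 O] with y hy
  rw [show fn u (O y) = fn u y from hy]

lemma exists_radius_decay (N : ℕ) (r : ℝ) :
    ∃ R : ℝ, ∀ x : R3, R ≤ ‖x‖ → ∀ u : H1r,
      N * ∫⁻ y in Metric.ball x r, ‖fn u y‖ₑ ^ (2 : ℝ) ≤ ∫⁻ y, ‖fn u y‖ₑ ^ (2 : ℝ) := by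
  have hinf : (Metric.sphere (0 : R3) 1).Infinite := by
    refine (isPreconnected_sphere ?_ 0 1).infinite_of_nontrivial ?_
    · have : (3 : Cardinal) = Module.rank ℝ R3 := by
        rw [← Module.finrank_eq_rank]; simp
      rw [← this]
      norm_num
    · refine ⟨EuclideanSpace.single 0 1, by simp, -EuclideanSpace.single 0 1, by simp, fun h => ?_⟩
      have := congrArg (fun v : R3 => v 0) h
      simp only [PiLp.neg_apply, PiLp.single_apply, if_true] at this
      norm_num at this
  obtain ⟨s, hs, hcard⟩ := hinf.exists_subset_card_eq N
  obtain ⟨d, hd, hsep⟩ : ∃ d > 0, ∀ v ∈ s, ∀ w ∈ s, v ≠ w → d ≤ dist v w := by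
    classical
    by_cases hne : s.offDiag.Nonempty
    · obtain ⟨q, hq, hmin⟩ := s.offDiag.exists_min_image (fun q => dist q.1 q.2) hne
      rw [Finset.mem_offDiag] at hq
      exact ⟨dist q.1 q.2, dist_pos.2 hq.2.2, fun v hv w hw h =>
        hmin (v, w) (Finset.mem_offDiag.2 ⟨hv, hw, h⟩)⟩
    · refine ⟨1, one_pos, fun v hv w hw h => (hne ⟨(v, w), Finset.mem_offDiag.2 ⟨hv, hw, h⟩⟩).elim⟩
  refine ⟨2 * r / d, fun x hx u => ?_⟩
  have hunit : ∀ v ∈ s, ‖v‖ = 1 := fun v hv => by simpa using hs hv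
  have hball : ∀ v ∈ s, ∫⁻ y in Metric.ball (‖x‖ • v) r, ‖fn u y‖ₑ ^ (2 : ℝ) =
      ∫⁻ y in Metric.ball x r, ‖fn u y‖ₑ ^ (2 : ℝ) := by
    intro v hv
    have hnorm : ‖x‖ = ‖‖x‖ • v‖ := by rw [norm_smul, hunit v hv, norm_norm, mul_one]
    have hO := Submodule.reflection_sub hnorm
    rw [← hO]
    exact lintegral_ball_isometry u _ x r
  have hdisj : (s : Set R3).PairwiseDisjoint fun v => Metric.ball (‖x‖ • v) r := by
    intro v hv w hw hvw
    refine Metric.ball_disjoint_ball ?_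
    have h1 := hsep v hv w hw hvw
    rw [dist_smul₀, norm_norm]
    have h2 : 2 * r ≤ ‖x‖ * d := by rwa [div_le_iff₀ hd] at hx
    nlinarith [norm_nonneg x, mul_le_mul_of_nonneg_left h1 (norm_nonneg x)]
  have hunion := lintegral_biUnion_finset hdisj
    (fun v _ => Metric.isOpen_ball.measurableSet) (μ := (volume : Measure R3))
    fun y => ‖fn u y‖ₑ ^ (2 : ℝ)
  rw [Finset.sum_congr rfl hball, Finset.sum_const, hcard, nsmul_eq_mul] at hunion
  rw [← hunion]
  exact setLIntegral_le_lintegral _ _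

/-! ### The compact embedding into `L^p` -/

lemma tendsto_mollify_uniformly {ε : ℝ} (hε : 0 < ε) {u : ℕ → H1r} {M : ℝ} (hM : ∀ k, ‖u k‖ ≤ M)
    (hu : ∀ ℓ : StrongDual ℝ H1r, Tendsto (fun k => ℓ (u k)) atTop (𝓝 0)) {s : ℝ} (hs : 0 < s) :
    ∀ᶠ k in atTop, ∀ x, ‖mollify ε (fn (u k)) x‖ ≤ s := by
  have hM0 : 0 ≤ M := (norm_nonneg _).trans (hM 0)
  obtain ⟨C, hC0, hC⟩ := exists_sq_mollify_le hε
  obtain ⟨N, hN⟩ := exists_nat_gt (C * M ^ 2 / s ^ 2)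
  have hNpos : 0 < (N : ℝ) := lt_of_le_of_lt (by positivity) hN
  obtain ⟨R, hR⟩ := exists_radius_decay N (2 * ε)
  have hfar : ∀ k x, R ≤ ‖x‖ → ‖mollify ε (fn (u k)) x‖ ≤ s := by
    intro k x hx
    have h1 := hC (u k) x
    have h2 := (hR x hx (u k)).trans (lintegral_fn_le (u k))
    have h3 : ENNReal.ofReal N * ‖mollify ε (fn (u k)) x‖ₑ ^ (2 : ℝ) ≤
        ENNReal.ofReal (C * M ^ 2) := by
      calc _ ≤ ENNReal.ofReal N * (ENNReal.ofReal C *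
            ∫⁻ y in Metric.ball x (2 * ε), ‖fn (u k) y‖ₑ ^ (2 : ℝ)) := mul_le_mul_right h1 _
        _ = ENNReal.ofReal C * (N * ∫⁻ y in Metric.ball x (2 * ε), ‖fn (u k) y‖ₑ ^ (2 : ℝ)) := by
            rw [ENNReal.ofReal_natCast]; ring
        _ ≤ ENNReal.ofReal C * ENNReal.ofReal (‖u k‖ ^ 2) := mul_le_mul_right h2 _
        _ ≤ _ := by
            rw [← ENNReal.ofReal_mul hC0]
            refine ENNReal.ofReal_le_ofReal ?_
            have := hM k
            gcongr
    rw [← ofReal_norm, ENNReal.ofReal_rpow_of_nonneg (norm_nonneg _) (by norm_num),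
      ← ENNReal.ofReal_mul hNpos.le, ENNReal.ofReal_le_ofReal_iff (by positivity)] at h3
    rw [div_lt_iff₀ (by positivity)] at hN
    have h4 : ‖mollify ε (fn (u k)) x‖ ^ (2 : ℝ) ≤ s ^ 2 := by
      refine le_of_mul_le_mul_left (h3.trans hN.le) hNpos
    rw [Real.rpow_ofNat] at h4
    exact (abs_le_of_sq_le_sq' h4 hs.le).2
  set c := mollMass⁻¹ with hc
  have hcpos : 0 < c := inv_pos.2 mollMass_pos
  have hpt : ∀ x, ∀ᶠ k in atTop, ‖mollify ε (fn (u k)) x‖ < s / 2 := by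
    intro x
    have h1 : Tendsto (fun k => mollify ε (fn (u k)) x) atTop (𝓝 0) := by
      have := (hu ((innerSL ℝ (kern hε x)).comp
        ((WithLp.fstL 2 ℝ (Lp ℝ 2 (volume : Measure R3)) (Lp R3 2 (volume : Measure R3))).comp
          H1r.subtypeL))).const_mul c
      rw [mul_zero] at this
      refine this.congr fun k => ?_
      rw [mollify_eq_inner hε]
      rfl
    have h2 := h1.norm
    rw [norm_zero] at h2
    exact h2.eventually_lt_const (by linarith)
  have hnhd : ∀ x ∈ Metric.closedBall (0 : R3) R,
      {y | c * ‖kern hε y - kern hε x‖ * M < s / 2} ∈ 𝓝 x := by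
    intro x _
    have h1 : Continuous fun y => c * ‖kern hε y - kern hε x‖ * M :=
      (continuous_const.mul ((continuous_kern hε).sub continuous_const).norm).mul continuous_const
    refine h1.continuousAt.preimage_mem_nhds (Iio_mem_nhds ?_)
    simpa using hs
  obtain ⟨t, -, ht⟩ := (isCompact_closedBall (0 : R3) R).elim_nhds_subcover _ hnhd
  filter_upwards [(Finset.eventually_all t).2 fun x _ => hpt x] with k hk y
  rcases le_or_gt R ‖y‖ with hy | hy
  · exact hfar k y hy
  · obtain ⟨x, hx, hxy⟩ := mem_iUnion₂.1 (ht (mem_closedBall_zero_iff.2 hy.le))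
    have h1 : ‖mollify ε (fn (u k)) y - mollify ε (fn (u k)) x‖ ≤
        c * ‖kern hε y - kern hε x‖ * M := by
      rw [mollify_eq_inner hε, mollify_eq_inner hε, ← mul_sub, ← inner_sub_left, norm_mul,
        Real.norm_of_nonneg hcpos.le, mul_assoc]
      refine mul_le_mul_of_nonneg_left ((norm_inner_le_norm _ _).trans ?_) hcpos.le
      exact mul_le_mul_of_nonneg_left ((norm_fst_le _).trans (hM k)) (norm_nonneg _)
    have h2 := hk x hx
    have h3 : c * ‖kern hε y - kern hε x‖ * M < s / 2 := hxy
    calc ‖mollify ε (fn (u k)) y‖ = ‖(mollify ε (fn (u k)) y - mollify ε (fn (u k)) x) +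
          mollify ε (fn (u k)) x‖ := by rw [sub_add_cancel]
      _ ≤ _ := (norm_add_le _ _).trans (by linarith)

lemma lintegral_fn_rpow_le_add {p : ℝ} (hp : 1 ≤ p) {ε : ℝ} (hε : 0 < ε) (u : H1r) :
    ∫⁻ x, ‖fn u x‖ₑ ^ p ≤ 2 ^ (p - 1) * ((∫⁻ x, ‖fn u x - mollify ε (fn u) x‖ₑ ^ p) +
      ∫⁻ x, ‖mollify ε (fn u) x‖ₑ ^ p) := by
  have hm : Measurable fun x => ‖mollify ε (fn u) x‖ₑ ^ p :=
    (continuous_mollify hε u).measurable.enorm.pow_const _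
  rw [← lintegral_add_right _ hm, ← lintegral_const_mul' _ _
    (ENNReal.rpow_ne_top_of_nonneg (by linarith) ENNReal.ofNat_ne_top)]
  refine lintegral_mono fun x => ?_
  refine le_trans ?_ (ENNReal.rpow_add_le_mul_rpow_add_rpow _ _ hp)
  refine ENNReal.rpow_le_rpow ?_ (by linarith)
  calc ‖fn u x‖ₑ = ‖fn u x - mollify ε (fn u) x + mollify ε (fn u) x‖ₑ := by rw [sub_add_cancel]
    _ ≤ _ := enorm_add_le _ _

/-- The **Sobolev embedding** `H¹_r ⊂ L^p`, `2 < p < 6`. -/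
lemma exists_lintegral_fn_rpow_le {p : ℝ} (hp : 2 < p) (hp' : p < 6) :
    ∃ K : ℝ, 0 ≤ K ∧ ∀ u : H1r, ∫⁻ x, ‖fn u x‖ₑ ^ p ≤ ENNReal.ofReal (K * ‖u‖ ^ p) := by
  have hp0 : 0 < p := by linarith
  obtain ⟨ε, hε, h1⟩ := exists_lintegral_sub_mollify_le hp hp' one_pos
  obtain ⟨C, hC0, hC⟩ := exists_sq_mollify_le hε
  obtain ⟨C', hC'0, hC'⟩ := exists_lintegral_sq_mollify_le hε
  have hsup : ∀ u : H1r, ∀ x, ‖mollify ε (fn u) x‖ₑ ≤ ENNReal.ofReal (Real.sqrt C * ‖u‖) := by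
    intro u x
    have h2 : ‖mollify ε (fn u) x‖ₑ ^ (2 : ℝ) ≤ ENNReal.ofReal (C * ‖u‖ ^ 2) := by
      refine (hC u x).trans ?_
      rw [ENNReal.ofReal_mul hC0]
      exact mul_le_mul_right ((setLIntegral_le_lintegral _ _).trans (lintegral_fn_le u)) _
    rw [← ofReal_norm, ENNReal.ofReal_rpow_of_nonneg (norm_nonneg _) (by norm_num),
      ENNReal.ofReal_le_ofReal_iff (by positivity), Real.rpow_ofNat] at h2
    rw [← ofReal_norm]
    refine ENNReal.ofReal_le_ofReal (abs_le_of_sq_le_sq' ?_ (by positivity)).2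
    rwa [mul_pow, Real.sq_sqrt hC0]
  refine ⟨2 ^ (p - 1) * (1 + Real.sqrt C ^ (p - 2) * C'), by positivity, fun u => ?_⟩
  refine (lintegral_fn_rpow_le_add (by linarith) hε u).trans ?_
  have h3 : ∫⁻ x, ‖mollify ε (fn u) x‖ₑ ^ p ≤
      ENNReal.ofReal (Real.sqrt C ^ (p - 2) * C' * ‖u‖ ^ p) := by
    refine (lintegral_rpow_le_of_bound ENNReal.ofReal_ne_top hp (hsup u)).trans ?_
    refine (mul_le_mul_right (hC' u) _).trans_eq ?_
    rw [ENNReal.ofReal_rpow_of_nonneg (by positivity) (by linarith),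
      ← ENNReal.ofReal_mul (by positivity), Real.mul_rpow (by positivity) (norm_nonneg _)]
    congr 1
    have : ‖u‖ ^ p = ‖u‖ ^ (p - 2) * ‖u‖ ^ 2 := by
      rw [← Real.rpow_ofNat ‖u‖ 2, ← Real.rpow_add_of_nonneg (norm_nonneg _) (by linarith)
        (by norm_num)]
      congr 1; ring
    rw [this]; ring
  have h4 : (2 : ENNReal) ^ (p - 1) = ENNReal.ofReal (2 ^ (p - 1)) := by
    rw [← ENNReal.ofReal_rpow_of_nonneg (by norm_num) (by linarith)]; simp
  rw [h4]
  refine (mul_le_mul_right (add_le_add (h1 u) h3) _).trans_eq ?_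
  rw [← ENNReal.ofReal_add (by positivity) (by positivity), ← ENNReal.ofReal_mul (by positivity)]
  congr 1
  ring

/-- **Strauss compactness**: weakly null bounded sequences in `H¹_r` are null in `L^p`,
`2 < p < 6`. -/
lemma tendsto_lintegral_fn_rpow {p : ℝ} (hp : 2 < p) (hp' : p < 6) {u : ℕ → H1r} {M : ℝ}
    (hM : ∀ k, ‖u k‖ ≤ M)
    (hu : ∀ ℓ : StrongDual ℝ H1r, Tendsto (fun k => ℓ (u k)) atTop (𝓝 0)) :
    Tendsto (fun k => ∫⁻ x, ‖fn (u k) x‖ₑ ^ p) atTop (𝓝 0) := by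
  have hp0 : 0 < p := by linarith
  have hM0 : 0 ≤ M := (norm_nonneg _).trans (hM 0)
  rw [ENNReal.tendsto_nhds_zero]
  intro δ hδ
  obtain ⟨d, hd, hdδ⟩ : ∃ d : ℝ, 0 < d ∧ ENNReal.ofReal d ≤ δ := by
    obtain ⟨d, hd, hd2⟩ := ENNReal.lt_iff_exists_nnreal_btwn.1 hδ
    exact ⟨d, by exact_mod_cast hd, by rw [ENNReal.ofReal_coe_nnreal]; exact hd2.le⟩
  set a : ℝ := d / 2 ^ (p - 1) / 2 with ha
  have hapos : 0 < a := by positivity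
  obtain ⟨ε, hε, h1⟩ := exists_lintegral_sub_mollify_le hp hp'
    (show 0 < a / (M ^ p + 1) by positivity)
  obtain ⟨C', hC'0, hC'⟩ := exists_lintegral_sq_mollify_le hε
  obtain ⟨s, hs, hsa⟩ : ∃ s : ℝ, 0 < s ∧ s ^ (p - 2) * (C' * M ^ 2) ≤ a := by
    have : Tendsto (fun s : ℝ => s ^ (p - 2) * (C' * M ^ 2)) (𝓝[>] 0) (𝓝 0) := by
      have h2 : ContinuousAt (fun s : ℝ => s ^ (p - 2) * (C' * M ^ 2)) 0 :=
        (Real.continuousAt_rpow_const _ _ (Or.inr (by linarith))).mul continuousAt_const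
      have h3 := h2.tendsto.mono_left (nhdsWithin_le_nhds (s := Ioi 0))
      rwa [Real.zero_rpow (by linarith), zero_mul] at h3
    obtain ⟨s, hs1, hs2⟩ := ((this.eventually_le_const hapos).and self_mem_nhdsWithin).exists
    exact ⟨s, hs2, hs1⟩
  filter_upwards [tendsto_mollify_uniformly hε hM hu hs] with k hk
  refine le_trans ?_ hdδ
  refine (lintegral_fn_rpow_le_add (by linarith) hε (u k)).trans ?_
  have h2 : ∫⁻ x, ‖fn (u k) x - mollify ε (fn (u k)) x‖ₑ ^ p ≤ ENNReal.ofReal a := by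
    refine (h1 (u k)).trans (ENNReal.ofReal_le_ofReal ?_)
    have : ‖u k‖ ^ p ≤ M ^ p := Real.rpow_le_rpow (norm_nonneg _) (hM k) hp0.le
    rw [div_mul_eq_mul_div, div_le_iff₀ (by positivity)]
    gcongr
    linarith
  have h3 : ∫⁻ x, ‖mollify ε (fn (u k)) x‖ₑ ^ p ≤ ENNReal.ofReal a := by
    have hb : ∀ x, ‖mollify ε (fn (u k)) x‖ₑ ≤ ENNReal.ofReal s := fun x => by
      rw [← ofReal_norm]; exact ENNReal.ofReal_le_ofReal (hk x)
    refine (lintegral_rpow_le_of_bound ENNReal.ofReal_ne_top hp hb).trans ?_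
    refine (mul_le_mul_right (hC' (u k)) _).trans ?_
    rw [ENNReal.ofReal_rpow_of_nonneg hs.le (by linarith), ← ENNReal.ofReal_mul (by positivity)]
    refine ENNReal.ofReal_le_ofReal (le_trans ?_ hsa)
    have := hM k
    gcongr
  have h4 : (2 : ENNReal) ^ (p - 1) = ENNReal.ofReal (2 ^ (p - 1)) := by
    rw [← ENNReal.ofReal_rpow_of_nonneg (by norm_num) (by linarith)]; simp
  rw [h4]
  refine (mul_le_mul_right (add_le_add h2 h3) _).trans_eq ?_
  rw [← ENNReal.ofReal_add (by positivity) (by positivity), ← ENNReal.ofReal_mul (by positivity)]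
  congr 1
  rw [ha]
  field_simp
  ring

lemma eLpNorm_fn_eq {p : ℝ} (hp : 0 < p) (u : H1r) :
    eLpNorm (fn u) (ENNReal.ofReal p) volume = (∫⁻ x, ‖fn u x‖ₑ ^ p) ^ (1 / p) := by
  rw [eLpNorm_eq_lintegral_rpow_enorm_toReal (by simpa using hp) ENNReal.ofReal_ne_top,
    ENNReal.toReal_ofReal hp.le]

lemma exists_eLpNorm_fn_le {p : ℝ} (hp : 2 < p) (hp' : p < 6) :
    ∃ K : ℝ, 0 ≤ K ∧ ∀ u : H1r, eLpNorm (fn u) (ENNReal.ofReal p) volume ≤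
      ENNReal.ofReal (K * ‖u‖) := by
  have hp0 : 0 < p := by linarith
  obtain ⟨K, hK0, hK⟩ := exists_lintegral_fn_rpow_le hp hp'
  refine ⟨K ^ (1 / p), by positivity, fun u => ?_⟩
  rw [eLpNorm_fn_eq hp0]
  refine (ENNReal.rpow_le_rpow (hK u) (by positivity)).trans_eq ?_
  rw [ENNReal.ofReal_rpow_of_nonneg (by positivity) (by positivity),
    Real.mul_rpow hK0 (by positivity), ← Real.rpow_mul (norm_nonneg _), mul_one_div_cancel hp0.ne',
    Real.rpow_one]

lemma memLp_fn_rpow {p : ℝ} (hp : 2 < p) (hp' : p < 6) (u : H1r) :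
    MemLp (fn u) (ENNReal.ofReal p) volume := by
  obtain ⟨K, -, hK⟩ := exists_eLpNorm_fn_le hp hp'
  exact ⟨(memLp_fn u).1, (hK u).trans_lt ENNReal.ofReal_lt_top⟩

/-! ### The `L^p` norm and the power term -/

/-- The `L^p` norm on `H¹_r`. -/
def lpn (p : ℝ) (u : H1r) : ℝ := (eLpNorm (fn u) (ENNReal.ofReal p) volume).toReal

lemma lpn_nonneg (p : ℝ) (u : H1r) : 0 ≤ lpn p u := ENNReal.toReal_nonneg

variable {p : ℝ}

lemma exists_lpn_le (hp : 2 < p) (hp' : p < 6) :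
    ∃ K : ℝ, 0 ≤ K ∧ ∀ u : H1r, lpn p u ≤ K * ‖u‖ := by
  obtain ⟨K, hK0, hK⟩ := exists_eLpNorm_fn_le hp hp'
  refine ⟨K, hK0, fun u => ?_⟩
  exact ENNReal.toReal_le_of_le_ofReal (by positivity) (hK u)

lemma lintegral_fn_eq (hp : 2 < p) (hp' : p < 6) (u : H1r) :
    (∫⁻ x, ‖fn u x‖ₑ ^ p) ^ (1 / p) = ENNReal.ofReal (lpn p u) := by
  rw [lpn, ENNReal.ofReal_toReal (memLp_fn_rpow hp hp' u).2.ne, eLpNorm_fn_eq (by linarith)]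

lemma integral_rpow_eq (hp : 2 < p) (hp' : p < 6) (u : H1r) : C p u = lpn p u ^ p := by
  have hp0 : 0 < p := by linarith
  rw [C, integral_eq_lintegral_of_nonneg_ae (Eventually.of_forall fun x => by positivity)
    (((memLp_fn u).1.aemeasurable.abs.pow_const p).aestronglyMeasurable)]
  have h := lintegral_fn_eq hp hp' u
  have e : ∫⁻ x, ENNReal.ofReal (|fn u x| ^ p) = ∫⁻ x, ‖fn u x‖ₑ ^ p := by
    refine lintegral_congr fun x => ?_
    rw [← ofReal_norm, ENNReal.ofReal_rpow_of_nonneg (norm_nonneg _) hp0.le, Real.norm_eq_abs]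
  rw [e]
  have h2 : ∫⁻ x, ‖fn u x‖ₑ ^ p = ENNReal.ofReal (lpn p u ^ p) := by
    rw [← ENNReal.ofReal_rpow_of_nonneg (lpn_nonneg _ _) hp0.le, ← h, ← ENNReal.rpow_mul,
      one_div, inv_mul_cancel₀ hp0.ne', ENNReal.rpow_one]
  rw [h2, ENNReal.toReal_ofReal (by have := lpn_nonneg p u; positivity)]

lemma tendsto_lpn_zero (hp : 2 < p) (hp' : p < 6) {u : ℕ → H1r} {M : ℝ} (hM : ∀ k, ‖u k‖ ≤ M)
    (hu : ∀ ℓ : StrongDual ℝ H1r, Tendsto (fun k => ℓ (u k)) atTop (𝓝 0)) :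
    Tendsto (fun k => lpn p (u k)) atTop (𝓝 0) := by
  have hp0 : 0 < p := by linarith
  have h1 := (tendsto_lintegral_fn_rpow hp hp' hM hu).ennrpow_const (1 / p)
  rw [ENNReal.zero_rpow_of_pos (by positivity)] at h1
  have h2 := (ENNReal.tendsto_toReal ENNReal.zero_ne_top).comp h1
  refine h2.congr fun k => ?_
  rw [Function.comp_apply, lintegral_fn_eq hp hp', ENNReal.toReal_ofReal (lpn_nonneg _ _)]

/-- **Hölder's inequality** with exponents `p/(p-2)`, `p`, `p`. -/
lemma lintegral_holder_three {f g k : R3 → ENNReal} (hf : AEMeasurable f volume)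
    (hg : AEMeasurable g volume) (hk : AEMeasurable k volume) (hp : 2 < p) :
    ∫⁻ x, f x ^ (p - 2) * g x * k x ≤ ((∫⁻ x, f x ^ p) ^ (1 / p)) ^ (p - 2) *
      (∫⁻ x, g x ^ p) ^ (1 / p) * (∫⁻ x, k x ^ p) ^ (1 / p) := by
  have hp0 : 0 < p := by linarith
  have h := ENNReal.lintegral_prod_norm_pow_le (μ := (volume : Measure R3)) Finset.univ
    (f := ![fun x => f x ^ p, fun x => g x ^ p, fun x => k x ^ p])
    (fun i _ => by
      fin_cases i
      · exact hf.pow_const _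
      · exact hg.pow_const _
      · exact hk.pow_const _)
    (p := ![(p - 2) / p, 1 / p, 1 / p])
    (by
      rw [Fin.sum_univ_three]
      change (p - 2) / p + 1 / p + 1 / p = 1
      field_simp; ring)
    (fun i _ => by
      fin_cases i
      · exact div_nonneg (by linarith) hp0.le
      · exact div_nonneg zero_le_one hp0.le
      · exact div_nonneg zero_le_one hp0.le)
  simp only [Fin.prod_univ_three] at h
  change ∫⁻ x, (f x ^ p) ^ ((p - 2) / p) * (g x ^ p) ^ (1 / p) * (k x ^ p) ^ (1 / p) ≤
    (∫⁻ x, f x ^ p) ^ ((p - 2) / p) * (∫⁻ x, g x ^ p) ^ (1 / p) *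
      (∫⁻ x, k x ^ p) ^ (1 / p) at h
  have e1 : ∀ a : ENNReal, (a ^ p) ^ ((p - 2) / p) = a ^ (p - 2) := fun a => by
    rw [← ENNReal.rpow_mul]; congr 1; field_simp
  have e2 : ∀ a : ENNReal, (a ^ p) ^ (1 / p) = a := fun a => by
    rw [← ENNReal.rpow_mul, mul_one_div_cancel hp0.ne', ENNReal.rpow_one]
  simp only [e1, e2] at h
  rwa [← ENNReal.rpow_mul, one_div_mul_eq_div]

lemma lintegral_power_term_le (hp : 2 < p) (hp' : p < 6) (u v w z : H1r) :
    ∫⁻ x, (‖fn u x‖ₑ + ‖fn v x‖ₑ) ^ (p - 2) * ‖fn w x‖ₑ * ‖fn z x‖ₑ ≤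
      ENNReal.ofReal ((lpn p u + lpn p v) ^ (p - 2) * lpn p w * lpn p z) := by
  have hm : ∀ u : H1r, AEMeasurable (fun x => ‖fn u x‖ₑ) volume := fun u => (memLp_fn u).1.enorm
  have hn := lpn_nonneg p
  refine (lintegral_holder_three ((hm u).add (hm v)) (hm w) (hm z) hp).trans ?_
  rw [lintegral_fn_eq hp hp', lintegral_fn_eq hp hp',
    ENNReal.ofReal_mul (mul_nonneg (Real.rpow_nonneg (add_nonneg (hn u) (hn v)) _) (hn w)),
    ENNReal.ofReal_mul (Real.rpow_nonneg (add_nonneg (hn u) (hn v)) _),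
    ← ENNReal.ofReal_rpow_of_nonneg (add_nonneg (hn u) (hn v)) (by linarith)]
  refine mul_le_mul_left (mul_le_mul_left (ENNReal.rpow_le_rpow ?_ (by linarith)) _) _
  have h := ENNReal.lintegral_Lp_add_le (hm u) (hm v) (show 1 ≤ p by linarith)
  rw [lintegral_fn_eq hp hp', lintegral_fn_eq hp hp', ← ENNReal.ofReal_add (hn u) (hn v)] at h
  exact h

/-- A function dominated by `(|u| + |v|)^(p-2) |w| |z|` is integrable with the corresponding
bound. -/
lemma integrable_of_power_bound (hp : 2 < p) (hp' : p < 6) (u v w z : H1r) {f : R3 → ℝ}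
    (hf : AEStronglyMeasurable f volume) {c : ℝ} (hc : 0 ≤ c)
    (hb : ∀ᵐ x, |f x| ≤ c * ((|fn u x| + |fn v x|) ^ (p - 2) * |fn w x| * |fn z x|)) :
    Integrable f volume ∧ |∫ x, f x| ≤ c * ((lpn p u + lpn p v) ^ (p - 2) * lpn p w * lpn p z) := by
  have hn := lpn_nonneg p
  have hnn : 0 ≤ (lpn p u + lpn p v) ^ (p - 2) * lpn p w * lpn p z :=
    mul_nonneg (mul_nonneg (Real.rpow_nonneg (add_nonneg (hn u) (hn v)) _) (hn w)) (hn z)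
  have h1 : ∫⁻ x, ‖f x‖ₑ ≤
      ENNReal.ofReal (c * ((lpn p u + lpn p v) ^ (p - 2) * lpn p w * lpn p z)) := by
    rw [ENNReal.ofReal_mul hc]
    refine le_trans ?_ (mul_le_mul_right (lintegral_power_term_le hp hp' u v w z) _)
    rw [← lintegral_const_mul' _ _ ENNReal.ofReal_ne_top]
    refine lintegral_mono_ae ?_
    filter_upwards [hb] with x hx
    have e : ENNReal.ofReal c * ((‖fn u x‖ₑ + ‖fn v x‖ₑ) ^ (p - 2) * ‖fn w x‖ₑ * ‖fn z x‖ₑ) =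
        ENNReal.ofReal (c * ((|fn u x| + |fn v x|) ^ (p - 2) * |fn w x| * |fn z x|)) := by
      simp only [← ofReal_norm, Real.norm_eq_abs]
      rw [ENNReal.ofReal_mul hc, ENNReal.ofReal_mul (by positivity),
        ENNReal.ofReal_mul (by positivity),
        ← ENNReal.ofReal_rpow_of_nonneg (by positivity) (by linarith),
        ENNReal.ofReal_add (by positivity) (by positivity)]
    rw [e, ← ofReal_norm]
    exact ENNReal.ofReal_le_ofReal hx
  have h2 : Integrable f volume := ⟨hf, h1.trans_lt ENNReal.ofReal_lt_top⟩
  refine ⟨h2, ?_⟩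
  have h3 := (enorm_integral_le_lintegral_enorm f).trans h1
  rw [← ofReal_norm, ENNReal.ofReal_le_ofReal_iff (by positivity)] at h3
  exact h3

lemma hasDerivAt_rpow_mul_self (hp : 3 < p) (t : ℝ) :
    HasDerivAt (fun t : ℝ => |t| ^ (p - 2) * t) ((p - 1) * |t| ^ (p - 2)) t := by
  have h1 := (hasDerivAt_abs_rpow t (show 1 < p - 2 by linarith)).mul (hasDerivAt_id t)
  refine h1.congr_deriv ?_
  simp only [id, mul_one]
  rcases eq_or_ne t 0 with rfl | ht
  · simp [Real.zero_rpow (show p - 2 ≠ 0 by linarith)]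
  · have h2 : |t| ^ (p - 2) = |t| ^ (p - 2 - 2) * (t * t) := by
      rw [← abs_mul_abs_self t, ← mul_assoc, ← Real.rpow_add_one (by positivity),
        ← Real.rpow_add_one (by positivity)]
      congr 1; ring
    rw [h2]; ring

lemma abs_rpow_mul_self_sub_le (hp : 3 < p) (a b : ℝ) :
    |(|a| ^ (p - 2) * a) - |b| ^ (p - 2) * b| ≤ (p - 1) * ((|a| + |b|) ^ (p - 2) * |a - b|) := by
  have h := Convex.norm_image_sub_le_of_norm_hasDerivWithin_le (s := Set.uIcc b a)
    (f := fun t : ℝ => |t| ^ (p - 2) * t) (f' := fun t => (p - 1) * |t| ^ (p - 2))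
    (C := (p - 1) * (|a| + |b|) ^ (p - 2)) (x := b) (y := a)
    (fun t _ => (hasDerivAt_rpow_mul_self hp t).hasDerivWithinAt) ?_ (convex_uIcc b a)
    left_mem_uIcc right_mem_uIcc
  · rw [Real.norm_eq_abs, Real.norm_eq_abs, mul_assoc] at h
    exact h
  · intro t ht
    rw [norm_mul, Real.norm_of_nonneg (show 0 ≤ p - 1 by linarith),
      Real.norm_of_nonneg (by positivity)]
    refine mul_le_mul_of_nonneg_left (Real.rpow_le_rpow (abs_nonneg _) ?_ (by linarith))
      (by linarith)
    rcases mem_uIcc.1 ht with ⟨h1, h2⟩ | ⟨h1, h2⟩ <;>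
    refine abs_le.2 ⟨?_, ?_⟩ <;>
    linarith [neg_abs_le a, neg_abs_le b, le_abs_self a, le_abs_self b, abs_nonneg a, abs_nonneg b]

lemma abs_rpow_taylor_le (hp : 3 < p) (a b : ℝ) :
    |(|a + b| ^ p - |a| ^ p) - p * (|a| ^ (p - 2) * a * b)| ≤
      p * (p - 1) * 2 ^ (p - 2) * ((|a| + |b|) ^ (p - 2) * |b| * |b|) := by
  have hderiv : ∀ t : ℝ, HasDerivAt (fun t : ℝ => |t| ^ p - p * (|a| ^ (p - 2) * a) * t)
      (p * |t| ^ (p - 2) * t - p * (|a| ^ (p - 2) * a) * 1) t := fun t =>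
    (hasDerivAt_abs_rpow t (show 1 < p by linarith)).sub ((hasDerivAt_id t).const_mul _)
  have h := Convex.norm_image_sub_le_of_norm_hasDerivWithin_le (s := Set.uIcc a (a + b))
    (f := fun t : ℝ => |t| ^ p - p * (|a| ^ (p - 2) * a) * t)
    (C := p * (p - 1) * 2 ^ (p - 2) * ((|a| + |b|) ^ (p - 2) * |b|)) (x := a) (y := a + b)
    (fun t _ => (hderiv t).hasDerivWithinAt) ?_ (convex_uIcc _ _)
    left_mem_uIcc right_mem_uIcc
  · rw [Real.norm_eq_abs, Real.norm_eq_abs, add_sub_cancel_left] at h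
    refine (le_of_eq ?_).trans (h.trans (le_of_eq (by ring)))
    congr 1; ring
  · intro t ht
    have htb : |t - a| ≤ |b| := by
      rcases mem_uIcc.1 ht with ⟨h1, h2⟩ | ⟨h1, h2⟩ <;>
      refine abs_le.2 ⟨?_, ?_⟩ <;>
      linarith [neg_abs_le b, le_abs_self b, abs_nonneg b]
    have ht2 : |t| + |a| ≤ 2 * (|a| + |b|) := by
      have : |t| ≤ |t - a| + |a| := by simpa using abs_add_le (t - a) a
      linarith [abs_nonneg b]
    have h1 := abs_rpow_mul_self_sub_le hp t a
    have h2 : (|t| + |a|) ^ (p - 2) ≤ 2 ^ (p - 2) * (|a| + |b|) ^ (p - 2) := by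
      rw [← Real.mul_rpow (by norm_num) (by positivity)]
      exact Real.rpow_le_rpow (by positivity) ht2 (by linarith)
    have e : p * |t| ^ (p - 2) * t - p * (|a| ^ (p - 2) * a) * 1 =
        p * (|t| ^ (p - 2) * t - |a| ^ (p - 2) * a) := by ring
    rw [e, norm_mul, Real.norm_of_nonneg (show 0 ≤ p by linarith), Real.norm_eq_abs]
    have hp1 : 0 ≤ p - 1 := by linarith
    have hp0 : 0 ≤ p := by linarith
    calc p * |(|t| ^ (p - 2) * t) - |a| ^ (p - 2) * a|
        ≤ p * ((p - 1) * ((2 ^ (p - 2) * (|a| + |b|) ^ (p - 2)) * |b|)) := by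
          refine mul_le_mul_of_nonneg_left (h1.trans ?_) hp0
          refine mul_le_mul_of_nonneg_left ?_ hp1
          exact mul_le_mul h2 htb (abs_nonneg _) (by positivity)
      _ = _ := by ring

lemma aestronglyMeasurable_power (u v : H1r) :
    AEStronglyMeasurable (fun x => |fn u x| ^ (p - 2) * fn u x * fn v x) volume := by
  have h := fun u : H1r => (memLp_fn u).1.aemeasurable
  exact ((((h u).abs.pow_const _).mul (h u)).mul (h v)).aestronglyMeasurable

lemma power_bound (hp : 2 < p) (hp' : p < 6) (u v : H1r) :
    Integrable (fun x => |fn u x| ^ (p - 2) * fn u x * fn v x) volume ∧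
    |∫ x, |fn u x| ^ (p - 2) * fn u x * fn v x| ≤ 1 * ((lpn p u + lpn p u) ^ (p - 2) * lpn p u * lpn p v) := by
  refine integrable_of_power_bound hp hp' u u u v (aestronglyMeasurable_power u v) zero_le_one
    (Eventually.of_forall fun x => ?_)
  rw [abs_mul, abs_mul, abs_of_nonneg (by positivity : 0 ≤ |fn u x| ^ (p - 2)), one_mul]
  gcongr
  linarith [abs_nonneg (fn u x)]

/-- The linear functional `φ ↦ ∫ |u|^(p-2) u φ`. -/
def powLin (hp : 2 < p) (hp' : p < 6) (u : H1r) : H1r →ₗ[ℝ] ℝ where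
  toFun φ := ∫ x, |fn u x| ^ (p - 2) * fn u x * fn φ x
  map_add' φ ψ := by
    rw [← integral_add (power_bound hp hp' u φ).1 (power_bound hp hp' u ψ).1]
    refine integral_congr_ae ?_
    filter_upwards [fn_add φ ψ] with x hx
    rw [hx]; ring
  map_smul' r φ := by
    rw [RingHom.id_apply, smul_eq_mul, ← integral_const_mul]
    refine integral_congr_ae ?_
    filter_upwards [fn_smul r φ] with x hx
    rw [hx]; ring

lemma exists_powLin_bound (hp : 2 < p) (hp' : p < 6) (u : H1r) :
    ∃ K, ∀ φ, ‖powLin hp hp' u φ‖ ≤ K * ‖φ‖ := by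
  obtain ⟨K, hK0, hK⟩ := exists_lpn_le hp hp'
  refine ⟨(lpn p u + lpn p u) ^ (p - 2) * lpn p u * K, fun φ => ?_⟩
  have hn := lpn_nonneg p u
  refine (power_bound hp hp' u φ).2.trans ?_
  rw [one_mul, mul_assoc _ K]
  exact mul_le_mul_of_nonneg_left (hK φ) (by positivity)

/-- The functional `φ ↦ ∫ |u|^(p-2) u φ`, as an element of the dual. -/
def powDual (hp : 2 < p) (hp' : p < 6) (u : H1r) : StrongDual ℝ H1r :=
  LinearMap.mkContinuousOfExistsBound (powLin hp hp' u) (exists_powLin_bound hp hp' u)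

lemma powDual_apply (hp : 2 < p) (hp' : p < 6) (u φ : H1r) :
    powDual hp hp' u φ = ∫ x, |fn u x| ^ (p - 2) * fn u x * fn φ x := rfl

lemma powDual_self (hp : 2 < p) (hp' : p < 6) (u : H1r) : powDual hp hp' u u = C p u := by
  rw [powDual_apply, C]
  refine integral_congr_ae (Eventually.of_forall fun x => ?_)
  have h : |fn u x| ^ p = |fn u x| ^ (p - 2) * |fn u x| ^ (2 : ℝ) := by
    rw [← Real.rpow_add_of_nonneg (abs_nonneg _) (by linarith) (by norm_num)]
    congr 1; ring
  simp only [h, Real.rpow_ofNat, sq_abs]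
  ring

lemma abs_powDual_sub_le (hp : 3 < p) (hp' : p < 6) (u v φ : H1r) :
    |powDual (by linarith) hp' u φ - powDual (by linarith) hp' v φ| ≤
      (p - 1) * ((lpn p u + lpn p v) ^ (p - 2) * lpn p (u - v) * lpn p φ) := by
  have hp2 : 2 < p := by linarith
  rw [powDual_apply, powDual_apply, ← integral_sub (power_bound hp2 hp' u φ).1
    (power_bound hp2 hp' v φ).1]
  refine (integrable_of_power_bound hp2 hp' u v (u - v) φ
    ((aestronglyMeasurable_power u φ).sub (aestronglyMeasurable_power v φ)) (by linarith) ?_).2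
  filter_upwards [fn_sub u v] with x hx
  rw [hx, Pi.sub_apply, ← sub_mul, abs_mul]
  refine (mul_le_mul_of_nonneg_right (abs_rpow_mul_self_sub_le hp _ _) (abs_nonneg _)).trans_eq ?_
  ring

lemma integrable_abs_rpow (hp : 2 < p) (hp' : p < 6) (u : H1r) :
    Integrable (fun x => |fn u x| ^ p) volume := by
  have := (memLp_fn_rpow hp hp' u).integrable_norm_rpow (by simp; linarith) ENNReal.ofReal_ne_top
  rwa [ENNReal.toReal_ofReal (by linarith)] at this

lemma hasFDerivAt_of_quadratic_remainder {E : Type*} [NormedAddCommGroup E] [NormedSpace ℝ E]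
    {f : E → ℝ} {L : StrongDual ℝ E} {u : E} {g : E → ℝ} (hg : ContinuousAt g 0)
    (h : ∀ k, |f (u + k) - f u - L k| ≤ g k * ‖k‖ ^ 2) : HasFDerivAt f L u := by
  rw [hasFDerivAt_iff_isLittleO_nhds_zero]
  have hO : (fun k : E => f (u + k) - f u - L k) =O[𝓝 0] fun k => ‖k‖ ^ 2 := by
    refine Asymptotics.IsBigO.of_bound (g 0 + 1) ?_
    filter_upwards [hg.eventually (Iio_mem_nhds (lt_add_one _))] with k hk
    refine (h k).trans ?_
    rw [norm_pow, norm_norm]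
    exact mul_le_mul_of_nonneg_right (le_of_lt hk) (by positivity)
  exact hO.trans_isLittleO (Asymptotics.isLittleO_norm_pow_id (E' := E) (n := 2) one_lt_two)

lemma hasFDerivAt_C (hp : 3 < p) (hp' : p < 6) (u : H1r) :
    HasFDerivAt (C p) (p • powDual (by linarith) hp' u) u := by
  have hp2 : 2 < p := by linarith
  obtain ⟨K, hK0, hK⟩ := exists_lpn_le hp2 hp'
  set c := p * (p - 1) * 2 ^ (p - 2) with hc
  have hc0 : 0 ≤ c := by
    have : 0 ≤ p - 1 := by linarith
    positivity
  have hbound : ∀ h : H1r, ‖C p (u + h) - C p u - (p • powDual hp2 hp' u) h‖ ≤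
      c * ((lpn p u + K * ‖h‖) ^ (p - 2) * (K * K)) * ‖h‖ ^ 2 := by
    intro h
    have e : C p (u + h) - C p u - (p • powDual hp2 hp' u) h = ∫ x, (|fn (u + h) x| ^ p -
        |fn u x| ^ p) - p * (|fn u x| ^ (p - 2) * fn u x * fn h x) := by
      have i1 : Integrable (fun x => |fn (u + h) x| ^ p - |fn u x| ^ p) volume :=
        (integrable_abs_rpow hp2 hp' _).sub (integrable_abs_rpow hp2 hp' _)
      rw [integral_sub i1 ((power_bound hp2 hp' u h).1.const_mul p),
        integral_sub (integrable_abs_rpow hp2 hp' _) (integrable_abs_rpow hp2 hp' _),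
        integral_const_mul]
      rfl
    have hm := fun u : H1r => (memLp_fn u).1.aemeasurable
    have h1 := (integrable_of_power_bound hp2 hp' u h h h (c := c)
      (f := fun x => (|fn (u + h) x| ^ p -
        |fn u x| ^ p) - p * (|fn u x| ^ (p - 2) * fn u x * fn h x))
      (((((hm (u + h)).abs.pow_const _).sub ((hm u).abs.pow_const _)).aestronglyMeasurable).sub
        ((aestronglyMeasurable_power u h).const_mul _)) hc0 (by
        filter_upwards [fn_add u h] with x hx
        rw [hx]
        exact abs_rpow_taylor_le hp _ _)).2
    rw [e, Real.norm_eq_abs]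
    refine h1.trans ?_
    have hn := lpn_nonneg p
    have hKh := hK h
    have h2 := hn h
    have h3 := hn u
    rw [mul_assoc c]
    refine mul_le_mul_of_nonneg_left ?_ hc0
    have h4 : (lpn p u + lpn p h) ^ (p - 2) ≤ (lpn p u + K * ‖h‖) ^ (p - 2) :=
      Real.rpow_le_rpow (by positivity) (by linarith) (by linarith)
    calc _ ≤ (lpn p u + K * ‖h‖) ^ (p - 2) * (K * ‖h‖) * (K * ‖h‖) := by gcongr
      _ = _ := by ring
  have hcont : ContinuousAt (fun h : H1r => c * ((lpn p u + K * ‖h‖) ^ (p - 2) * (K * K))) 0 := by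
    refine continuousAt_const.mul (ContinuousAt.mul ?_ continuousAt_const)
    exact ContinuousAt.rpow_const (by fun_prop) (Or.inr (by linarith))
  exact hasFDerivAt_of_quadratic_remainder hcont hbound

/-! ### The Newton potential -/


lemma lintegral_fn_mul_le (u v : H1r) :
    ∫⁻ x, ‖fn u x‖ₑ * ‖fn v x‖ₑ ≤ ENNReal.ofReal (‖u‖ * ‖v‖) := by
  have h := ENNReal.lintegral_mul_le_Lp_mul_Lq volume Real.HolderConjugate.two_two
    (memLp_fn u).1.enorm (memLp_fn v).1.enorm
  have hb : ∀ u : H1r, (∫⁻ x, ‖fn u x‖ₑ ^ (2 : ℝ)) ^ (1 / 2 : ℝ) ≤ ENNReal.ofReal ‖u‖ := fun u => by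
    refine (ENNReal.rpow_le_rpow (lintegral_fn_le u) (by norm_num)).trans_eq ?_
    rw [ENNReal.ofReal_rpow_of_nonneg (by positivity) (by norm_num), ← Real.sqrt_eq_rpow,
      Real.sqrt_sq (norm_nonneg _)]
  refine h.trans ((mul_le_mul' (hb u) (hb v)).trans_eq ?_)
  rw [ENNReal.ofReal_mul (norm_nonneg _)]

lemma exists_newton_bound (hp : 3 < p) (hp' : p < 6) {R : ℝ} (hR : 0 < R) :
    ∃ K : ℝ, 0 ≤ K ∧ ∀ (u v : H1r) (x : R3),
      ∫⁻ y, ‖fn u y‖ₑ * ‖fn v y‖ₑ * ENNReal.ofReal ‖x - y‖⁻¹ ≤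
        ENNReal.ofReal (K * (lpn p u * lpn p v) + R⁻¹ * (‖u‖ * ‖v‖)) := by
  have hp2 : 2 < p := by linarith
  set w : R3 → ENNReal := (Metric.ball (0 : R3) R).indicator fun z => ENNReal.ofReal ‖z‖⁻¹ with hw
  have hwm : Measurable w := Measurable.indicator (by fun_prop) Metric.isOpen_ball.measurableSet
  have hle : ∀ z, ENNReal.ofReal ‖z‖⁻¹ ≤ w z + ENNReal.ofReal R⁻¹ := by
    intro z
    by_cases hz : z ∈ Metric.ball (0 : R3) R
    · rw [hw, indicator_of_mem hz]; exact le_self_add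
    · rw [mem_ball_zero_iff, not_lt] at hz
      exact (ENNReal.ofReal_le_ofReal (inv_anti₀ hR hz)).trans le_add_self
  have hfin : ∫⁻ z, (w z ^ (1 / (p - 2))) ^ p < ⊤ := by
    have ht : 0 < p / (p - 2) := div_pos (by linarith) (by linarith)
    have ht3 : p / (p - 2) < 3 := by rw [div_lt_iff₀ (by linarith)]; linarith
    have e : ∫⁻ z, (w z ^ (1 / (p - 2))) ^ p =
        ∫⁻ z in Metric.ball (0 : R3) R, ENNReal.ofReal (‖z‖ ^ (-(p / (p - 2)))) := by
      rw [← lintegral_indicator Metric.isOpen_ball.measurableSet]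
      refine lintegral_congr fun z => ?_
      rw [← ENNReal.rpow_mul, one_div_mul_eq_div]
      by_cases hz : z ∈ Metric.ball (0 : R3) R
      · rw [hw, indicator_of_mem hz, indicator_of_mem hz,
          ENNReal.ofReal_rpow_of_nonneg (by positivity) ht.le, Real.inv_rpow (norm_nonneg _),
          Real.rpow_neg (norm_nonneg _)]
      · rw [hw, indicator_of_notMem hz, indicator_of_notMem hz, ENNReal.zero_rpow_of_pos ht]
    rw [e]
    exact lintegral_norm_rpow_ball_lt_top ht3
  set c : ENNReal := ((∫⁻ z, (w z ^ (1 / (p - 2))) ^ p) ^ (1 / p)) ^ (p - 2) with hc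
  have hcfin : c ≠ ⊤ := ENNReal.rpow_ne_top_of_nonneg (by linarith)
    (ENNReal.rpow_ne_top_of_nonneg (by positivity) hfin.ne)
  refine ⟨c.toReal, ENNReal.toReal_nonneg, fun u v x => ?_⟩
  have hm : ∀ u : H1r, AEMeasurable (fun x => ‖fn u x‖ₑ) volume := fun u => (memLp_fn u).1.enorm
  have hwx : Measurable fun y => w (x - y) := hwm.comp (measurable_const.sub measurable_id)
  have h1 : ∫⁻ y, w (x - y) * ‖fn u y‖ₑ * ‖fn v y‖ₑ ≤
      c * ENNReal.ofReal (lpn p u) * ENNReal.ofReal (lpn p v) := by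
    have h2 := lintegral_holder_three (p := p) (hwx.pow_const (1 / (p - 2))).aemeasurable
      (hm u) (hm v) hp2
    have e1 : ∀ y, (w (x - y) ^ (1 / (p - 2))) ^ (p - 2) = w (x - y) := fun y => by
      rw [← ENNReal.rpow_mul, one_div_mul_cancel (by linarith), ENNReal.rpow_one]
    simp only [e1] at h2
    rw [lintegral_sub_left_eq_self (fun y => (w y ^ (1 / (p - 2))) ^ p) x, lintegral_fn_eq hp2 hp',
      lintegral_fn_eq hp2 hp'] at h2
    exact h2
  calc ∫⁻ y, ‖fn u y‖ₑ * ‖fn v y‖ₑ * ENNReal.ofReal ‖x - y‖⁻¹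
      ≤ ∫⁻ y, (w (x - y) * ‖fn u y‖ₑ * ‖fn v y‖ₑ + ENNReal.ofReal R⁻¹ * (‖fn u y‖ₑ * ‖fn v y‖ₑ)) := by
        refine lintegral_mono fun y => (mul_le_mul_right (hle (x - y)) _).trans_eq ?_
        ring
    _ = (∫⁻ y, w (x - y) * ‖fn u y‖ₑ * ‖fn v y‖ₑ) +
        ENNReal.ofReal R⁻¹ * ∫⁻ y, ‖fn u y‖ₑ * ‖fn v y‖ₑ := by
        have h0 : AEMeasurable (fun y => w (x - y) * ‖fn u y‖ₑ * ‖fn v y‖ₑ) volume :=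
          (hwx.aemeasurable.mul (hm u)).mul (hm v)
        rw [lintegral_add_left' h0,
          lintegral_const_mul' _ _ ENNReal.ofReal_ne_top]
    _ ≤ c * ENNReal.ofReal (lpn p u) * ENNReal.ofReal (lpn p v) +
        ENNReal.ofReal R⁻¹ * ENNReal.ofReal (‖u‖ * ‖v‖) :=
        add_le_add h1 (mul_le_mul_right (lintegral_fn_mul_le u v) _)
    _ = _ := by
        have hn := lpn_nonneg p
        have h1 := hn u
        have h2 := hn v
        rw [ENNReal.ofReal_add (by positivity) (by positivity),
          ENNReal.ofReal_mul ENNReal.toReal_nonneg, ENNReal.ofReal_toReal hcfin,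
          ENNReal.ofReal_mul (hn u), ENNReal.ofReal_mul (inv_nonneg.2 hR.le), mul_assoc]

/-- The polarised Newton potential `∫ u(y) v(y) / |x - y| dy`. -/
def pot (u v : H1r) (x : R3) : ℝ := ∫ y, fn u y * fn v y / ‖x - y‖

lemma enorm_newton_integrand (u v : H1r) (x y : R3) :
    ‖fn u y * fn v y / ‖x - y‖‖ₑ = ‖fn u y‖ₑ * ‖fn v y‖ₑ * ENNReal.ofReal ‖x - y‖⁻¹ := by
  rw [div_eq_mul_inv, enorm_mul, enorm_mul, Real.enorm_of_nonneg (by positivity : 0 ≤ ‖x - y‖⁻¹)]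

lemma aemeasurable_newton (u v : H1r) :
    AEStronglyMeasurable (fun z : R3 × R3 => fn u z.2 * fn v z.2 / ‖z.1 - z.2‖)
      (volume.prod volume) := by
  have h : ∀ u : H1r, AEMeasurable (fun z : R3 × R3 => fn u z.2) (volume.prod volume) := fun u =>
    (memLp_fn u).1.aemeasurable.comp_quasiMeasurePreserving Measure.quasiMeasurePreserving_snd
  exact (((h u).mul (h v)).div (by fun_prop)).aestronglyMeasurable

lemma aestronglyMeasurable_pot (u v : H1r) : AEStronglyMeasurable (pot u v) volume :=
  (aemeasurable_newton u v).integral_prod_right'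

lemma integrable_newton (u v : H1r) (x : R3) :
    Integrable (fun y => fn u y * fn v y / ‖x - y‖) volume := by
  obtain ⟨K, -, hK⟩ := exists_newton_bound (p := 4) (by norm_num) (by norm_num) one_pos
  refine ⟨?_, ?_⟩
  · have h := fun u : H1r => (memLp_fn u).1.aemeasurable
    exact (((h u).mul (h v)).div (by fun_prop)).aestronglyMeasurable
  · rw [HasFiniteIntegral]
    simp only [enorm_newton_integrand]
    exact (hK u v x).trans_lt ENNReal.ofReal_lt_top

lemma exists_abs_pot_le (hp : 3 < p) (hp' : p < 6) {R : ℝ} (hR : 0 < R) :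
    ∃ K : ℝ, 0 ≤ K ∧ ∀ (u v : H1r) (x : R3),
      (∫ y, |fn u y * fn v y / ‖x - y‖|) ≤ K * (lpn p u * lpn p v) + R⁻¹ * (‖u‖ * ‖v‖) ∧
      |pot u v x| ≤ K * (lpn p u * lpn p v) + R⁻¹ * (‖u‖ * ‖v‖) := by
  obtain ⟨K, hK0, hK⟩ := exists_newton_bound hp hp' hR
  refine ⟨K, hK0, fun u v x => ?_⟩
  have h1 : (∫ y, |fn u y * fn v y / ‖x - y‖|) ≤ K * (lpn p u * lpn p v) + R⁻¹ * (‖u‖ * ‖v‖) := by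
    have h2 := hK u v x
    simp only [← enorm_newton_integrand] at h2
    have hn := lpn_nonneg p
    have h3 := hn u
    have h4 := hn v
    rw [← ENNReal.ofReal_le_ofReal_iff (by positivity),
      ofReal_integral_eq_lintegral_ofReal (integrable_newton u v x).abs
        (Eventually.of_forall fun _ => abs_nonneg _)]
    simpa only [← Real.norm_eq_abs, ofReal_norm] using h2
  exact ⟨h1, (abs_integral_le_integral_abs).trans h1⟩

lemma exists_abs_pot_le_norm : ∃ K : ℝ, 0 ≤ K ∧ ∀ (u v : H1r) (x : R3),
    (∫ y, |fn u y * fn v y / ‖x - y‖|) ≤ K * (‖u‖ * ‖v‖) ∧ |pot u v x| ≤ K * (‖u‖ * ‖v‖) := by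
  obtain ⟨K, hK0, hK⟩ := exists_abs_pot_le (p := 4) (by norm_num) (by norm_num) one_pos
  obtain ⟨K', hK'0, hK'⟩ := exists_lpn_le (p := 4) (by norm_num) (by norm_num)
  have hb : ∀ u v : H1r, K * (lpn 4 u * lpn 4 v) + 1⁻¹ * (‖u‖ * ‖v‖) ≤
      (K * (K' * K') + 1) * (‖u‖ * ‖v‖) := by
    intro u v
    have h1 := mul_le_mul (hK' u) (hK' v) (lpn_nonneg 4 v) (by positivity)
    have h2 := mul_le_mul_of_nonneg_left h1 hK0
    rw [inv_one]
    linarith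
  exact ⟨K * (K' * K') + 1, by positivity, fun u v x =>
    ⟨(hK u v x).1.trans (hb u v), (hK u v x).2.trans (hb u v)⟩⟩

lemma pot_comm (u v : H1r) (x : R3) : pot u v x = pot v u x := by
  simp only [pot, mul_comm]

lemma pot_add_left (u u' v : H1r) (x : R3) : pot (u + u') v x = pot u v x + pot u' v x := by
  rw [pot, pot, pot, ← integral_add (integrable_newton u v x) (integrable_newton u' v x)]
  refine integral_congr_ae ?_
  filter_upwards [fn_add u u'] with y hy
  rw [hy]; ring

lemma pot_smul_left (r : ℝ) (u v : H1r) (x : R3) : pot (r • u) v x = r * pot u v x := by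
  rw [pot, pot, ← integral_const_mul]
  refine integral_congr_ae ?_
  filter_upwards [fn_smul r u] with y hy
  rw [hy]; ring

lemma pot_self_eq (u : H1r) (x : R3) : potential u x = pot u u x := by
  simp only [potential, pot, sq_abs]
  simp only [sq]

lemma integrable_fn_mul (w z : H1r) : Integrable (fun x => fn w x * fn z x) volume :=
  (memLp_fn w).integrable_mul (memLp_fn z)

lemma integral_abs_fn_mul_le (w z : H1r) : (∫ x, |fn w x * fn z x|) ≤ ‖w‖ * ‖z‖ := by
  rw [← ENNReal.ofReal_le_ofReal_iff (by positivity),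
    ofReal_integral_eq_lintegral_ofReal (integrable_fn_mul w z).abs
      (Eventually.of_forall fun _ => abs_nonneg _)]
  simpa only [← Real.norm_eq_abs, ofReal_norm, enorm_mul] using lintegral_fn_mul_le w z

/-- A bounded weight times `w z` is integrable with the obvious bound. -/
lemma bounded_weight {g : R3 → ℝ} (hg : AEStronglyMeasurable g volume) {M : ℝ}
    (hM : ∀ x, |g x| ≤ M) (w z : H1r) :
    Integrable (fun x => g x * fn w x * fn z x) volume ∧
    |∫ x, g x * fn w x * fn z x| ≤ M * (‖w‖ * ‖z‖) := by
  have hM0 : 0 ≤ M := (abs_nonneg _).trans (hM 0)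
  have h1 : Integrable (fun x => g x * fn w x * fn z x) volume := by
    have := (integrable_fn_mul w z).bdd_mul hg (Eventually.of_forall hM)
    simpa only [mul_assoc] using this
  refine ⟨h1, abs_integral_le_integral_abs.trans ?_⟩
  calc ∫ x, |g x * fn w x * fn z x| ≤ ∫ x, M * |fn w x * fn z x| := by
        refine integral_mono h1.abs ((integrable_fn_mul w z).abs.const_mul M) fun x => ?_
        simp only [mul_assoc, abs_mul (g x)]
        exact mul_le_mul_of_nonneg_right (hM x) (abs_nonneg _)
    _ ≤ M * (‖w‖ * ‖z‖) := by
        rw [integral_const_mul]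
        exact mul_le_mul_of_nonneg_left (integral_abs_fn_mul_le w z) hM0

/-- The quadrilinear form `∫∫ u(y) v(y) w(x) z(x) / |x - y|`. -/
def quart (u v w z : H1r) : ℝ := ∫ x, pot u v x * fn w x * fn z x

lemma integrable_quart (u v w z : H1r) :
    Integrable (fun x => pot u v x * fn w x * fn z x) volume := by
  obtain ⟨K, -, hK⟩ := exists_abs_pot_le_norm
  exact (bounded_weight (aestronglyMeasurable_pot u v) (fun x => (hK u v x).2) w z).1

lemma exists_abs_quart_le : ∃ K : ℝ, 0 ≤ K ∧ ∀ u v w z : H1r,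
    |quart u v w z| ≤ K * ‖u‖ * ‖v‖ * ‖w‖ * ‖z‖ := by
  obtain ⟨K, hK0, hK⟩ := exists_abs_pot_le_norm
  refine ⟨K, hK0, fun u v w z => ?_⟩
  refine (bounded_weight (aestronglyMeasurable_pot u v) (fun x => (hK u v x).2) w z).2.trans_eq ?_
  ring

lemma quart_symm (u v w z : H1r) : quart u v w z = quart w z u v := by
  obtain ⟨K, hK0, hK⟩ := exists_abs_pot_le_norm
  have hm : ∀ u : H1r, AEStronglyMeasurable (fun q : R3 × R3 => fn u q.1) (volume.prod volume) :=
    fun u => (memLp_fn u).1.comp_quasiMeasurePreserving Measure.quasiMeasurePreserving_fst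
  have haesm : AEStronglyMeasurable
      (fun q : R3 × R3 => fn u q.2 * fn v q.2 / ‖q.1 - q.2‖ * (fn w q.1 * fn z q.1))
      (volume.prod volume) := (aemeasurable_newton u v).mul ((hm w).mul (hm z))
  have hint : Integrable
      (fun q : R3 × R3 => fn u q.2 * fn v q.2 / ‖q.1 - q.2‖ * (fn w q.1 * fn z q.1))
      (volume.prod volume) := by
    rw [integrable_prod_iff haesm]
    refine ⟨Eventually.of_forall fun x => (integrable_newton u v x).mul_const (fn w x * fn z x), ?_⟩
    have e : ∀ x, ∫ y, ‖fn u y * fn v y / ‖x - y‖ * (fn w x * fn z x)‖ =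
        (∫ y, |fn u y * fn v y / ‖x - y‖|) * |fn w x * fn z x| := fun x => by
      rw [← integral_mul_const]
      simp only [Real.norm_eq_abs, abs_mul (_ / _)]
    simp only [e]
    refine (integrable_fn_mul w z).abs.bdd_mul (c := K * (‖u‖ * ‖v‖)) ?_ ?_
    · exact (aemeasurable_newton u v).norm.integral_prod_right'
    · refine Eventually.of_forall fun x => ?_
      rw [Real.norm_of_nonneg (integral_nonneg fun y => abs_nonneg _)]
      exact (hK u v x).1
  have h := integral_integral_swap
    (f := fun x y => fn u y * fn v y / ‖x - y‖ * (fn w x * fn z x)) hint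
  have e1 : quart u v w z = ∫ x, ∫ y, fn u y * fn v y / ‖x - y‖ * (fn w x * fn z x) := by
    simp only [quart, pot, integral_mul_const, mul_assoc]
  have e2 : quart w z u v = ∫ y, ∫ x, fn u y * fn v y / ‖x - y‖ * (fn w x * fn z x) := by
    rw [quart]
    refine integral_congr_ae (Eventually.of_forall fun y => ?_)
    simp only [pot]
    rw [mul_assoc, ← integral_mul_const]
    refine integral_congr_ae (Eventually.of_forall fun x => ?_)
    simp only [norm_sub_rev y x]
    ring
  rw [e1, e2]
  exact h

lemma B_eq_quart (u : H1r) : B u = quart u u u u := by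
  rw [B, quart]
  refine integral_congr_ae (Eventually.of_forall fun x => ?_)
  simp only [pot]
  rw [mul_assoc, ← integral_mul_const]
  refine integral_congr_ae (Eventually.of_forall fun y => ?_)
  simp only [sq_abs]
  ring

lemma B_nonneg (u : H1r) : 0 ≤ B u :=
  integral_nonneg fun x => integral_nonneg fun y => by positivity

/-! ### Differentiability of the energy -/


lemma quart_add_left (u u' v w z : H1r) : quart (u + u') v w z = quart u v w z + quart u' v w z := by
  rw [quart, quart, quart, ← integral_add (integrable_quart u v w z) (integrable_quart u' v w z)]
  simp only [pot_add_left, add_mul]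

lemma quart_smul_left (r : ℝ) (u v w z : H1r) : quart (r • u) v w z = r * quart u v w z := by
  rw [quart, quart, ← integral_const_mul]
  simp only [pot_smul_left, mul_assoc]

lemma quart_comm_left (u v w z : H1r) : quart u v w z = quart v u w z := by
  simp only [quart, pot_comm u v]

lemma quart_comm_right (u v w z : H1r) : quart u v w z = quart u v z w := by
  rw [quart_symm, quart_comm_left, quart_symm]

lemma quart_add_second (u v v' w z : H1r) :
    quart u (v + v') w z = quart u v w z + quart u v' w z := by
  simp only [quart_comm_left u, quart_add_left]

lemma quart_add_third (u v w w' z : H1r) :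
    quart u v (w + w') z = quart u v w z + quart u v w' z := by
  simp only [quart_symm u v, quart_add_left]

lemma quart_add_right (u v w z z' : H1r) :
    quart u v w (z + z') = quart u v w z + quart u v w z' := by
  simp only [quart_comm_right u v w, quart_add_third]

lemma quart_smul_right (r : ℝ) (u v w z : H1r) : quart u v w (r • z) = r * quart u v w z := by
  rw [quart_comm_right, quart_symm, quart_smul_left, quart_symm, quart_comm_right]

/-- The functional `φ ↦ ∫ (|x|⁻¹ * u²) u φ`. -/
def newtonDual (u : H1r) : StrongDual ℝ H1r :=
  LinearMap.mkContinuousOfExistsBound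
    { toFun := fun φ => quart u u u φ
      map_add' := quart_add_right u u u
      map_smul' := fun r φ => quart_smul_right r u u u φ } (by
    obtain ⟨K, -, hK⟩ := exists_abs_quart_le
    exact ⟨K * ‖u‖ * ‖u‖ * ‖u‖, fun φ => hK u u u φ⟩)

lemma newtonDual_apply (u φ : H1r) : newtonDual u φ = quart u u u φ := rfl

lemma hasFDerivAt_B (u : H1r) : HasFDerivAt B ((4 : ℝ) • newtonDual u) u := by
  obtain ⟨K, hK0, hK⟩ := exists_abs_quart_le
  refine hasFDerivAt_of_quadratic_remainder
    (g := fun h => 6 * (K * ‖u‖ * ‖u‖) + 4 * (K * ‖u‖ * ‖h‖) + K * ‖h‖ * ‖h‖) (by fun_prop) ?_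
  intro h
  have e : B (u + h) - B u - ((4 : ℝ) • newtonDual u) h =
      2 * quart u u h h + 4 * quart u h u h + 4 * quart u h h h + quart h h h h := by
    rw [B_eq_quart, B_eq_quart, smul_apply, newtonDual_apply, smul_eq_mul]
    simp only [quart_add_left, quart_add_second, quart_add_third, quart_add_right]
    rw [quart_comm_left h u, quart_comm_left h u, quart_comm_left h u, quart_comm_left h u,
      quart_comm_right u h h u, quart_symm u h u u, quart_comm_right u u h u, quart_symm h h u u,
      quart_symm h h u h, quart_comm_right h h h u, quart_symm h h u h]
    ring
  rw [e]
  have h1 := hK u u h h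
  have h2 := hK u h u h
  have h3 := hK u h h h
  have h4 := hK h h h h
  rw [abs_le] at h1 h2 h3 h4 ⊢
  constructor <;> nlinarith [h1.1, h1.2, h2.1, h2.2, h3.1, h3.2, h4.1, h4.2]

lemma A_add (u h : H1r) : A (u + h) = A u + 2 * gradDual u h + A h := by
  have e : gradDual (u + h) h = gradDual u h + gradDual h h := by
    rw [gradDual_comm, map_add, gradDual_comm h u]
  have e' : gradDual (u + h) u = gradDual u u + gradDual u h := by
    rw [gradDual_comm, map_add]
  rw [← gradDual_self (u + h), ← gradDual_self u, ← gradDual_self h, map_add, e, e']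
  ring

lemma hasFDerivAt_A (u : H1r) : HasFDerivAt A ((2 : ℝ) • gradDual u) u := by
  have e : ∀ h : H1r, |A (u + h) - A u - ((2 : ℝ) • gradDual u) h| ≤ 1 * ‖h‖ ^ 2 := fun h => by
    have e1 : A (u + h) - A u - ((2 : ℝ) • gradDual u) h = A h := by
      rw [A_add, smul_apply, smul_eq_mul]
      ring
    rw [e1, abs_of_nonneg (A_nonneg h), one_mul]
    exact A_le_norm_sq h
  exact hasFDerivAt_of_quadratic_remainder (g := fun _ => (1 : ℝ)) continuousAt_const e

lemma D_add (u h : H1r) : D (u + h) = D u + 2 * l2Dual u h + D h := by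
  have e : l2Dual (u + h) h = l2Dual u h + l2Dual h h := by
    rw [l2Dual_comm, map_add, l2Dual_comm h u]
  have e' : l2Dual (u + h) u = l2Dual u u + l2Dual u h := by
    rw [l2Dual_comm, map_add]
  rw [← l2Dual_self (u + h), ← l2Dual_self u, ← l2Dual_self h, map_add, e, e']
  ring

lemma hasFDerivAt_D (u : H1r) : HasFDerivAt D ((2 : ℝ) • l2Dual u) u := by
  have e : ∀ h : H1r, |D (u + h) - D u - ((2 : ℝ) • l2Dual u) h| ≤ 1 * ‖h‖ ^ 2 := fun h => by
    have e1 : D (u + h) - D u - ((2 : ℝ) • l2Dual u) h = D h := by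
      rw [D_add, smul_apply, smul_eq_mul]
      ring
    rw [e1, abs_of_nonneg (D_nonneg h), one_mul]
    exact D_le_norm_sq h
  exact hasFDerivAt_of_quadratic_remainder (g := fun _ => (1 : ℝ)) continuousAt_const e

/-- The derivative of the energy `F`. -/
def energyDual (hp : 2 < p) (hp' : p < 6) (u : H1r) : StrongDual ℝ H1r :=
  gradDual u + newtonDual u - powDual hp hp' u

lemma energyDual_apply (hp : 2 < p) (hp' : p < 6) (u φ : H1r) :
    energyDual hp hp' u φ = gradDual u φ + newtonDual u φ - powDual hp hp' u φ := rfl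

lemma energyDual_self (hp : 2 < p) (hp' : p < 6) (u : H1r) :
    energyDual hp hp' u u = A u + B u - C p u := by
  rw [energyDual_apply, gradDual_self, newtonDual_apply, powDual_self, B_eq_quart]

lemma hasFDerivAt_energy_combination {E : Type*} [NormedAddCommGroup E] [NormedSpace ℝ E]
    {f g h : E → ℝ} {a b c : StrongDual ℝ E} {u : E} (hp : p ≠ 0)
    (hf : HasFDerivAt f ((2 : ℝ) • a) u) (hg : HasFDerivAt g ((4 : ℝ) • b) u)
    (hh : HasFDerivAt h (p • c) u) :
    HasFDerivAt (fun u => 1 / 2 * f u + 1 / 4 * g u - 1 / p * h u) (a + b - c) u := by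
  refine (((hf.const_mul (1 / 2)).add (hg.const_mul (1 / 4))).sub
    (hh.const_mul (1 / p))).congr_fderiv ?_
  rw [smul_smul, smul_smul, smul_smul, one_div_mul_cancel hp]
  norm_num

lemma hasFDerivAt_F (hp : 3 < p) (hp' : p < 6) (u : H1r) :
    HasFDerivAt (F p) (energyDual (by linarith) hp' u) u :=
  hasFDerivAt_energy_combination (by linarith) (hasFDerivAt_A u) (hasFDerivAt_B u)
    (hasFDerivAt_C hp hp' u)

lemma continuous_A : Continuous A := continuous_iff_continuousAt.2 fun u => (hasFDerivAt_A u).continuousAt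

lemma continuous_D : Continuous D := continuous_iff_continuousAt.2 fun u => (hasFDerivAt_D u).continuousAt

lemma continuous_F (hp : 3 < p) (hp' : p < 6) : Continuous (F p) :=
  continuous_iff_continuousAt.2 fun u => (hasFDerivAt_F hp hp' u).continuousAt

lemma eqResidual_eq (hp : 2 < p) (hp' : p < 6) (lam : ℝ) (u φ : H1r) :
    eqResidual p lam u φ = (energyDual hp hp' u - lam • l2Dual u) φ := by
  rw [sub_apply, smul_apply, energyDual_apply, gradDual_apply, newtonDual_apply, powDual_apply,
    l2Dual_apply, eqResidual, quart, smul_eq_mul]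
  simp only [pot_self_eq]
  ring

/-! ### Dilations -/


section LpDilation

variable {X : Type*} [NormedAddCommGroup X]

lemma eLpNorm_dilation {f : R3 → X} (hf : AEStronglyMeasurable f volume) (θ : ℝ) :
    eLpNorm (fun x => f (Real.exp θ • x)) 2 volume =
      ENNReal.ofReal (Real.exp (-(3 * θ))) ^ (1 / 2 : ℝ) * eLpNorm f 2 volume := by
  have hr := Real.exp_ne_zero θ
  have hm : Measurable (fun x : R3 => Real.exp θ • x) := measurable_const_smul _
  have hf' : AEStronglyMeasurable f (Measure.map (fun x : R3 => Real.exp θ • x) volume) := by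
    rw [Measure.map_addHaar_smul volume hr]
    exact hf.smul_measure _
  have h := eLpNorm_map_measure (p := 2) hf' hm.aemeasurable
  rw [Measure.map_addHaar_smul volume hr, eLpNorm_smul_measure_of_ne_top (by simp)] at h
  have e : |(Real.exp θ ^ Module.finrank ℝ R3)⁻¹| = Real.exp (-(3 * θ)) := by
    rw [finrank_euclideanSpace_fin, ← Real.exp_nat_mul, ← Real.exp_neg, abs_of_pos (Real.exp_pos _)]
    norm_num
  rw [e] at h
  simpa [Function.comp_def] using h.symm

lemma tendsto_eLpNorm_dilation_of_hasCompactSupport {g : R3 → X} (hg : Continuous g)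
    (hc : HasCompactSupport g) (θ₀ : ℝ) :
    Tendsto (fun θ => eLpNorm (fun x => g (Real.exp θ • x) - g (Real.exp θ₀ • x)) 2 volume)
      (𝓝 θ₀) (𝓝 0) := by
  obtain ⟨M, hM⟩ := hg.bounded_above_of_compact_support hc
  obtain ⟨R, hR⟩ := hc.isCompact.isBounded.subset_closedBall (0 : R3)
  have hz : ∀ x : R3, R < ‖x‖ → g x = 0 := fun x hx => by
    by_contra h
    have := hR (subset_tsupport g h)
    rw [mem_closedBall_zero_iff] at this
    linarith
  have hlim : Tendsto
      (fun θ => ∫⁻ x, ‖g (Real.exp θ • x) - g (Real.exp θ₀ • x)‖ₑ ^ (2 : ℝ)) (𝓝 θ₀)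
      (𝓝 (∫⁻ _ : R3, 0)) := by
    refine tendsto_lintegral_filter_of_dominated_convergence
      ((Metric.closedBall (0 : R3) (R * Real.exp (1 - θ₀))).indicator
        fun _ => ENNReal.ofReal (2 * M) ^ (2 : ℝ)) ?_ ?_ ?_ ?_
    · exact Eventually.of_forall fun θ =>
        (((by fun_prop : Continuous fun x : R3 =>
          g (Real.exp θ • x) - g (Real.exp θ₀ • x))).enorm.measurable.pow_const _)
    · filter_upwards [Ioi_mem_nhds (sub_one_lt θ₀)] with θ hθ
      refine Eventually.of_forall fun x => ?_
      by_cases hx : x ∈ Metric.closedBall (0 : R3) (R * Real.exp (1 - θ₀))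
      · rw [indicator_of_mem hx]
        refine ENNReal.rpow_le_rpow ?_ (by norm_num)
        rw [← ofReal_norm]
        refine ENNReal.ofReal_le_ofReal ((norm_sub_le _ _).trans ?_)
        linarith [hM (Real.exp θ • x), hM (Real.exp θ₀ • x)]
      · rw [mem_closedBall_zero_iff, not_le] at hx
        have hbig : ∀ s, θ₀ - 1 ≤ s → R < ‖Real.exp s • x‖ := fun s hs => by
          rw [norm_smul, Real.norm_of_nonneg (Real.exp_pos _).le]
          have h1 : R < Real.exp (θ₀ - 1) * ‖x‖ := by
            have := mul_lt_mul_of_pos_left hx (Real.exp_pos (θ₀ - 1))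
            have e : Real.exp (θ₀ - 1) * (R * Real.exp (1 - θ₀)) = R := by
              rw [mul_left_comm, ← Real.exp_add]; simp
            rwa [e] at this
          exact h1.trans_le (mul_le_mul_of_nonneg_right (Real.exp_le_exp.2 hs) (norm_nonneg _))
        rw [hz _ (hbig θ (le_of_lt hθ)), hz _ (hbig θ₀ (by linarith)), sub_zero, enorm_zero,
          ENNReal.zero_rpow_of_pos (by norm_num)]
        exact zero_le
    · rw [lintegral_indicator Metric.isClosed_closedBall.measurableSet, setLIntegral_const]
      exact ENNReal.mul_ne_top (ENNReal.rpow_ne_top_of_nonneg (by norm_num) ENNReal.ofReal_ne_top)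
        measure_closedBall_lt_top.ne
    · refine Eventually.of_forall fun x => ?_
      have hcont : Continuous fun θ => ‖g (Real.exp θ • x) - g (Real.exp θ₀ • x)‖ₑ ^ (2 : ℝ) :=
        ENNReal.continuous_rpow_const.comp (by fun_prop)
      simpa using hcont.tendsto θ₀
  have h2 := (ENNReal.continuous_rpow_const (y := (1 / 2 : ℝ))).tendsto _ |>.comp hlim
  simp only [lintegral_zero, ENNReal.zero_rpow_of_pos (by norm_num : (0 : ℝ) < 1 / 2)] at h2
  refine h2.congr fun θ => ?_
  rw [eLpNorm_eq_lintegral_rpow_enorm_toReal (by norm_num) (by norm_num)]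
  simp

lemma tendsto_eLpNorm_dilation [NormedSpace ℝ X] {f : R3 → X} (hf : MemLp f 2 volume) (θ₀ : ℝ) :
    Tendsto (fun θ => eLpNorm (fun x => f (Real.exp θ • x) - f (Real.exp θ₀ • x)) 2 volume)
      (𝓝 θ₀) (𝓝 0) := by
  rw [ENNReal.tendsto_nhds_zero]
  intro ε hε
  set K : ENNReal := ENNReal.ofReal (Real.exp (-(3 * (θ₀ - 1)))) ^ (1 / 2 : ℝ) with hK
  have hKtop : K + K ≠ ⊤ := by
    have : K ≠ ⊤ := ENNReal.rpow_ne_top_of_nonneg (by norm_num) ENNReal.ofReal_ne_top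
    exact ENNReal.add_ne_top.2 ⟨this, this⟩
  obtain ⟨δ, hδ, hδK⟩ := ENNReal.exists_nnreal_pos_mul_lt hKtop (ENNReal.half_pos hε.ne').ne'
  obtain ⟨g, hgc, hfg, hg, hgm⟩ := hf.exists_hasCompactSupport_eLpNorm_sub_le (by norm_num)
    (ENNReal.coe_pos.2 hδ).ne'
  have hfgm : AEStronglyMeasurable (f - g) volume := hf.1.sub hgm.1
  have hbound : ∀ s, θ₀ - 1 ≤ s →
      eLpNorm (fun x => (f - g) (Real.exp s • x)) 2 volume ≤ δ * K := fun s hs => by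
    rw [eLpNorm_dilation hfgm, mul_comm (δ : ENNReal)]
    refine mul_le_mul' (ENNReal.rpow_le_rpow (ENNReal.ofReal_le_ofReal
      (Real.exp_le_exp.2 (by linarith))) (by norm_num)) hfg
  have hmd : ∀ {h : R3 → X}, AEStronglyMeasurable h volume → ∀ s : ℝ,
      AEStronglyMeasurable (fun x => h (Real.exp s • x)) volume := fun {h} hh s => by
    refine hh.comp_quasiMeasurePreserving ⟨measurable_const_smul _, ?_⟩
    rw [Measure.map_addHaar_smul volume (Real.exp_ne_zero s)]
    exact Measure.smul_absolutelyContinuous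
  filter_upwards [Ioi_mem_nhds (sub_one_lt θ₀),
    (ENNReal.tendsto_nhds_zero.1 (tendsto_eLpNorm_dilation_of_hasCompactSupport hg hgc θ₀))
      (ε / 2) (ENNReal.half_pos hε.ne')] with θ hθ hgθ
  have e : (fun x => f (Real.exp θ • x) - f (Real.exp θ₀ • x)) =
      ((fun x => (f - g) (Real.exp θ • x)) - fun x => (f - g) (Real.exp θ₀ • x)) +
        fun x => g (Real.exp θ • x) - g (Real.exp θ₀ • x) := by
    ext x; simp only [Pi.add_apply, Pi.sub_apply]; abel
  rw [e]
  calc _ ≤ _ := eLpNorm_add_le ((hmd hfgm θ).sub (hmd hfgm θ₀)) ((hmd hgm.1 θ).sub (hmd hgm.1 θ₀))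
        (by norm_num)
    _ ≤ (δ * K + δ * K) + ε / 2 := add_le_add ((eLpNorm_sub_le (hmd hfgm θ) (hmd hfgm θ₀)
        (by norm_num)).trans (add_le_add (hbound θ (le_of_lt hθ)) (hbound θ₀ (by linarith)))) hgθ
    _ ≤ ε / 2 + ε / 2 := by
        rw [← mul_add]
        exact add_le_add hδK.le le_rfl
    _ = ε := ENNReal.add_halves ε

lemma continuous_toLp_dilation [NormedSpace ℝ X] {f : R3 → X} (hf : MemLp f 2 volume) (a : ℝ)
    (h : ∀ θ, MemLp (fun x => Real.exp (a * θ) • f (Real.exp θ • x)) 2 volume) :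
    Continuous fun θ => (h θ).toLp _ := by
  have hd : Continuous fun θ => (memLp_dilation hf (Real.exp_ne_zero θ)).toLp _ := by
    rw [continuous_iff_continuousAt]
    intro θ₀
    rw [ContinuousAt, Lp.tendsto_Lp_iff_tendsto_eLpNorm'']
    exact tendsto_eLpNorm_dilation hf θ₀
  have hc : Continuous fun θ => Real.exp (a * θ) •
      (memLp_dilation hf (Real.exp_ne_zero θ)).toLp _ := by fun_prop
  exact hc

end LpDilation

lemma continuous_kappa_right (u : H1r) : Continuous fun θ => kappa u θ := by
  refine Continuous.subtype_mk ?_ _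
  refine (WithLp.prod_continuous_toLp 2 _ _).comp (Continuous.prodMk ?_ ?_)
  · exact continuous_toLp_dilation (memLp_fn u) (3 / 2) (memLp_kappa_fn u)
  · exact continuous_toLp_dilation (memLp_grad u) (5 / 2) (memLp_kappa_grad u)

lemma fn_kappa (u : H1r) (θ : ℝ) :
    fn (kappa u θ) =ᵐ[volume] fun x => Real.exp (3 / 2 * θ) * fn u (Real.exp θ • x) :=
  (memLp_kappa_fn u θ).coeFn_toLp

lemma grad_kappa (u : H1r) (θ : ℝ) :
    grad (kappa u θ) =ᵐ[volume] fun x => Real.exp (5 / 2 * θ) • grad u (Real.exp θ • x) :=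
  (memLp_kappa_grad u θ).coeFn_toLp

lemma integral_eq_of_dilation {g : R3 → ℝ} (f : R3 → ℝ) (a θ : ℝ)
    (h : ∀ᵐ x, g x = Real.exp a * f (Real.exp θ • x)) :
    ∫ x, g x = Real.exp (a - 3 * θ) * ∫ x, f x := by
  rw [integral_congr_ae h, integral_const_mul, Measure.integral_comp_smul, smul_eq_mul,
    finrank_euclideanSpace_fin, ← Real.exp_nat_mul, ← Real.exp_neg, abs_of_pos (Real.exp_pos _),
    ← mul_assoc, ← Real.exp_add]
  norm_num [sub_eq_add_neg]

lemma D_kappa (u : H1r) (θ : ℝ) : D (kappa u θ) = D u := by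
  refine (integral_eq_of_dilation (fun y => |fn u y| ^ 2) (3 * θ) θ ?_).trans ?_
  · filter_upwards [fn_kappa u θ] with x hx
    rw [hx, abs_mul, mul_pow, Real.abs_exp, ← Real.exp_nat_mul]
    ring_nf
  · rw [D, sub_self, Real.exp_zero, one_mul]

lemma A_kappa (u : H1r) (θ : ℝ) : A (kappa u θ) = Real.exp (2 * θ) * A u := by
  refine (integral_eq_of_dilation (fun y => ‖grad u y‖ ^ 2) (5 * θ) θ ?_).trans ?_
  · filter_upwards [grad_kappa u θ] with x hx
    rw [hx, norm_smul, mul_pow, Real.norm_eq_abs, Real.abs_exp, ← Real.exp_nat_mul]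
    ring_nf
  · rw [A]
    ring_nf

lemma C_kappa (u : H1r) (θ : ℝ) :
    C p (kappa u θ) = Real.exp (3 * (p - 2) / 2 * θ) * C p u := by
  refine (integral_eq_of_dilation (fun y => |fn u y| ^ p) (3 / 2 * θ * p) θ ?_).trans ?_
  · filter_upwards [fn_kappa u θ] with x hx
    rw [hx, abs_mul, Real.mul_rpow (abs_nonneg _) (abs_nonneg _), Real.abs_exp, ← Real.exp_mul]
  · rw [C]
    ring_nf

lemma pot_kappa (u : H1r) (θ : ℝ) (x : R3) :
    pot (kappa u θ) (kappa u θ) x = Real.exp θ * pot u u (Real.exp θ • x) := by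
  refine (integral_eq_of_dilation (fun z => (fn u z * fn u z / ‖Real.exp θ • x - z‖)) (4 * θ) θ ?_).trans ?_
  · filter_upwards [fn_kappa u θ] with y hy
    have e : Real.exp (4 * θ) = Real.exp (3 / 2 * θ) * Real.exp (3 / 2 * θ) * Real.exp θ := by
      rw [← Real.exp_add, ← Real.exp_add]
      ring_nf
    have h0 := Real.exp_ne_zero θ
    rw [hy, ← smul_sub, norm_smul, Real.norm_eq_abs, Real.abs_exp, e]
    field_simp
  · rw [pot]
    ring_nf

lemma B_kappa (u : H1r) (θ : ℝ) : B (kappa u θ) = Real.exp θ * B u := by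
  rw [B_eq_quart, B_eq_quart]
  refine (integral_eq_of_dilation (fun y => (pot u u y * fn u y * fn u y)) (4 * θ) θ ?_).trans ?_
  · filter_upwards [fn_kappa u θ] with x hx
    have e : Real.exp (4 * θ) = Real.exp (3 / 2 * θ) * Real.exp (3 / 2 * θ) * Real.exp θ := by
      rw [← Real.exp_add, ← Real.exp_add]
      ring_nf
    rw [hx, pot_kappa, e]
    ring
  · rw [quart]
    ring_nf

lemma F_kappa (u : H1r) (θ : ℝ) : F p (kappa u θ) = 1 / 2 * (Real.exp (2 * θ) * A u) +
    1 / 4 * (Real.exp θ * B u) - 1 / p * (Real.exp (3 * (p - 2) / 2 * θ) * C p u) := by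
  rw [F, A_kappa, B_kappa, C_kappa]

lemma ext_of_fn_ae_eq {u v : H1r} (h : fn u =ᵐ[volume] fn v) : u = v := by
  rw [← sub_eq_zero]
  refine eq_zero_of_D_eq_zero ?_
  rw [D]
  refine (integral_congr_ae ?_).trans (integral_zero R3 ℝ)
  filter_upwards [fn_sub u v, h] with x hx hx'
  rw [hx, hx']
  simp

lemma kappa_sub (u v : H1r) (θ : ℝ) : kappa (u - v) θ = kappa u θ - kappa v θ := by
  refine ext_of_fn_ae_eq ?_
  filter_upwards [fn_kappa (u - v) θ, fn_kappa u θ, fn_kappa v θ, fn_sub (kappa u θ) (kappa v θ),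
    ae_dilation (fn_sub u v) (Real.exp_ne_zero θ)] with x h1 h2 h3 h4 h5
  rw [h1, h4, h2, h3, h5]
  ring

lemma kappa_zero (θ : ℝ) : kappa 0 θ = 0 := by
  simpa using kappa_sub 0 0 θ

lemma kappa_neg (u : H1r) (θ : ℝ) : kappa (-u) θ = -kappa u θ := by
  simpa [kappa_zero] using kappa_sub 0 u θ

lemma norm_kappa_le (u : H1r) (θ : ℝ) : ‖kappa u θ‖ ≤ (1 + Real.exp θ) * ‖u‖ := by
  have h0 := Real.exp_pos θ
  refine abs_le_of_sq_le_sq' ?_ (by positivity) |>.2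
  have e : Real.exp (2 * θ) = Real.exp θ ^ 2 := by rw [← Real.exp_nat_mul]; norm_num
  rw [norm_sq_eq, D_kappa, A_kappa, mul_pow, norm_sq_eq, e]
  nlinarith [D_nonneg u, A_nonneg u, mul_nonneg h0.le (D_nonneg u), mul_nonneg h0.le (A_nonneg u),
    mul_nonneg (sq_nonneg (Real.exp θ)) (D_nonneg u)]

lemma continuous_kappa : Continuous fun q : ℝ × H1r => kappa q.2 q.1 := by
  rw [continuous_iff_continuousAt]
  rintro ⟨θ₀, u₀⟩
  rw [ContinuousAt, tendsto_iff_norm_sub_tendsto_zero]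
  have h1 : Continuous fun q : ℝ × H1r =>
      (1 + Real.exp q.1) * ‖q.2 - u₀‖ + ‖kappa u₀ q.1 - kappa u₀ θ₀‖ := by
    have := (continuous_kappa_right u₀).comp (continuous_fst (X := ℝ) (Y := H1r))
    simp only [Function.comp_def] at this
    fun_prop
  have h2 := h1.tendsto (θ₀, u₀)
  simp only [sub_self, norm_zero, mul_zero, add_zero] at h2
  refine squeeze_zero (fun _ => norm_nonneg _) (fun q => ?_) h2
  have e : kappa q.2 q.1 - kappa u₀ θ₀ = kappa (q.2 - u₀) q.1 + (kappa u₀ q.1 - kappa u₀ θ₀) := by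
    rw [kappa_sub]; abel
  rw [e]
  exact (norm_add_le _ _).trans (add_le_add (norm_kappa_le _ _) le_rfl)

/-! ### Positivity of the min-max level -/

variable {c : ℝ}

lemma A_neg (u : H1r) : A (-u) = A u := by
  rw [← gradDual_self, ← gradDual_self, map_neg, gradDual_comm, map_neg, neg_neg]

lemma D_smul (r : ℝ) (u : H1r) : D (r • u) = r ^ 2 * D u := by
  rw [← l2Dual_self, ← l2Dual_self, map_smul, l2Dual_comm, map_smul, smul_eq_mul, smul_eq_mul]
  ring

lemma C_nonneg (u : H1r) : 0 ≤ C p u :=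
  integral_nonneg fun _ => by positivity

lemma D_pos {u : H1r} (hu : u ≠ 0) : 0 < D u :=
  (D_nonneg u).lt_of_ne fun h => hu (eq_zero_of_D_eq_zero h.symm)

lemma isCompact_inter_of_injective {E G : Type*} [NormedAddCommGroup E] [NormedSpace ℝ E]
    [NormedAddCommGroup G] [NormedSpace ℝ G] (T : E →L[ℝ] G) (hT : ∀ x, T x = 0 → x = 0)
    (W : Submodule ℝ E) [FiniteDimensional ℝ W] (c : ℝ) :
    IsCompact ({x | ‖T x‖ ^ 2 = c} ∩ (W : Set E)) := by
  have hker : LinearMap.ker (T.toLinearMap ∘ₗ W.subtype) = ⊥ := by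
    rw [LinearMap.ker_eq_bot']
    exact fun v hv => Subtype.ext (hT v hv)
  obtain ⟨K, -, hK⟩ := LinearMap.exists_antilipschitzWith _ hker
  have hcl : IsClosed {v : W | ‖T v‖ ^ 2 = c} := isClosed_eq (by fun_prop) continuous_const
  have hbd : Bornology.IsBounded {v : W | ‖T v‖ ^ 2 = c} := by
    rw [isBounded_iff_forall_norm_le]
    refine ⟨K * Real.sqrt c, fun v hv => ?_⟩
    have h1 := hK.le_mul_dist v 0
    rw [map_zero, dist_zero_right, dist_zero_right] at h1
    rw [Set.mem_ofPred_eq] at hv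
    rwa [← hv, Real.sqrt_sq (norm_nonneg _)]
  convert (Metric.isCompact_of_isClosed_isBounded hcl hbd).image
    (continuous_subtype_val (p := fun x => x ∈ W)) using 1
  ext u
  constructor
  · rintro ⟨h1, h2⟩
    exact ⟨⟨u, h2⟩, h1, rfl⟩
  · rintro ⟨v, h1, rfl⟩
    exact ⟨h1, v.2⟩

/-- The inclusion of `H¹_r` in `L²`. -/
def toL2 : H1r →L[ℝ] Lp ℝ 2 (volume : Measure R3) :=
  (WithLp.fstL 2 ℝ (Lp ℝ 2 (volume : Measure R3)) (Lp R3 2 (volume : Measure R3))).comp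
    H1r.subtypeL

lemma D_eq_norm_toL2_sq (u : H1r) : D u = ‖toL2 u‖ ^ 2 := D_eq_norm_sq u

lemma isCompact_sphere_inter (W : Submodule ℝ H1r) [FiniteDimensional ℝ W] :
    IsCompact (S c ∩ (W : Set H1r)) := by
  have h := isCompact_inter_of_injective toL2
    (fun u hu => eq_zero_of_D_eq_zero (by rw [D_eq_norm_toL2_sq, hu]; simp)) W c
  have e : S c = {u | ‖toL2 u‖ ^ 2 = c} := by
    ext u
    simp only [S, Set.mem_ofPred_eq, D_eq_norm_toL2_sq]
  rw [e]
  exact h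

lemma exists_injective_linearMap {E : Type*} [NormedAddCommGroup E] [NormedSpace ℝ E]
    {W W' : Submodule ℝ E} [FiniteDimensional ℝ W'] (h : W < W') :
    ∃ ι : (Fin (Module.finrank ℝ W + 1) → ℝ) →ₗ[ℝ] E,
      Continuous ι ∧ (∀ x, x ≠ 0 → ι x ≠ 0) ∧ ∀ x, ι x ∈ W' := by
  obtain ⟨b, hbi⟩ := exists_linearIndependent_of_le_finrank (R := ℝ) (M := W')
    (n := Module.finrank ℝ W + 1) (Submodule.finrank_lt_finrank_of_lt h)
  refine ⟨W'.subtype ∘ₗ Fintype.linearCombination ℝ b,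
    LinearMap.continuous_of_finiteDimensional _, fun x hx h => ?_,
    fun x => (Fintype.linearCombination ℝ b x).2⟩
  refine hx (hbi.fintypeLinearCombination_injective ?_)
  rw [map_zero]
  exact Subtype.ext h

lemma gbar_mem_Gam (V : ℕ → Submodule ℝ H1r) (n : ℕ) (θ : ℝ) :
    (fun q : ℝ × H1r => gbar θ q.1 q.2) ∈ Gam c V n θ := by
  refine ⟨Continuous.continuousOn ?_, ?_, ?_, fun u _ => ⟨rfl, rfl⟩⟩
  · have h : Continuous fun q : ℝ × H1r => (((2 * q.1 - 1) * θ, q.2) : ℝ × H1r) := by fun_prop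
    exact continuous_kappa.comp h
  · rintro ⟨t, u⟩ ⟨-, hu, -⟩
    exact (D_kappa _ _).trans hu
  · exact fun t _ u _ => kappa_neg _ _

lemma F_kappa_pos_of_lt (hp : 10 / 3 < p) {u : H1r} {s t : ℝ} (hst : t < s)
    (h : 0 < F p (kappa u s)) : 0 < F p (kappa u t) := by
  set α := 3 * (p - 2) / 2 with hα
  have hα2 : 2 < α := by rw [hα]; linarith
  rw [F_kappa] at h ⊢
  have hexp : ∀ b, b ≤ α → Real.exp (α * (t - s)) * Real.exp (b * s) ≤ Real.exp (b * t) := by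
    intro b hb
    rw [← Real.exp_add]
    refine Real.exp_le_exp.2 ?_
    nlinarith
  have h2 := mul_le_mul_of_nonneg_right (hexp 2 hα2.le) (A_nonneg u)
  have h1 := mul_le_mul_of_nonneg_right (hexp 1 (by linarith)) (B_nonneg u)
  rw [one_mul, one_mul] at h1
  have h3 : Real.exp (α * (t - s)) * Real.exp (α * s) = Real.exp (α * t) := by
    rw [← Real.exp_add]; ring_nf
  have h4 := mul_pos (Real.exp_pos (α * (t - s))) h
  rw [← h3]
  nlinarith

/-- Every odd family over the punctured `(m+1)`-dimensional space meets the orthogonal complement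
of a subspace of dimension `m`. -/
lemma exists_mem_orthogonal (W : Submodule ℝ H1r) [FiniteDimensional ℝ W]
    {f : (Fin (Module.finrank ℝ W + 1) → ℝ) → H1r} (hf : ContinuousOn f {0}ᶜ)
    (hodd : ∀ x, x ≠ 0 → f (-x) = -f x) : ∃ x, x ≠ 0 ∧ f x ∈ Wᗮ := by
  let e := (Module.finBasis ℝ W).equivFun
  have he : Continuous e := e.toLinearMap.continuous_of_finiteDimensional
  obtain ⟨x, hx, h⟩ := BorsukUlam.exists_ne_zero_eq_zero
    (f := fun x => e (W.orthogonalProjectionOnto (f x)))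
    ((he.comp W.orthogonalProjectionOnto.continuous).comp_continuousOn hf)
    (fun x hx => by simp only [hodd x hx, map_neg])
  refine ⟨x, hx, ?_⟩
  rw [← Submodule.orthogonalProjectionOnto_eq_zero_iff]
  exact e.map_eq_zero_iff.1 h

lemma bn_le_F {V : ℕ → Submodule ℝ H1r} {n : ℕ} (hb : 1 ≤ bn p c V n) {u : H1r}
    (hu : u ∈ Bset p c V n) : bn p c V n ≤ F p u := by
  refine csInf_le ?_ ⟨u, hu, rfl⟩
  by_contra h
  rw [bn, Real.sInf_of_not_bddBelow h] at hb
  linarith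

lemma exists_odd_map_level {E : Type*} [NormedAddCommGroup E] [NormedSpace ℝ E] {d : E → ℝ}
    (hdc : Continuous d) (hdpos : ∀ u, u ≠ 0 → 0 < d u) (hdsmul : ∀ (r : ℝ) u, d (r • u) = r ^ 2 * d u)
    (hc : 0 < c) {W W' : Submodule ℝ E} [FiniteDimensional ℝ W']
    (h : W < W') : ∃ v : (Fin (Module.finrank ℝ W + 1) → ℝ) → E,
      ContinuousOn v {0}ᶜ ∧ (∀ x, v (-x) = -v x) ∧ ∀ x, x ≠ 0 → d (v x) = c ∧ v x ∈ W' := by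
  obtain ⟨ι, hιc, hι0, hιW⟩ := exists_injective_linearMap h
  refine ⟨fun x => (Real.sqrt c / Real.sqrt (d (ι x))) • ι x, ?_, fun x => ?_, fun x hx => ?_⟩
  · refine ContinuousOn.smul (continuousOn_const.div ?_ ?_) hιc.continuousOn
    · exact (Real.continuous_sqrt.comp (hdc.comp hιc)).continuousOn
    · exact fun x hx => (Real.sqrt_pos.2 (hdpos _ (hι0 x hx))).ne'
  · have hneg : d (-ι x) = d (ι x) := by simpa using hdsmul (-1) (ι x)
    simp only [map_neg, hneg, smul_neg]
  · have hD := hdpos _ (hι0 x hx)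
    refine ⟨?_, W'.smul_mem _ (hιW x)⟩
    change d (_ • _) = c
    rw [hdsmul, div_pow, Real.sq_sqrt hc.le, Real.sq_sqrt hD.le, div_mul_cancel₀ _ hD.ne']

lemma continuousOn_comp_log {E X : Type*} [TopologicalSpace E] [TopologicalSpace X]
    {k : E → ℝ → E} {a : E → ℝ} (hk : Continuous fun q : ℝ × E => k q.2 q.1) (ha : Continuous a)
    {v : X → E} {T : Set X} (hv : ContinuousOn v T) (hpos : ∀ x ∈ T, 0 < a (v x)) {ρ : ℝ}
    (hρ : 0 < ρ) : ContinuousOn (fun x => k (v x) (1 / 2 * Real.log (ρ / a (v x)))) T := by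
  have hs : ContinuousOn (fun x => 1 / 2 * Real.log (ρ / a (v x))) T :=
    continuousOn_const.mul (ContinuousOn.log (continuousOn_const.div (ha.comp_continuousOn hv)
      fun x hx => (hpos x hx).ne') fun x hx => (div_pos hρ (hpos x hx)).ne')
  exact hk.comp_continuousOn (hs.prodMk hv)

lemma A_kappa_log {u : H1r} {ρ : ℝ} (hρ : 0 < ρ) (hA : 0 < A u) :
    A (kappa u (1 / 2 * Real.log (ρ / A u))) = ρ := by
  rw [A_kappa, ← mul_assoc, mul_one_div_cancel two_ne_zero, one_mul, Real.exp_log (div_pos hρ hA),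
    div_mul_cancel₀ _ hA.ne']

lemma exists_kappa_mem_Bset {V : ℕ → Submodule ℝ H1r} {n : ℕ} [FiniteDimensional ℝ (V (n - 1))]
    {v : (Fin (Module.finrank ℝ (V (n - 1)) + 1) → ℝ) → H1r} (hvc : ContinuousOn v {0}ᶜ)
    (hvneg : ∀ x, v (-x) = -v x) (hv : ∀ x, x ≠ 0 → v x ∈ S c)
    (hA0 : ∀ x, x ≠ 0 → 0 < A (v x)) (hρ0 : 0 < rho p c V n) :
    ∃ x s, x ≠ 0 ∧ kappa (v x) s ∈ Bset p c V n := by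
  have hkc := continuousOn_comp_log continuous_kappa continuous_A hvc hA0 hρ0
  obtain ⟨x, hx, hmem⟩ := exists_mem_orthogonal (V (n - 1)) hkc (fun x _ => by
    simp only [hvneg, A_neg, kappa_neg])
  exact ⟨x, _, hx, hmem, (D_kappa _ _).trans (hv x hx), A_kappa_log hρ0 (hA0 x hx)⟩

lemma exists_F_gbar_zero_pos (hp : 10 / 3 < p) (hc : 0 < c) {V : ℕ → Submodule ℝ H1r}
    (hVmono : StrictMono V) (hVfin : ∀ m, FiniteDimensional ℝ (V m)) {n : ℕ} (hn : 1 ≤ n)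
    (hb : 1 ≤ bn p c V n) {θ : ℝ} (hθ : IsScale p c V n θ) :
    ∃ u ∈ S c ∩ (V n : Set H1r), 0 < F p (gbar θ 0 u) := by
  have := hVfin n
  have := hVfin (n - 1)
  have hlt : V (n - 1) < V n := hVmono (by omega)
  obtain ⟨v, hvc, hvneg, hv⟩ := exists_odd_map_level continuous_D (fun u => D_pos) D_smul hc hlt
  have hρ0 : 0 < rho p c V n := by
    have h1 : (fun _ => 1 : Fin (Module.finrank ℝ (V (n - 1)) + 1) → ℝ) ≠ 0 := fun h => by
      simpa using congrFun h 0
    exact (A_nonneg _).trans_lt (hθ.2 _ (hv _ h1)).1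
  have hA0 : ∀ x, x ≠ 0 → 0 < A (v x) := fun x hx => by
    have h := hρ0.trans (hθ.2 _ (hv x hx)).2.1
    rw [gbar, A_kappa] at h
    exact pos_of_mul_pos_right h (Real.exp_pos _).le
  obtain ⟨x, s, hx, hB⟩ := exists_kappa_mem_Bset hvc hvneg (fun x hx => (hv x hx).1) hA0 hρ0
  have hF : 0 < F p (kappa (v x) s) := by linarith [bn_le_F hb hB]
  refine ⟨v x, hv x hx, F_kappa_pos_of_lt hp ?_ hF⟩
  have h := (hθ.2 _ (hv x hx)).1
  rw [gbar, A_kappa, ← hB.2.2, A_kappa] at h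
  have h2 := Real.exp_lt_exp.1 (lt_of_mul_lt_mul_right h (hA0 x hx).le)
  linarith

lemma gam_pos (hp : 10 / 3 < p) (hp' : p < 6) (hc : 0 < c) {V : ℕ → Submodule ℝ H1r}
    (hVmono : StrictMono V) (hVfin : ∀ m, FiniteDimensional ℝ (V m)) {n : ℕ} (hn : 1 ≤ n)
    (hb : 1 ≤ bn p c V n) {θ : ℝ} (hθ : IsScale p c V n θ) : 0 < gam p c V n θ := by
  obtain ⟨u, hu, hpos⟩ := exists_F_gbar_zero_pos hp hc hVmono hVfin hn hb hθ
  refine hpos.trans_le (le_csInf ⟨_, _, gbar_mem_Gam V n θ, rfl⟩ ?_)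
  rintro _ ⟨g, ⟨hgc, -, -, hg⟩, rfl⟩
  have := hVfin n
  have hbdd := (isCompact_Icc.prod (isCompact_sphere_inter (c := c) (V n))).bddAbove_image
    ((continuous_F (by linarith : 3 < p) hp').comp_continuousOn hgc)
  refine le_csSup hbdd ⟨(0, u), ⟨by simp, hu⟩, ?_⟩
  simp only [(hg u hu).1]

/-! ### Constrained Palais–Smale sequences -/


lemma norm_sub_smul_le_of_apply_eq {E : Type*} [NormedAddCommGroup E] [NormedSpace ℝ E]
    (f ℓ : StrongDual ℝ E) {u : E} (hc : 0 < c) (hu : ℓ u = c) :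
    ‖f - (f u / c) • ℓ‖ ≤ ‖f.comp ℓ.ker.subtypeL‖ * (1 + ‖ℓ‖ * ‖u‖ / c) := by
  refine ContinuousLinearMap.opNorm_le_bound _ (by positivity) fun φ => ?_
  have hmem : φ - (ℓ φ / c) • u ∈ ℓ.ker := by
    rw [LinearMap.mem_ker]
    change ℓ (φ - (ℓ φ / c) • u) = 0
    rw [map_sub, map_smul, hu, smul_eq_mul, div_mul_cancel₀ _ hc.ne', sub_self]
  have e : (f - (f u / c) • ℓ) φ = (f.comp ℓ.ker.subtypeL) ⟨_, hmem⟩ := by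
    change f φ - f u / c * ℓ φ = f (φ - (ℓ φ / c) • u)
    rw [map_sub, map_smul, smul_eq_mul]
    ring
  rw [e, mul_assoc]
  refine (ContinuousLinearMap.le_opNorm _ _).trans
    (mul_le_mul_of_nonneg_left ?_ (norm_nonneg _))
  change ‖φ - (ℓ φ / c) • u‖ ≤ _
  refine (norm_sub_le _ _).trans ?_
  rw [norm_smul, norm_div, Real.norm_of_nonneg hc.le]
  have h := mul_le_mul_of_nonneg_right (ℓ.le_opNorm φ) (norm_nonneg u)
  have h2 : ‖ℓ φ‖ / c * ‖u‖ ≤ ‖ℓ‖ * ‖φ‖ * ‖u‖ / c := by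
    rw [div_mul_eq_mul_div]
    exact div_le_div_of_nonneg_right h hc.le
  calc _ ≤ ‖φ‖ + ‖ℓ‖ * ‖φ‖ * ‖u‖ / c := by linarith
    _ = _ := by ring

lemma exists_norm_le_of_F_Q (hp : 10 / 3 < p) {u : ℕ → H1r} (huS : ∀ k, u k ∈ S c) {γ : ℝ}
    (huF : Tendsto (fun k => F p (u k)) atTop (𝓝 γ))
    (huQ : Tendsto (fun k => Q p (u k)) atTop (𝓝 0)) : ∃ M, 0 ≤ M ∧ ∀ k, ‖u k‖ ≤ M := by
  set q := 2 / (3 * (p - 2)) with hq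
  have hp2 : 0 < p - 2 := by linarith
  have hq1 : q < 1 / 2 := by
    rw [hq, div_lt_div_iff₀ (by linarith) two_pos]
    linarith
  have hp0 : p ≠ 0 := by linarith
  obtain ⟨K, hK⟩ := (huF.sub (huQ.const_mul q)).bddAbove_range
  have hA : ∀ k, A (u k) ≤ K / (1 / 2 - q) := fun k => by
    rw [le_div_iff₀ (by linarith)]
    have h1 : F p (u k) - q * Q p (u k) ≤ K := hK ⟨k, rfl⟩
    have h2 : F p (u k) - q * Q p (u k) =
        (1 / 2 - q) * A (u k) + 1 / 4 * (1 - q) * B (u k) := by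
      rw [F, Q, hq]
      field_simp
      ring
    have h3 : 0 ≤ 1 / 4 * (1 - q) * B (u k) :=
      mul_nonneg (by linarith) (B_nonneg _)
    linarith
  refine ⟨Real.sqrt (c + K / (1 / 2 - q)), Real.sqrt_nonneg _, fun k => Real.le_sqrt_of_sq_le ?_⟩
  have h := huS k
  rw [S, Set.mem_ofPred_eq] at h
  rw [norm_sq_eq, h]
  linarith [hA k]

lemma exists_abs_energyDual_self_le (hp : 2 < p) (hp' : p < 6) (M : ℝ) :
    ∃ K, ∀ u : H1r, ‖u‖ ≤ M → |energyDual hp hp' u u| ≤ K := by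
  obtain ⟨K, hK0, hK⟩ := exists_abs_quart_le
  obtain ⟨K', hK0', hK'⟩ := exists_lpn_le hp hp'
  refine ⟨M ^ 2 + K * M * M * M * M + (K' * M) ^ p, fun u hu => ?_⟩
  have hM : 0 ≤ M := (norm_nonneg u).trans hu
  have h1 : A u ≤ M ^ 2 := (A_le_norm_sq u).trans (pow_le_pow_left₀ (norm_nonneg _) hu 2)
  have h2 : |B u| ≤ K * M * M * M * M := by
    rw [B_eq_quart]
    exact (hK u u u u).trans (by gcongr)
  have h3 : C p u ≤ (K' * M) ^ p := by
    rw [integral_rpow_eq hp hp']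
    exact Real.rpow_le_rpow (lpn_nonneg p u) ((hK' u).trans (by gcongr)) (by linarith)
  rw [energyDual_self, abs_le]
  have h4 := abs_le.1 h2
  have h5 := A_nonneg u
  have h6 := C_nonneg (p := p) u
  have h7 : 0 ≤ M ^ 2 := by positivity
  have h8 : 0 ≤ (K' * M) ^ p := by positivity
  constructor <;> linarith [h4.1, h4.2]

lemma exists_abs_quart_le_lpn (hp : 3 < p) (hp' : p < 6) {R : ℝ} (hR : 0 < R) :
    ∃ K : ℝ, 0 ≤ K ∧ ∀ a b v w : H1r, |quart a b v w| ≤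
      (K * (lpn p a * lpn p b) + R⁻¹ * (‖a‖ * ‖b‖)) * (‖v‖ * ‖w‖) := by
  obtain ⟨K, hK0, hK⟩ := exists_abs_pot_le hp hp' hR
  exact ⟨K, hK0, fun a b v w =>
    (bounded_weight (aestronglyMeasurable_pot a b) (fun x => (hK a b x).2) v w).2⟩

lemma tendsto_quart_zero (hp : 3 < p) (hp' : p < 6) {M : ℝ} {a b v w : ℕ → H1r}
    (ha : Tendsto (fun k => lpn p (a k)) atTop (𝓝 0)) (haM : ∀ k, ‖a k‖ ≤ M)
    (hbM : ∀ k, ‖b k‖ ≤ M) (hvM : ∀ k, ‖v k‖ ≤ M) (hwM : ∀ k, ‖w k‖ ≤ M) :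
    Tendsto (fun k => quart (a k) (b k) (v k) (w k)) atTop (𝓝 0) := by
  have hM : 0 ≤ M := (norm_nonneg _).trans (haM 0)
  obtain ⟨K', hK0', hK'⟩ := exists_lpn_le (by linarith : 2 < p) hp'
  rw [Metric.tendsto_atTop]
  intro ε hε
  set R := 2 * (M ^ 4 + 1) / ε with hR
  have hR0 : 0 < R := by positivity
  obtain ⟨K, hK0, hK⟩ := exists_abs_quart_le_lpn hp hp' hR0
  have hlim : Tendsto (fun k => K * (lpn p (a k) * (K' * M)) * M ^ 2) atTop (𝓝 0) := by
    have := ((ha.mul_const (K' * M)).const_mul K).mul_const (M ^ 2)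
    simpa using this
  obtain ⟨N, hN⟩ := eventually_atTop.1 (hlim.eventually (Iio_mem_nhds (half_pos hε)))
  refine ⟨N, fun k hk => ?_⟩
  rw [dist_zero_right, Real.norm_eq_abs]
  have h1 : lpn p (b k) ≤ K' * M := (hK' _).trans (by gcongr; exact hbM k)
  have h2 : (K * (lpn p (a k) * lpn p (b k)) + R⁻¹ * (‖a k‖ * ‖b k‖)) * (‖v k‖ * ‖w k‖) ≤
      (K * (lpn p (a k) * (K' * M)) + R⁻¹ * (M * M)) * (M * M) := by
    have h3 := lpn_nonneg p (a k)
    have h4 := haM k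
    have h5 := hbM k
    have h6 := hvM k
    have h7 := hwM k
    gcongr
  have h3 : R⁻¹ * (M * M) * (M * M) < ε / 2 := by
    rw [hR, inv_div, div_mul_eq_mul_div, div_mul_eq_mul_div, div_lt_div_iff₀ (by positivity) two_pos]
    have : 0 < ε * 2 := by positivity
    nlinarith
  have h4 : K * (lpn p (a k) * (K' * M)) * M ^ 2 < ε / 2 := hN k hk
  calc _ ≤ _ := (hK _ _ _ _).trans h2
    _ = K * (lpn p (a k) * (K' * M)) * M ^ 2 + R⁻¹ * (M * M) * (M * M) := by ring
    _ < ε := by linarith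

lemma newtonDual_sub (v w φ : H1r) : newtonDual v φ - newtonDual w φ =
    quart (v - w) (v + w) v φ + quart (v - w) φ w w := by
  have h1 : quart v v v φ = quart (v - w) (v + w) v φ + quart w w v φ := by
    have hv : quart v v v φ = quart ((v - w) + w) v v φ := by rw [sub_add_cancel]
    have hw : quart (v - w) w v φ + quart w w v φ = quart v w v φ := by
      rw [← quart_add_left, sub_add_cancel]
    rw [quart_add_second, add_assoc, hw, hv, quart_add_left, quart_comm_left w v]
  have h2 : quart w w v φ = quart (v - w) φ w w + quart w w w φ := by
    rw [quart_symm (v - w), ← quart_add_third, sub_add_cancel]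
  rw [newtonDual_apply, newtonDual_apply, h1, h2]
  ring

/-- The nonlinear terms are continuous for the convergence in `L^p`. -/
lemma tendsto_nonlinear_sub (hp : 3 < p) (hp' : p < 6) {M : ℝ} {v φ : ℕ → H1r} {w : H1r}
    (hvM : ∀ k, ‖v k‖ ≤ M) (hφM : ∀ k, ‖φ k‖ ≤ M)
    (hv : Tendsto (fun k => lpn p (v k - w)) atTop (𝓝 0)) :
    Tendsto (fun k => newtonDual (v k) (φ k) - newtonDual w (φ k)) atTop (𝓝 0) ∧
    Tendsto (fun k => powDual (by linarith) hp' (v k) (φ k) - powDual (by linarith) hp' w (φ k))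
      atTop (𝓝 0) := by
  have hM : 0 ≤ M := (norm_nonneg _).trans (hvM 0)
  have hw0 := norm_nonneg w
  constructor
  · have h1 := tendsto_quart_zero hp hp' (M := M + ‖w‖) (b := fun k => v k + w) (v := v) (w := φ)
      hv (fun k => (norm_sub_le _ _).trans (by linarith [hvM k]))
      (fun k => (norm_add_le _ _).trans (by linarith [hvM k])) (fun k => by linarith [hvM k])
      (fun k => by linarith [hφM k])
    have h2 := tendsto_quart_zero hp hp' (M := M + ‖w‖) (b := φ) (v := fun _ => w)
      (w := fun _ => w) hv (fun k => (norm_sub_le _ _).trans (by linarith [hvM k]))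
      (fun k => by linarith [hφM k]) (fun _ => by linarith) (fun _ => by linarith)
    have h3 := h1.add h2
    rw [add_zero] at h3
    exact h3.congr fun k => (newtonDual_sub _ _ _).symm
  · obtain ⟨K, hK0, hK⟩ := exists_lpn_le (by linarith : 2 < p) hp'
    have hlim : Tendsto (fun k => (p - 1) * ((K * M + lpn p w) ^ (p - 2) * lpn p (v k - w) *
        (K * M))) atTop (𝓝 0) := by
      have := ((hv.const_mul ((K * M + lpn p w) ^ (p - 2))).mul_const (K * M)).const_mul (p - 1)
      simpa using this
    refine squeeze_zero_norm (fun k => ?_) hlim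
    rw [Real.norm_eq_abs]
    refine (abs_powDual_sub_le hp hp' _ _ _).trans (mul_le_mul_of_nonneg_left ?_ (by linarith))
    have h1 := lpn_nonneg p (v k - w)
    have h2 := lpn_nonneg p w
    have h3 := lpn_nonneg p (v k)
    have h4 : lpn p (v k) ≤ K * M := (hK _).trans (by gcongr; exact hvM k)
    have h5 : lpn p (φ k) ≤ K * M := (hK _).trans (by gcongr; exact hφM k)
    have h6 : (lpn p (v k) + lpn p w) ^ (p - 2) ≤ (K * M + lpn p w) ^ (p - 2) :=
      Real.rpow_le_rpow (by positivity) (by linarith) (by linarith)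
    have h7 := lpn_nonneg p (φ k)
    gcongr

lemma tendsto_sub_smul_zero {E : Type*} [NormedAddCommGroup E] [NormedSpace ℝ E] {f ℓ : ℕ → E}
    {l : ℕ → ℝ} {lam M : ℝ} (h : Tendsto (fun k => ‖f k - l k • ℓ k‖) atTop (𝓝 0))
    (hl : Tendsto l atTop (𝓝 lam)) (hM : ∀ k, ‖ℓ k‖ ≤ M) :
    Tendsto (fun k => f k - lam • ℓ k) atTop (𝓝 0) := by
  have hlim : Tendsto (fun k => ‖f k - l k • ℓ k‖ + |l k - lam| * M) atTop (𝓝 0) := by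
    simpa using h.add ((hl.sub_const lam).abs.mul_const M)
  refine squeeze_zero_norm (fun k => ?_) hlim
  have e : f k - lam • ℓ k = (f k - l k • ℓ k) + (l k - lam) • ℓ k := by
    rw [sub_smul]; abel
  rw [e]
  refine (norm_add_le _ _).trans (add_le_add le_rfl ?_)
  rw [norm_smul, Real.norm_eq_abs]
  exact mul_le_mul_of_nonneg_left (hM k) (abs_nonneg _)

lemma tendsto_dual_apply_zero {E : Type*} [NormedAddCommGroup E] [NormedSpace ℝ E]
    {R : ℕ → StrongDual ℝ E} (hR : Tendsto R atTop (𝓝 0)) {φ : ℕ → E} {M : ℝ}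
    (hφ : ∀ k, ‖φ k‖ ≤ M) : Tendsto (fun k => R k (φ k)) atTop (𝓝 0) := by
  have h := hR.norm.mul_const M
  rw [norm_zero, zero_mul] at h
  exact squeeze_zero_norm (fun k => ((R k).le_opNorm _).trans
    (mul_le_mul_of_nonneg_left (hφ k) (norm_nonneg _))) h

/-- A bounded sequence of almost critical points of a functional with derivative `f`, constrained
to a sphere with normal `ℓ`, has a weak limit and a Lagrange multiplier along a subsequence. -/
lemma exists_weak_limit_multiplier {E : Type*} [NormedAddCommGroup E] [InnerProductSpace ℝ E]
    [CompleteSpace E] [TopologicalSpace.SeparableSpace E] (f ℓ : E → StrongDual ℝ E) {M K : ℝ}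
    (hc : 0 < c) {u : ℕ → E} (huM : ∀ k, ‖u k‖ ≤ M) (hℓu : ∀ k, ℓ (u k) (u k) = c)
    (hℓ : ∀ v, ‖ℓ v‖ ≤ ‖v‖) (hK : ∀ k, |f (u k) (u k)| ≤ K)
    (hf : Tendsto (fun k => ‖(f (u k)).comp (ℓ (u k)).ker.subtypeL‖) atTop (𝓝 0)) :
    ∃ (lam : ℝ) (w : E) (τ : ℕ → ℕ), StrictMono τ ∧
      (∀ L : StrongDual ℝ E, Tendsto (fun k => L (u (τ k))) atTop (𝓝 (L w))) ∧
      Tendsto (fun k => f (u (τ k)) - lam • ℓ (u (τ k))) atTop (𝓝 0) ∧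
      ∀ (φ : ℕ → E) (M' : ℝ), (∀ k, ‖φ k‖ ≤ M') →
        Tendsto (fun k => f (u (τ k)) (φ k) - lam * ℓ (u (τ k)) (φ k)) atTop (𝓝 0) := by
  have hM : 0 ≤ M := (norm_nonneg _).trans (huM 0)
  have hlK : ∀ k, f (u k) (u k) / c ∈ Icc (-(K / c)) (K / c) := fun k => by
    refine abs_le.1 ?_
    rw [abs_div, abs_of_pos hc]
    exact div_le_div_of_nonneg_right (hK k) hc.le
  have hres : Tendsto (fun k => ‖f (u k) - (f (u k) (u k) / c) • ℓ (u k)‖) atTop (𝓝 0) := by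
    have hlim := hf.mul_const (1 + M * M / c)
    rw [zero_mul] at hlim
    refine squeeze_zero (fun _ => norm_nonneg _) (fun k => ?_) hlim
    refine (norm_sub_smul_le_of_apply_eq _ _ hc (hℓu k)).trans ?_
    have h1 := huM k
    have h2 : ‖ℓ (u k)‖ ≤ M := (hℓ _).trans h1
    gcongr
  obtain ⟨lam, -, σ, hσ, hlσ⟩ := isCompact_Icc.tendsto_subseq hlK
  obtain ⟨w, σ', hσ', hw⟩ := exists_weakly_convergent_subseq (u := fun k => u (σ k))
    (fun k => huM (σ k))
  have hτ : Tendsto (fun k => σ (σ' k)) atTop atTop := (hσ.comp hσ').tendsto_atTop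
  have hR := tendsto_sub_smul_zero (hres.comp hτ) (hlσ.comp hσ'.tendsto_atTop)
    fun k => (hℓ _).trans (huM _)
  exact ⟨lam, w, fun k => σ (σ' k), hσ.comp hσ', hw, hR,
    fun φ M' hφ => tendsto_dual_apply_zero hR hφ⟩

lemma norm_fderiv_comp_eq {E : Type*} [NormedAddCommGroup E] [NormedSpace ℝ E] {f : E → ℝ}
    {f' : StrongDual ℝ E} {u : E} (h : HasFDerivAt f f' u) (W : Submodule ℝ E) :
    ‖(fderiv ℝ f u).comp W.subtypeL‖ = ‖f'.comp W.subtypeL‖ := by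
  rw [h.fderiv]

lemma exists_weak_limit_multiplier_energy (hp : 3 < p) (hp2 : 2 < p) (hp' : p < 6) (hc : 0 < c)
    [TopologicalSpace.SeparableSpace H1r] {u : ℕ → H1r} {M : ℝ} (huM : ∀ k, ‖u k‖ ≤ M)
    (huS : ∀ k, u k ∈ S c)
    (huF' : Tendsto (fun k => constrainedDerivNorm p (u k)) atTop (𝓝 0)) :
    ∃ (lam : ℝ) (w : H1r) (τ : ℕ → ℕ), StrictMono τ ∧ WeaklyConverges (fun k => u (τ k)) w ∧
      Tendsto (fun k => energyDual hp2 hp' (u (τ k)) - lam • l2Dual (u (τ k))) atTop (𝓝 0) ∧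
      ∀ (φ : ℕ → H1r) (M' : ℝ), (∀ k, ‖φ k‖ ≤ M') → Tendsto (fun k =>
        energyDual hp2 hp' (u (τ k)) (φ k) - lam * l2Dual (u (τ k)) (φ k)) atTop (𝓝 0) := by
  obtain ⟨K, hK⟩ := exists_abs_energyDual_self_le hp2 hp' M
  have hf : ∀ k, constrainedDerivNorm p (u k) =
      ‖(energyDual hp2 hp' (u k)).comp (l2Dual (u k)).ker.subtypeL‖ :=
    fun k => norm_fderiv_comp_eq (hasFDerivAt_F hp hp' (u k)) (tangent (u k))
  simp only [hf] at huF'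
  exact exists_weak_limit_multiplier (energyDual hp2 hp') l2Dual hc huM
    (fun k => (l2Dual_self (u k)).trans (huS k)) norm_l2Dual_le (fun k => hK _ (huM k)) huF'

lemma tendsto_lpn_sub_of_weak (hp : 2 < p) (hp' : p < 6) {v : ℕ → H1r} {w : H1r} {M : ℝ}
    (hvM : ∀ k, ‖v k‖ ≤ M) (hw : WeaklyConverges v w) :
    Tendsto (fun k => lpn p (v k - w)) atTop (𝓝 0) := by
  refine tendsto_lpn_zero hp hp' (M := M + ‖w‖)
    (fun k => (norm_sub_le _ _).trans (by linarith [hvM k])) fun ℓ => ?_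
  have h := (hw ℓ).sub_const (ℓ w)
  rw [sub_self] at h
  exact h.congr fun k => (map_sub ℓ _ _).symm

set_option maxHeartbeats 1000000 in
lemma residual_weak_limit_eq_zero (hp : 3 < p) (hp2 : 2 < p) (hp' : p < 6) {v : ℕ → H1r} {w : H1r} {M lam : ℝ}
    (hvM : ∀ k, ‖v k‖ ≤ M) (hw : WeaklyConverges v w)
    (hR : ∀ (φ : ℕ → H1r) (M' : ℝ), (∀ k, ‖φ k‖ ≤ M') → Tendsto (fun k =>
      energyDual hp2 hp' (v k) (φ k) - lam * l2Dual (v k) (φ k)) atTop (𝓝 0))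
    (φ : H1r) : energyDual hp2 hp' w φ - lam * l2Dual w φ = 0 := by
  have hlpn := tendsto_lpn_sub_of_weak hp2 hp' hvM hw
  have hM : 0 ≤ M := (norm_nonneg _).trans (hvM 0)
  obtain ⟨h1, h2⟩ := tendsto_nonlinear_sub hp hp' (M := M + ‖φ‖) (φ := fun _ => φ)
    (fun k => (hvM k).trans (by linarith [norm_nonneg φ])) (fun _ => by linarith) hlpn
  have h3 := (hw (gradDual φ)).sub_const (gradDual φ w)
  have h4 := ((hw (l2Dual φ)).sub_const (l2Dual φ w)).const_mul lam
  have h5 := hR (fun _ => φ) _ (fun _ => le_rfl)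
  have h6 := (((h3.add h1).sub h2).sub h4)
  rw [sub_self, sub_self] at h6
  simp only [add_zero, mul_zero, sub_zero] at h6
  have h7 := h5.sub h6
  rw [sub_zero] at h7
  refine tendsto_nhds_unique (tendsto_const_nhds (f := (atTop : Filter ℕ)))
    (h7.congr fun k => ?_)
  rw [energyDual_apply, energyDual_apply, gradDual_comm φ, gradDual_comm φ, l2Dual_comm φ,
    l2Dual_comm φ]
  ring

lemma weak_limit_ne_zero (hp : 3 < p) (hp' : p < 6) {v : ℕ → H1r} {w : H1r} {M γ : ℝ}
    (hvM : ∀ k, ‖v k‖ ≤ M) (hw : WeaklyConverges v w) (hγ : γ ≠ 0)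
    (hvF : Tendsto (fun k => F p (v k)) atTop (𝓝 γ))
    (hvQ : Tendsto (fun k => Q p (v k)) atTop (𝓝 0)) : w ≠ 0 := by
  rintro rfl
  have hp2 : 2 < p := by linarith
  obtain ⟨h1, h2⟩ := tendsto_nonlinear_sub hp hp' hvM hvM
    (tendsto_lpn_sub_of_weak hp2 hp' hvM hw)
  have hB : Tendsto (fun k => B (v k)) atTop (𝓝 0) := h1.congr fun k => by
    have : newtonDual 0 (v k) = 0 := by
      rw [newtonDual_apply, ← zero_smul ℝ (0 : H1r), quart_smul_left, zero_mul]
    rw [this, newtonDual_apply, sub_zero, B_eq_quart]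
  have hC : Tendsto (fun k => C p (v k)) atTop (𝓝 0) := h2.congr fun k => by
    have : powDual hp2 hp' 0 (v k) = 0 := by
      rw [powDual_apply]
      refine (integral_congr_ae ?_).trans (integral_zero R3 ℝ)
      filter_upwards [fn_zero] with x hx
      rw [hx]
      simp
    rw [this, sub_zero, powDual_self]
  have hA : Tendsto (fun k => A (v k)) atTop (𝓝 0) := by
    have h := (hvQ.sub (hB.const_mul (1 / 4))).add (hC.const_mul (3 * (p - 2) / (2 * p)))
    simp only [mul_zero, sub_zero, add_zero] at h
    exact h.congr fun k => by rw [Q]; ring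
  have hF := ((hA.const_mul (1 / 2)).add (hB.const_mul (1 / 4))).sub (hC.const_mul (1 / p))
  simp only [mul_zero, sub_zero, add_zero] at hF
  exact hγ (tendsto_nhds_unique hvF hF)

set_option maxHeartbeats 1000000 in
lemma tendsto_of_weak_of_neg (hp : 3 < p) (hp2 : 2 < p) (hp' : p < 6) {v : ℕ → H1r} {w : H1r} {M lam : ℝ}
    (hvM : ∀ k, ‖v k‖ ≤ M) (hw : WeaklyConverges v w)
    (hR : ∀ (φ : ℕ → H1r) (M' : ℝ), (∀ k, ‖φ k‖ ≤ M') → Tendsto (fun k =>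
      energyDual hp2 hp' (v k) (φ k) - lam * l2Dual (v k) (φ k)) atTop (𝓝 0))
    (hlam : lam < 0) : Tendsto v atTop (𝓝 w) := by
  have hM : 0 ≤ M := (norm_nonneg _).trans (hvM 0)
  have hφM : ∀ k, ‖v k - w‖ ≤ M + ‖w‖ := fun k => (norm_sub_le _ _).trans (by linarith [hvM k])
  obtain ⟨h1, h2⟩ := tendsto_nonlinear_sub hp hp' (M := M + ‖w‖)
    (fun k => (hvM k).trans (by linarith [norm_nonneg w])) hφM
    (tendsto_lpn_sub_of_weak hp2 hp' hvM hw)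
  have h3 := ((hR _ _ hφM).sub h1).add h2
  simp only [sub_zero, add_zero] at h3
  have hself : ∀ k, energyDual hp2 hp' w (v k - w) - lam * l2Dual w (v k - w) = 0 :=
    fun k => residual_weak_limit_eq_zero hp hp2 hp' hvM hw hR _
  have h4 : Tendsto (fun k => A (v k - w) + -lam * D (v k - w)) atTop (𝓝 0) := by
    refine h3.congr fun k => ?_
    have e := hself k
    have eA : A (v k - w) = gradDual (v k) (v k - w) - gradDual w (v k - w) := by
      rw [← gradDual_self, gradDual_comm (v k), gradDual_comm w, ← map_sub]
    have eD : D (v k - w) = l2Dual (v k) (v k - w) - l2Dual w (v k - w) := by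
      rw [← l2Dual_self, l2Dual_comm (v k), l2Dual_comm w, ← map_sub]
    rw [energyDual_apply] at e
    rw [eA, eD, energyDual_apply]
    linear_combination e
  have hm : 0 < min 1 (-lam) := lt_min one_pos (by linarith)
  have h5 : Tendsto (fun k => ‖v k - w‖ ^ 2) atTop (𝓝 0) := by
    have h6 := h4.div_const (min 1 (-lam))
    rw [zero_div] at h6
    refine squeeze_zero (fun _ => by positivity) (fun k => ?_) h6
    rw [le_div_iff₀ hm, norm_sq_eq]
    have hA := A_nonneg (v k - w)
    have hD := D_nonneg (v k - w)
    have m1 := mul_le_mul_of_nonneg_left (min_le_left 1 (-lam)) hA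
    have m2 := mul_le_mul_of_nonneg_left (min_le_right 1 (-lam)) hD
    linarith
  rw [tendsto_iff_norm_sub_tendsto_zero]
  have h7 := h5.sqrt
  simpa [Real.sqrt_sq (norm_nonneg _)] using h7

end SchrodingerPoisson

end

open SchrodingerPoisson
theorem proposition2p1 (p c : ℝ) (hp : 10 / 3 < p) (hp' : p < 6) (hc : 0 < c)
    (V : ℕ → Submodule ℝ H1r) (hVmono : StrictMono V) (hVfin : ∀ m, FiniteDimensional ℝ (V m))
    (hVdense : Dense (⋃ m, (V m : Set H1r)))
    (n : ℕ) (hn : 1 ≤ n) (hb : 1 ≤ bn p c V n)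
    (θ : ℝ) (hθ : IsScale p c V n θ)
    (u : ℕ → H1r) (huS : ∀ k, u k ∈ S c)
    (huF : Tendsto (fun k => F p (u k)) atTop (𝓝 (gam p c V n θ)))
    (huF' : Tendsto (fun k => constrainedDerivNorm p (u k)) atTop (𝓝 0))
    (huQ : Tendsto (fun k => Q p (u k)) atTop (𝓝 0)) :
    ∃ (lam : ℝ) (w : H1r) (τ : ℕ → ℕ), StrictMono τ ∧
      (WeaklyConverges (fun k => u (τ k)) w ∧ w ≠ 0) ∧
      (∃ R : ℕ → StrongDual ℝ H1r,
        (∀ k φ, R k φ = eqResidual p lam (u (τ k)) φ) ∧ Tendsto R atTop (𝓝 0)) ∧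
      (∀ φ : H1r, eqResidual p lam w φ = 0) ∧
      (lam < 0 →
        Tendsto (fun k => u (τ k)) atTop (𝓝 w) ∧ D w = c ∧ F p w = gam p c V n θ ∧
          HasFDerivAt (F p) (lam • l2Dual w) w) := by
  have hp3 : 3 < p := by linarith
  have hp2 : 2 < p := by linarith
  have := separableSpace_of_dense_iUnion hVfin hVdense
  obtain ⟨M, -, hM⟩ := exists_norm_le_of_F_Q hp huS huF huQ
  obtain ⟨lam, w, τ, hτ, hw, hR, hRφ⟩ := exists_weak_limit_multiplier_energy hp3 hp2 hp' hc hM huS huF'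
  have hvM : ∀ k, ‖u (τ k)‖ ≤ M := fun k => hM _
  have hvF := huF.comp hτ.tendsto_atTop
  have hvQ := huQ.comp hτ.tendsto_atTop
  have heq := residual_weak_limit_eq_zero hp3 hp2 hp' hvM hw hRφ
  refine ⟨lam, w, τ, hτ, ⟨hw, ?_⟩, ⟨_, fun k φ => (eqResidual_eq hp2 hp' lam _ φ).symm, hR⟩,
    fun φ => (eqResidual_eq hp2 hp' lam w φ).trans (heq φ), fun hlam => ?_⟩
  · exact weak_limit_ne_zero hp3 hp' hvM hw (gam_pos hp hp' hc hVmono hVfin hn hb hθ).ne' hvF hvQ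
  · have hlim := tendsto_of_weak_of_neg hp3 hp2 hp' hvM hw hRφ hlam
    refine ⟨hlim, ?_, ?_, ?_⟩
    · refine tendsto_nhds_unique ((continuous_D.tendsto w).comp hlim) ?_
      exact tendsto_const_nhds.congr fun k => (huS (τ k)).symm
    · exact tendsto_nhds_unique (((continuous_F hp3 hp').tendsto w).comp hlim) hvF
    · have e : energyDual hp2 hp' w = lam • l2Dual w :=
        ContinuousLinearMap.ext fun φ => sub_eq_zero.1 (heq φ)
      exact e ▸ hasFDerivAt_F hp3 hp' w
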